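/- Let $\Omega\subseteq\mathbb R^n$ be open and connected, let $\lambda_1,\dots,\lambda_n\in C^\infty(\Omega)$, and consider the diagonal system $$\partial_t w_i+\lambda_i(w)\,\partial_x w_i=0\quad(1\le i\le n),\ t>0,\ x\in\mathbb R,\qquad w(0,x)=w^0(x).$$ Assume that on $\Omega$ the system is strictly hyperbolic ($\lambda_1<\dots<\lambda_n$), linearly degenerate ($\partial\lambda_i/\partial w_i=0$ for all $i$), and rich with one and the same function for all characteristics: there is a positive $N\in C^\infty(\Omega)$ with $(\lambda_j-\lambda_i)\,\partial N/\partial w_j=N\,\partial\lambda_i/\partial w_j$ for all $i,j$. Let $w^0:\mathbb R\to\mathbb R^n$ take its values in a compact box $\prod_i[a_i,b_i]\subseteq\Omega$, let $w^0-\bar w\in L^1(\mathbb R)$ and $\lim_{x\to\pm\infty}w^0(x)=\bar w$, where $\bar w\in\mathbb R^n$. An entropy solution is a measurable $w$ on $(0,\infty)\times\mathbb R$ with values a.e. in a compact subset of $\Omega$, such that for all $i$ the equations $\partial_tN(w)+\partial_x(N(w)\lambda_i(w))=0$ and $\partial_t(N(w)w_i)+\partial_x(N(w)\lambda_i(w)w_i)=0$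 hold in the sense of distributions with initial data $N(w^0)$ and $N(w^0)w_i^0$. There are constants $\tilde\lambda_1,\dots,\tilde\lambda_n$ such that $N\lambda_i-\tilde\lambda_i$ is the same function on $\Omega$ for all $i$ (they are unique up to a common additive constant); fix any such constants. Put $\bar\lambda_i=\lambda_i(\bar w)$, $Z^0(x)=\int_0^xN(w^0(\xi))\,d\xi$, $X^0=(Z^0)^{-1}$, $\tilde w^0=w^0\circ X^0$, $\tilde w_i(t,z)=\tilde w^0_i(z-\tilde\lambda_it)$, and let $\bar w^{[j]}(s)$ be the vector $\bar w$ with $j$-th entry replaced by $s$. Define $\psi_i(x)=x+\psi_{i1}(x)+\psi_{i2}(x)$ as follows, where $k$ is any index different from $i$ (needed only if $\tilde\lambda_i\neq0$). If $\tilde\lambda_i>0$: $$\psi_{i1}(x)=\sum_{j>i}\frac1{\tilde\lambda_j-\tilde\lambda_i}\int_{-\infty}^{\infty}\big(\lambda_i(\bar w^{[j]}(\tilde w^0_j(\xi)))-\bar\lambda_i\big)d\xi+\frac1{\tilde\lambda_i-\tilde\lambda_k}\int_{Z^0(x)}^{\infty}\big(\lambda_k(\bar w^{[i]}(\tilde w^0_i(\xi)))-\bar\lambda_k\big)d\xi,$$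 $$\psi_{i2}(x)=\int_{Z^0(x)}^{\infty}\Big(\frac1{N(\tilde w^0(\xi))}-\frac1{N(\bar w)}\Big)d\xi.$$ If $\tilde\lambda_i=0$: $$\psi_{i1}(x)=\int_0^\infty\big(\lambda_i(\tilde w(\tau,Z^0(x)))-\bar\lambda_i\big)d\tau,\qquad\psi_{i2}(x)=0.$$ If $\tilde\lambda_i<0$: $$\psi_{i1}(x)=\sum_{j<i}\frac1{\tilde\lambda_i-\tilde\lambda_j}\int_{-\infty}^{\infty}\big(\lambda_i(\bar w^{[j]}(\tilde w^0_j(\xi)))-\bar\lambda_i\big)d\xi+\frac1{\tilde\lambda_i-\tilde\lambda_k}\int_{Z^0(x)}^{-\infty}\big(\lambda_k(\bar w^{[i]}(\tilde w^0_i(\xi)))-\bar\lambda_k\big)d\xi,$$ $$\psi_{i2}(x)=\int_{Z^0(x)}^{-\infty}\Big(\frac1{N(\tilde w^0(\xi))}-\frac1{N(\bar w)}\Big)d\xi.$$ **Theorem.** The Cauchy problem has an entropy solution $w$, it is unique up to null sets of $(0,\infty)\times\mathbb R$, and it has a representative for which $t\mapsto w(t,\cdot)$ is continuous from $[0,\infty)$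 to $L^1_{loc}(\mathbb R)$. For this representative and every $i$ the following holds: if $\psi_i$ is Lipschitz on $\mathbb R$ and $\psi_i'\ge C_0$ a.e. for some constant $C_0>0$, then, with $\phi_i=\psi_i^{-1}$, $$\lim_{t\to+\infty}\big\|w_i(t,\cdot)-w_i^0\big(\phi_i(\cdot-\bar\lambda_i t)\big)\big\|_{L^1(\mathbb R)}=0.$$ -/

import Mathlib

open MeasureTheory Set Filter
open scoped Topology ContDiff

noncomputable section

/-- The `j`-th partial derivative of a real function on `ℝⁿ`. -/
def pderivW {n : ℕ} (j : Fin n) (f : (Fin n → ℝ) → ℝ) (w : Fin n → ℝ) : ℝ :=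
  fderiv ℝ f w (Pi.single j 1)

/-- The diagonal system `∂ₜ wᵢ + λᵢ(w) ∂ₓ wᵢ = 0` on a domain `Ω ⊆ ℝⁿ` has smooth coefficients, is
strictly hyperbolic (`λ₁ < ⋯ < λₙ` on `Ω`), linearly degenerate (`∂λᵢ/∂wᵢ = 0`) and rich, with one
and the same positive smooth function `N` for all characteristic families:
`(λⱼ - λᵢ) ∂N/∂wⱼ = N ∂λᵢ/∂wⱼ`. -/
structure IsRichSystem {n : ℕ} (Ω : Set (Fin n → ℝ)) (lam : Fin n → (Fin n → ℝ) → ℝ)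
    (N : (Fin n → ℝ) → ℝ) : Prop where
  isOpen : IsOpen Ω
  isPreconnected : IsPreconnected Ω
  contDiffOn_lam : ∀ i, ContDiffOn ℝ ∞ (lam i) Ω
  contDiffOn_N : ContDiffOn ℝ ∞ N Ω
  strictlyHyperbolic : ∀ w ∈ Ω, StrictMono (fun i => lam i w)
  linearlyDegenerate : ∀ w ∈ Ω, ∀ i, pderivW i (lam i) w = 0
  N_pos : ∀ w ∈ Ω, 0 < N w
  rich : ∀ w ∈ Ω, ∀ i j,
    (lam j w - lam i w) * pderivW j N w = N w * pderivW j (lam i) w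

/-- Lebesgue measure on the open half plane `{(t, x) | t > 0}`. -/
def halfPlane : Measure (ℝ × ℝ) := volume.restrict (Ioi 0 ×ˢ univ)

/-- `w` is an (`L^∞`) entropy solution of the Cauchy problem with initial data `w0`: the equalities
`∂ₜ N(w) + ∂ₓ (N(w) λᵢ(w)) = 0` and `∂ₜ (N(w) wᵢ) + ∂ₓ (N(w) λᵢ(w) wᵢ) = 0` hold, for all `i`, in
the sense of distributions, the initial data being included in the weak formulation through test
functions that need not vanish at `t = 0`. As the coefficients are only defined on `Ω`, membership
in `L^∞` means that the values lie almost everywhere in a compact subset of `Ω` (for `Ω = ℝⁿ` this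
is essential boundedness). -/
structure IsEntropySolution {n : ℕ} (Ω : Set (Fin n → ℝ)) (lam : Fin n → (Fin n → ℝ) → ℝ)
    (N : (Fin n → ℝ) → ℝ) (w0 : ℝ → Fin n → ℝ) (w : ℝ → ℝ → Fin n → ℝ) : Prop where
  aestronglyMeasurable : AEStronglyMeasurable (fun p : ℝ × ℝ => w p.1 p.2) halfPlane
  bounded : ∃ K ⊆ Ω, IsCompact K ∧ ∀ᵐ p ∂halfPlane, w p.1 p.2 ∈ K
  entropy_N : ∀ i, ∀ φ : ℝ × ℝ → ℝ, ContDiff ℝ ∞ φ → HasCompactSupport φ →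
    (∫ p, (N (w p.1 p.2) * fderiv ℝ φ p (1, 0)
        + N (w p.1 p.2) * lam i (w p.1 p.2) * fderiv ℝ φ p (0, 1)) ∂halfPlane)
      + ∫ x, N (w0 x) * φ (0, x) = 0
  entropy_Nw : ∀ i, ∀ φ : ℝ × ℝ → ℝ, ContDiff ℝ ∞ φ → HasCompactSupport φ →
    (∫ p, (N (w p.1 p.2) * w p.1 p.2 i * fderiv ℝ φ p (1, 0)
        + N (w p.1 p.2) * lam i (w p.1 p.2) * w p.1 p.2 i * fderiv ℝ φ p (0, 1)) ∂halfPlane)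
      + ∫ x, N (w0 x) * w0 x i * φ (0, x) = 0

/-- `t ↦ w(t, ·)` is continuous from `[0, ∞)` into `L¹_loc(ℝ)`. Every `L^∞` class of functions on
the half plane has at most one such representative, up to null sets of `x` for each `t`. -/
def ContinuousInL1loc {n : ℕ} (w : ℝ → ℝ → Fin n → ℝ) : Prop :=
  (∀ t, 0 ≤ t → LocallyIntegrable (w t) volume) ∧
  ∀ s, 0 ≤ s → ∀ R : ℝ,
    Tendsto (fun t => eLpNorm (fun x => w t x - w s x) 1 (volume.restrict (Icc (-R) R)))
      (𝓝[Ici 0] s) (𝓝 0)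

/-- The constants `λ̃ᵢ` for which `N λᵢ - λ̃ᵢ = M` with a function `M` that does not depend on `i`
(they are determined up to a common additive constant). -/
def IsLagrangianSpeeds {n : ℕ} (Ω : Set (Fin n → ℝ)) (lam : Fin n → (Fin n → ℝ) → ℝ)
    (N : (Fin n → ℝ) → ℝ) (lamT : Fin n → ℝ) : Prop :=
  ∃ M : (Fin n → ℝ) → ℝ, ∀ w ∈ Ω, ∀ i, N w * lam i w - lamT i = M w

/-- `Z⁰(x) = ∫₀ˣ N(w⁰(ξ)) dξ`. -/
def Z0 {n : ℕ} (N : (Fin n → ℝ) → ℝ) (w0 : ℝ → Fin n → ℝ) (x : ℝ) : ℝ :=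
  ∫ ξ in (0 : ℝ)..x, N (w0 ξ)

/-- `X⁰`, the inverse function of `Z⁰`. -/
def X0 {n : ℕ} (N : (Fin n → ℝ) → ℝ) (w0 : ℝ → Fin n → ℝ) : ℝ → ℝ :=
  Function.invFun (Z0 N w0)

/-- `w̃⁰ = w⁰ ∘ X⁰`. -/
def wTilde0 {n : ℕ} (N : (Fin n → ℝ) → ℝ) (w0 : ℝ → Fin n → ℝ) (z : ℝ) : Fin n → ℝ :=
  w0 (X0 N w0 z)

/-- `w̃ᵢ(t, z) = w̃⁰ᵢ(z - λ̃ᵢ t)`. -/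
def wTilde {n : ℕ} (N : (Fin n → ℝ) → ℝ) (w0 : ℝ → Fin n → ℝ) (lamT : Fin n → ℝ) (t z : ℝ) :
    Fin n → ℝ :=
  fun i => wTilde0 N w0 (z - lamT i * t) i

/-- The function `ψᵢ₁`; `k` is the auxiliary index with `λₖ ≠ λᵢ` in its definition. By strict
hyperbolicity, `λⱼ > λᵢ` means `j > i`. -/
def psi1 {n : ℕ} (lam : Fin n → (Fin n → ℝ) → ℝ) (N : (Fin n → ℝ) → ℝ) (w0 : ℝ → Fin n → ℝ)
    (wbar : Fin n → ℝ) (lamT : Fin n → ℝ) (i k : Fin n) (x : ℝ) : ℝ :=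
  if 0 < lamT i then
    (∑ j ∈ Finset.Ioi i, 1 / (lamT j - lamT i) *
      ∫ ξ, (lam i (Function.update wbar j (wTilde0 N w0 ξ j)) - lam i wbar))
    + 1 / (lamT i - lamT k) *
      ∫ ξ in Ioi (Z0 N w0 x), (lam k (Function.update wbar i (wTilde0 N w0 ξ i)) - lam k wbar)
  else if lamT i = 0 then
    ∫ τ in Ioi (0 : ℝ), (lam i (wTilde N w0 lamT τ (Z0 N w0 x)) - lam i wbar)
  else
    (∑ j ∈ Finset.Iio i, 1 / (lamT i - lamT j) *
      ∫ ξ, (lam i (Function.update wbar j (wTilde0 N w0 ξ j)) - lam i wbar))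
    + 1 / (lamT i - lamT k) *
      (-∫ ξ in Iic (Z0 N w0 x), (lam k (Function.update wbar i (wTilde0 N w0 ξ i)) - lam k wbar))

/-- The function `ψᵢ₂`. -/
def psi2 {n : ℕ} (N : (Fin n → ℝ) → ℝ) (w0 : ℝ → Fin n → ℝ)
    (wbar : Fin n → ℝ) (lamT : Fin n → ℝ) (i : Fin n) (x : ℝ) : ℝ :=
  if 0 < lamT i then
    ∫ ξ in Ioi (Z0 N w0 x), (1 / N (wTilde0 N w0 ξ) - 1 / N wbar)
  else if lamT i = 0 then 0
  else
    -∫ ξ in Iic (Z0 N w0 x), (1 / N (wTilde0 N w0 ξ) - 1 / N wbar)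

/-- `ψᵢ(x) = x + ψᵢ₁(x) + ψᵢ₂(x)`. -/
def psi {n : ℕ} (lam : Fin n → (Fin n → ℝ) → ℝ) (N : (Fin n → ℝ) → ℝ) (w0 : ℝ → Fin n → ℝ)
    (wbar : Fin n → ℝ) (lamT : Fin n → ℝ) (i k : Fin n) (x : ℝ) : ℝ :=
  x + psi1 lam N w0 wbar lamT i k x + psi2 N w0 wbar lamT i x

end

noncomputable section

/-! ### Lipschitz functions of one variable -/

/-! The proof passes to Lagrangian coordinates, in which the system is linear and decoupled. Let `v`
be an entropy solution, continued to `t ≤ 0` by the initial data with zero flux; the initial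
condition then becomes part of a divergence equation on the whole plane. The field `(N, N λᵢ)` is
divergence-free, so it has a Lipschitz potential `Yᵢ` with `∂ₓ Yᵢ = N` and `∂ₜ Yᵢ = -N λᵢ` for `t >
0` (`IsDivFree.exists_isPotential`). Its level lines are the `i`-th characteristics. The second
equation gives a `P` with `∇P = vᵢ ∇Yᵢ`, so `vᵢ` is a function of `Yᵢ` alone, and negative times
identify this function as `w̃⁰ᵢ` (`ae_eq_comp_of_isPotential`).

Richness makes `N (λᵢ - λⱼ)` the constant `λ̃ᵢ - λ̃ⱼ`. Hence `Yᵢ = Z - λ̃ᵢ t⁺` with a single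
Lagrangian coordinate `Z`, and `v = w̃(t⁺, Z)`. Only `Z` remains to be found. The inverse of `Z(t,
·)` has gradient `(λᵢ - λ̃ᵢ / N, 1 / N)` for `t > 0`, evaluated at the known state `w̃`, so it is
determined; this is uniqueness (`IsCauchyData.ae_eq_richSol`). Linear degeneracy makes `1 / N` and
`λᵢ - λ̃ᵢ / N` sums of functions of single `wⱼ` on the box (`IsRichSystem.mixed_difference`). As
each `w̃ⱼ` moves at constant speed `λ̃ⱼ`, the inverse is the explicit function `position`; reading
the argument backwards gives existence.

For the asymptotics, evaluate `position` along `z = y + λ̃ᵢ t`. The term of index `j` is the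
primitive `incrInt` at `y + (λ̃ᵢ - λ̃ⱼ) t`, which tends to its limit at `+∞` for `j < i` and at `-∞`
for `j > i`, while the `i`-th term is stationary. So the position minus `λ̄ᵢ t` tends to
`asymPosition`, which equals `ψᵢ ∘ X⁰` (`IsCauchyData.psi_X0`). After inversion, the characteristic
coordinates in the moving frame converge pointwise, at bounded distance and with slopes bounded
below; for such maps, composition with an integrable function converges in `L¹`
(`tendsto_eLpNorm_comp_sub`). -/

theorem LipschitzWith.eq_of_ae_hasDerivAt_zero {f : ℝ → ℝ} {L : NNReal} (hf : LipschitzWith L f)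
    {a b : ℝ} (h : ∀ᵐ x, x ∈ uIcc a b → HasDerivAt f 0 x) : f a = f b := by
  obtain ⟨c, hc⟩ :=
    (hf.lipschitzOnWith (s := uIcc a b)).absolutelyContinuousOnInterval.const_of_ae_hasDerivAt_zero h
  rw [hc a left_mem_uIcc, hc b right_mem_uIcc]

theorem LipschitzWith.mul_sub_le_of_ae_hasDerivAt {f f' : ℝ → ℝ} {L : NNReal}
    (hf : LipschitzWith L f) {m : ℝ} (h : ∀ᵐ x, HasDerivAt f (f' x) x) (hm : ∀ᵐ x, m ≤ f' x)
    {a b : ℝ} (hab : a ≤ b) : m * (b - a) ≤ f b - f a := by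
  have hac := (hf.lipschitzOnWith (s := uIcc a b)).absolutelyContinuousOnInterval
  rw [← hac.integral_deriv_eq_sub]
  have : m * (b - a) = ∫ _ in a..b, m := by simp [mul_comm]
  rw [this]
  refine intervalIntegral.integral_mono_ae hab (by simp) hac.intervalIntegrable_deriv ?_
  filter_upwards [h, hm] with x hx hmx
  rwa [hx.deriv]

/-! ### Lipschitz functions on the plane with prescribed gradient -/

/-- The linear form `(s, y) ↦ α s + β y`. -/
def gradForm (α β : ℝ) : ℝ × ℝ →L[ℝ] ℝ :=
  α • ContinuousLinearMap.fst ℝ ℝ ℝ + β • ContinuousLinearMap.snd ℝ ℝ ℝ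

@[simp] theorem gradForm_apply (α β : ℝ) (p : ℝ × ℝ) : gradForm α β p = α * p.1 + β * p.2 := rfl

/-- `Y` is Lipschitz on the plane, with gradient `(α, β)` almost everywhere. -/
structure IsPotential (Y α β : ℝ × ℝ → ℝ) : Prop where
  lipschitz : ∃ L, LipschitzWith L Y
  ae_hasFDerivAt : ∀ᵐ p, HasFDerivAt Y (gradForm (α p) (β p)) p

theorem HasFDerivAt.hasDerivAt_fst {Y : ℝ × ℝ → ℝ} {α β : ℝ} {p : ℝ × ℝ}
    (h : HasFDerivAt Y (gradForm α β) p) : HasDerivAt (fun s => Y (s, p.2)) α p.1 := by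
  have h1 : HasDerivAt (fun s : ℝ => (s, p.2)) ((1 : ℝ), (0 : ℝ)) p.1 :=
    (hasDerivAt_id p.1).prodMk (hasDerivAt_const p.1 p.2)
  have := HasFDerivAt.comp_hasDerivAt p.1 (f := fun s : ℝ => (s, p.2)) (l := Y) h h1
  simpa using! this

theorem HasFDerivAt.hasDerivAt_snd {Y : ℝ × ℝ → ℝ} {α β : ℝ} {p : ℝ × ℝ}
    (h : HasFDerivAt Y (gradForm α β) p) : HasDerivAt (fun y => Y (p.1, y)) β p.2 := by
  have h1 : HasDerivAt (fun y : ℝ => (p.1, y)) ((0 : ℝ), (1 : ℝ)) p.2 :=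
    (hasDerivAt_const p.2 p.1).prodMk (hasDerivAt_id p.2)
  have := HasFDerivAt.comp_hasDerivAt p.2 (f := fun y : ℝ => (p.1, y)) (l := Y) h h1
  simpa using! this

theorem ae_ae_of_ae_plane {P : ℝ × ℝ → Prop} (h : ∀ᵐ p : ℝ × ℝ, P p) :
    ∀ᵐ t : ℝ, ∀ᵐ x : ℝ, P (t, x) := by
  rw [Measure.volume_eq_prod] at h
  exact Measure.ae_ae_of_ae_prod h

theorem ae_ae_of_ae_plane_swap {P : ℝ × ℝ → Prop} (h : ∀ᵐ p : ℝ × ℝ, P p) :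
    ∀ᵐ x : ℝ, ∀ᵐ t : ℝ, P (t, x) := by
  have h1 : ∀ᵐ p : ℝ × ℝ, P p.swap := by
    have := Measure.measurePreserving_swap (μ := (volume : Measure ℝ)) (ν := (volume : Measure ℝ))
    exact this.quasiMeasurePreserving.ae h
  exact ae_ae_of_ae_plane h1

theorem LipschitzWith.slice_fst {Y : ℝ × ℝ → ℝ} {L : NNReal} (h : LipschitzWith L Y) (x : ℝ) :
    LipschitzWith L (fun t => Y (t, x)) := by
  simpa using! h.comp (LipschitzWith.prodMk_right x)

theorem LipschitzWith.slice_snd {Y : ℝ × ℝ → ℝ} {L : NNReal} (h : LipschitzWith L Y) (t : ℝ) :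
    LipschitzWith L (fun x => Y (t, x)) := by
  simpa using! h.comp (LipschitzWith.prodMk_left t)

/-- Continuous functions that agree almost everywhere are equal. -/
theorem eq_of_ae_eq_of_continuous {f g : ℝ → ℝ} (hf : Continuous f) (hg : Continuous g)
    (h : ∀ᵐ x, f x = g x) : f = g :=
  (hf.ae_eq_iff_eq volume hg).1 h

theorem eq_of_ae_hasDerivAt_fst_zero {f : ℝ × ℝ → ℝ} {L : NNReal} (hf : LipschitzWith L f)
    {S : Set ℝ} (hS : S.OrdConnected)
    (h : ∀ᵐ p : ℝ × ℝ, p.1 ∈ S → HasDerivAt (fun s => f (s, p.2)) 0 p.1)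
    {s t : ℝ} (hs : s ∈ S) (ht : t ∈ S) (x : ℝ) : f (s, x) = f (t, x) := by
  have key : ∀ᵐ x : ℝ, f (s, x) = f (t, x) := by
    filter_upwards [ae_ae_of_ae_plane_swap h] with x hx
    refine (hf.slice_fst x).eq_of_ae_hasDerivAt_zero ?_
    filter_upwards [hx] with r hr hmem
    exact hr (hS.uIcc_subset hs ht hmem)
  exact congrFun (eq_of_ae_eq_of_continuous (hf.slice_snd s).continuous
    (hf.slice_snd t).continuous key) x

/-- Fubini controls only almost every time slice. Continuity in `t` extends the equality to the
interior of `S`, and the closure condition carries it to boundary times such as `t = 0` in `Iic 0`.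
-/
theorem eq_of_ae_hasDerivAt_snd_zero {f : ℝ × ℝ → ℝ} {L : NNReal} (hf : LipschitzWith L f)
    {S : Set ℝ} (hS : S ⊆ closure (interior S))
    (h : ∀ᵐ p : ℝ × ℝ, p.1 ∈ S → HasDerivAt (fun y => f (p.1, y)) 0 p.2)
    {t : ℝ} (ht : t ∈ S) (x y : ℝ) : f (t, x) = f (t, y) := by
  have key : ∀ᵐ t : ℝ, t ∈ S → f (t, x) = f (t, y) := by
    filter_upwards [ae_ae_of_ae_plane h] with t ht htS
    refine (hf.slice_snd t).eq_of_ae_hasDerivAt_zero ?_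
    filter_upwards [ht] with r hr _ using hr htS
  have key2 : ∀ t ∈ interior S, f (t, x) = f (t, y) := by
    have hc : IsClosed {t | f (t, x) = f (t, y)} :=
      isClosed_eq (hf.slice_fst x).continuous (hf.slice_fst y).continuous
    intro t ht
    by_contra hne
    have hopen : IsOpen (interior S ∩ {t | f (t, x) = f (t, y)}ᶜ) :=
      isOpen_interior.inter hc.isOpen_compl
    have hpos := hopen.measure_pos volume ⟨t, ht, hne⟩
    refine hpos.ne' (measure_mono_null ?_ key)
    rintro r ⟨hr, hr'⟩ hcon
    exact hr' (hcon (interior_subset hr))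
  have hc : IsClosed {t | f (t, x) = f (t, y)} :=
    isClosed_eq (hf.slice_fst x).continuous (hf.slice_fst y).continuous
  exact hc.closure_subset_iff.2 key2 (hS ht)

namespace IsPotential

variable {Y α β : ℝ × ℝ → ℝ}

theorem continuous (h : IsPotential Y α β) : Continuous Y := by
  obtain ⟨L, hL⟩ := h.lipschitz
  exact hL.continuous

theorem congr_ae (h : IsPotential Y α β) {α' β' : ℝ × ℝ → ℝ} (hα : ∀ᵐ p, α p = α' p)
    (hβ : ∀ᵐ p, β p = β' p) : IsPotential Y α' β' := by
  refine ⟨h.lipschitz, ?_⟩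
  filter_upwards [h.ae_hasFDerivAt, hα, hβ] with p hp h1 h2
  rwa [← h1, ← h2]

theorem sub {Y' α' β' : ℝ × ℝ → ℝ} (h : IsPotential Y α β) (h' : IsPotential Y' α' β') :
    IsPotential (fun p => Y p - Y' p) (fun p => α p - α' p) (fun p => β p - β' p) := by
  obtain ⟨L, hL⟩ := h.lipschitz
  obtain ⟨L', hL'⟩ := h'.lipschitz
  refine ⟨⟨L + L', hL.sub hL'⟩, ?_⟩
  filter_upwards [h.ae_hasFDerivAt, h'.ae_hasFDerivAt] with p hp hp'
  have : gradForm (α p - α' p) (β p - β' p) = gradForm (α p) (β p) - gradForm (α' p) (β' p) :=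
    ContinuousLinearMap.ext fun v => by simp; ring
  rw [this]
  exact hp.fun_sub hp'

theorem sub_const (h : IsPotential Y α β) (c : ℝ) : IsPotential (fun p => Y p - c) α β := by
  obtain ⟨L, hL⟩ := h.lipschitz
  refine ⟨⟨L + 0, hL.sub (LipschitzWith.const c)⟩, ?_⟩
  filter_upwards [h.ae_hasFDerivAt] with p hp using hp.sub_const c

/-- Two potentials of the same field that agree at a point are equal. -/
theorem eq_of_grad_eq {Y' : ℝ × ℝ → ℝ} (h : IsPotential Y α β) (h' : IsPotential Y' α β)
    (h0 : Y (0, 0) = Y' (0, 0)) : Y = Y' := by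
  have hd := h.sub h'
  obtain ⟨L, hL⟩ := hd.lipschitz
  have hd' : ∀ᵐ p, HasFDerivAt (fun p => Y p - Y' p) (gradForm 0 0) p := by
    filter_upwards [hd.ae_hasFDerivAt] with p hp
    simpa using hp
  ext ⟨t, x⟩
  have h1 := eq_of_ae_hasDerivAt_fst_zero hL ordConnected_univ
    (by filter_upwards [hd'] with p hp _ using hp.hasDerivAt_fst) (mem_univ t) (mem_univ 0) x
  have h2 := eq_of_ae_hasDerivAt_snd_zero (S := univ) hL (by simp)
    (by filter_upwards [hd'] with p hp _ using hp.hasDerivAt_snd) (mem_univ 0) x 0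
  linarith

/-- Two potentials whose gradients agree for `t < 0` and that agree at the origin are equal for
`t ≤ 0`. -/
theorem eq_of_grad_eq_of_neg {Y' α' β' : ℝ × ℝ → ℝ} (h : IsPotential Y α β)
    (h' : IsPotential Y' α' β') (hα : ∀ᵐ p : ℝ × ℝ, p.1 < 0 → α p = α' p)
    (hβ : ∀ᵐ p : ℝ × ℝ, p.1 < 0 → β p = β' p)
    (h0 : Y (0, 0) = Y' (0, 0)) {t : ℝ} (ht : t ≤ 0) (x : ℝ) : Y (t, x) = Y' (t, x) := by
  have hd := h.sub h'
  obtain ⟨L, hL⟩ := hd.lipschitz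
  have hne : ∀ᵐ p : ℝ × ℝ, p.1 ≠ 0 := by
    have : ∀ᵐ t : ℝ, t ≠ 0 := by simp [ae_iff]
    exact (Measure.quasiMeasurePreserving_fst (μ := (volume : Measure ℝ))
      (ν := (volume : Measure ℝ))).ae this
  have hd' : ∀ᵐ p : ℝ × ℝ, p.1 ∈ Iic (0 : ℝ) →
      HasFDerivAt (fun p => Y p - Y' p) (gradForm 0 0) p := by
    filter_upwards [hd.ae_hasFDerivAt, hα, hβ, hne] with p hp h1 h2 h3 h4
    have h5 : p.1 < 0 := lt_of_le_of_ne h4 h3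
    simpa [h1 h5, h2 h5] using hp
  have h1 := eq_of_ae_hasDerivAt_fst_zero hL ordConnected_Iic
    (by filter_upwards [hd'] with p hp hp0 using (hp hp0).hasDerivAt_fst) (mem_Iic.2 ht)
    self_mem_Iic x
  have h2 := eq_of_ae_hasDerivAt_snd_zero (S := Iic 0) hL (by simp)
    (by filter_upwards [hd'] with p hp hp0 using (hp hp0).hasDerivAt_snd)
    (self_mem_Iic (a := (0 : ℝ))) x 0
  linarith

theorem slope_of_le (h : IsPotential Y α β) {m : ℝ} (hm : ∀ᵐ p, m ≤ β p) (t : ℝ) {x y : ℝ}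
    (hxy : x ≤ y) : m * (y - x) ≤ Y (t, y) - Y (t, x) := by
  obtain ⟨L, hL⟩ := h.lipschitz
  have key : ∀ᵐ t : ℝ, m * (y - x) ≤ Y (t, y) - Y (t, x) := by
    filter_upwards [ae_ae_of_ae_plane h.ae_hasFDerivAt, ae_ae_of_ae_plane hm] with t ht hmt
    refine (hL.slice_snd t).mul_sub_le_of_ae_hasDerivAt (f' := fun x => β (t, x)) ?_ hmt hxy
    filter_upwards [ht] with r hr using hr.hasDerivAt_snd
  have hc : IsClosed {t | m * (y - x) ≤ Y (t, y) - Y (t, x)} :=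
    isClosed_le continuous_const ((hL.slice_fst y).continuous.sub (hL.slice_fst x).continuous)
  have hdense : Dense {t | m * (y - x) ≤ Y (t, y) - Y (t, x)} := Measure.dense_of_ae key
  have := hc.closure_eq ▸ hdense t
  exact this

end IsPotential

/-! ### Inversion in the second variable -/

/-- All the functions `Y (t, ·)` increase with slope at least `m`. -/
def SlopeAtLeast (m : ℝ) (Y : ℝ × ℝ → ℝ) : Prop :=
  ∀ t x y, x ≤ y → m * (y - x) ≤ Y (t, y) - Y (t, x)

/-- The inverse of `Y (t, ·)` for each `t`. -/
def fibreInv (Y : ℝ × ℝ → ℝ) (p : ℝ × ℝ) : ℝ := Function.invFun (fun x => Y (p.1, x)) p.2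

/-- The map `(t, x) ↦ (t, Y (t, x))`. -/
def fibreMap (Y : ℝ × ℝ → ℝ) (p : ℝ × ℝ) : ℝ × ℝ := (p.1, Y p)

theorem bijective_of_slope {f : ℝ → ℝ} {m : ℝ} (hm : 0 < m) (hf : Continuous f)
    (h : ∀ x y, x ≤ y → m * (y - x) ≤ f y - f x) : Function.Bijective f := by
  have hmono : StrictMono f := by
    intro x y hxy
    have := h x y hxy.le
    have : 0 < m * (y - x) := mul_pos hm (sub_pos.2 hxy)
    linarith
  refine ⟨hmono.injective, hf.surjective ?_ ?_⟩
  · refine tendsto_atTop_mono' atTop (f₁ := fun x => m * x + f 0) ?_ ?_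
    · filter_upwards [eventually_ge_atTop 0] with x hx
      have := h 0 x hx
      simp only [sub_zero] at this
      linarith
    · exact tendsto_atTop_add_const_right _ _ (tendsto_id.const_mul_atTop hm)
  · refine tendsto_atBot_mono' atBot (f₁ := fun x => m * x + f 0) ?_ ?_
    · filter_upwards [eventually_le_atBot 0] with x hx
      have := h x 0 hx
      simp only [zero_sub] at this
      linarith
    · exact tendsto_atBot_add_const_right _ _ (tendsto_id.const_mul_atBot hm)

namespace SlopeAtLeast

variable {Y : ℝ × ℝ → ℝ} {m : ℝ} {L : NNReal}

theorem bijective (h : SlopeAtLeast m Y) (hm : 0 < m) (hY : Continuous Y) (t : ℝ) :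
    Function.Bijective (fun x => Y (t, x)) :=
  bijective_of_slope hm (hY.comp (Continuous.prodMk_right t)) (h t)

theorem apply_fibreInv (h : SlopeAtLeast m Y) (hm : 0 < m) (hY : Continuous Y) (t y : ℝ) :
    Y (t, fibreInv Y (t, y)) = y :=
  Function.rightInverse_invFun (h.bijective hm hY t).2 y

theorem fibreInv_apply (h : SlopeAtLeast m Y) (hm : 0 < m) (hY : Continuous Y) (t x : ℝ) :
    fibreInv Y (t, Y (t, x)) = x :=
  Function.leftInverse_invFun (h.bijective hm hY t).1 x

theorem mul_abs_le (h : SlopeAtLeast m Y) (t x y : ℝ) :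
    m * |x - y| ≤ |Y (t, x) - Y (t, y)| := by
  rcases le_total x y with hxy | hxy
  · have := h t x y hxy
    rw [abs_sub_comm x y, abs_of_nonneg (sub_nonneg.2 hxy), abs_sub_comm]
    exact this.trans (le_abs_self _)
  · have := h t y x hxy
    rw [abs_of_nonneg (sub_nonneg.2 hxy)]
    exact this.trans (le_abs_self _)

/-- With `x = fibreInv Y (s, z)`, the slope bound gives `m |fibreInv Y (t, y) - x| ≤ |y - Y (t, x)|
≤ |y - z| + |Y (s, x) - Y (t, x)|`, whence the constant `(1 + L) / m`. -/
theorem lipschitz_fibreInv (h : SlopeAtLeast m Y) (hm : 0 < m) (hY : LipschitzWith L Y) :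
    LipschitzWith (Real.toNNReal ((1 + L) / m)) (fibreInv Y) := by
  refine LipschitzWith.of_dist_le_mul ?_
  rintro ⟨t, y⟩ ⟨s, z⟩
  have hLm : 0 ≤ (1 + L : ℝ) / m := by positivity
  rw [Real.coe_toNNReal _ hLm, Real.dist_eq, div_mul_eq_mul_div, le_div_iff₀ hm, mul_comm]
  have h1 := h.mul_abs_le t (fibreInv Y (t, y)) (fibreInv Y (s, z))
  rw [h.apply_fibreInv hm hY.continuous] at h1
  have h2 := hY.dist_le_mul (s, fibreInv Y (s, z)) (t, fibreInv Y (s, z))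
  rw [h.apply_fibreInv hm hY.continuous, Real.dist_eq, Prod.dist_eq] at h2
  simp only [dist_self, dist_nonneg, sup_of_le_left] at h2
  have h3 : |y - Y (t, fibreInv Y (s, z))| ≤ |y - z| + |z - Y (t, fibreInv Y (s, z))| :=
    abs_sub_le _ _ _
  have h4 : dist t s ≤ dist ((t, y) : ℝ × ℝ) (s, z) := le_max_left _ _
  have h5 : |y - z| ≤ dist ((t, y) : ℝ × ℝ) (s, z) := le_max_right _ _
  rw [dist_comm] at h2
  nlinarith [L.coe_nonneg]

theorem fibreMap_fibreMap_inv (h : SlopeAtLeast m Y) (hm : 0 < m) (hY : Continuous Y)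
    (p : ℝ × ℝ) : fibreMap Y (fibreMap (fibreInv Y) p) = p :=
  Prod.ext rfl (h.apply_fibreInv hm hY p.1 p.2)

theorem fibreMap_inv_fibreMap (h : SlopeAtLeast m Y) (hm : 0 < m) (hY : Continuous Y)
    (p : ℝ × ℝ) : fibreMap (fibreInv Y) (fibreMap Y p) = p :=
  Prod.ext rfl (h.fibreInv_apply hm hY p.1 p.2)

end SlopeAtLeast

theorem LipschitzWith.fibreMap {Y : ℝ × ℝ → ℝ} {L : NNReal} (hY : LipschitzWith L Y) :
    LipschitzWith (max 1 L) (fibreMap Y) :=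
  LipschitzWith.prod_fst.prodMk hY

/-- On `ℝ × ℝ` with the sup metric, Lebesgue measure is the two-dimensional Hausdorff measure, which
a Lipschitz map increases by at most a constant factor. -/
theorem LipschitzWith.volume_image_plane_eq_zero {f : ℝ × ℝ → ℝ × ℝ} {L : NNReal}
    (hf : LipschitzWith L f) {s : Set (ℝ × ℝ)} (hs : volume s = 0) : volume (f '' s) = 0 := by
  rw [← hausdorffMeasure_prod_real] at hs ⊢
  have := hf.hausdorffMeasure_image_le (d := 2) (by norm_num) s
  rw [hs, mul_zero] at this
  exact le_antisymm this zero_le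

/-- A measurable map of the plane with a Lipschitz left inverse pulls null sets back to null
sets. -/
theorem quasiMeasurePreserving_of_lipschitz_leftInverse {f g : ℝ × ℝ → ℝ × ℝ} {L : NNReal}
    (hf : Measurable f) (hg : LipschitzWith L g) (hgf : Function.LeftInverse g f) :
    Measure.QuasiMeasurePreserving f volume volume := by
  refine ⟨hf, Measure.AbsolutelyContinuous.mk fun s hs h0 => ?_⟩
  rw [Measure.map_apply hf hs]
  refine measure_mono_null ?_ (hg.volume_image_plane_eq_zero h0)
  intro p hp
  exact ⟨f p, hp, hgf p⟩

namespace SlopeAtLeast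

variable {Y : ℝ × ℝ → ℝ} {m : ℝ} {L : NNReal}

theorem quasiMeasurePreserving (h : SlopeAtLeast m Y) (hm : 0 < m) (hY : LipschitzWith L Y) :
    Measure.QuasiMeasurePreserving (fibreMap Y) volume volume :=
  quasiMeasurePreserving_of_lipschitz_leftInverse hY.fibreMap.continuous.measurable
    (h.lipschitz_fibreInv hm hY).fibreMap (h.fibreMap_inv_fibreMap hm hY.continuous)

theorem quasiMeasurePreserving_inv (h : SlopeAtLeast m Y) (hm : 0 < m) (hY : LipschitzWith L Y) :
    Measure.QuasiMeasurePreserving (fibreMap (fibreInv Y)) volume volume :=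
  quasiMeasurePreserving_of_lipschitz_leftInverse
    (h.lipschitz_fibreInv hm hY).fibreMap.continuous.measurable
    hY.fibreMap (h.fibreMap_fibreMap_inv hm hY.continuous)

/-- The gradient of the inverse function. -/
theorem isPotential_fibreInv (h : SlopeAtLeast m Y) (hm : 0 < m) {α β : ℝ × ℝ → ℝ}
    (hY : IsPotential Y α β) :
    IsPotential (fibreInv Y)
      (fun q => -α (fibreMap (fibreInv Y) q) / β (fibreMap (fibreInv Y) q))
      (fun q => 1 / β (fibreMap (fibreInv Y) q)) := by
  obtain ⟨L, hL⟩ := hY.lipschitz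
  have hX := h.lipschitz_fibreInv hm hL
  refine ⟨⟨_, hX⟩, ?_⟩
  -- Rademacher's theorem differentiates the inverse. Since its fibre map pulls null sets back to
  -- null sets, `Y` is also differentiable at almost every image point, and the chain rule applies
  -- to `Y (t, X (t, y)) = y`.
  filter_upwards [hX.ae_differentiableAt, (h.quasiMeasurePreserving_inv hm hL).ae hY.ae_hasFDerivAt]
    with q hXq hYq
  have h1 : HasFDerivAt (fibreMap (fibreInv Y))
      ((ContinuousLinearMap.fst ℝ ℝ ℝ).prod (fderiv ℝ (fibreInv Y) q)) q :=
    (hasFDerivAt_fst (𝕜 := ℝ) (E := ℝ) (F := ℝ) (p := q)).prodMk hXq.hasFDerivAt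
  have h2 := HasFDerivAt.comp q hYq h1
  have h3 : Y ∘ fibreMap (fibreInv Y) = fun q => q.2 :=
    funext fun q => h.apply_fibreInv hm hL.continuous q.1 q.2
  rw [h3] at h2
  have h4 := h2.unique (hasFDerivAt_snd (𝕜 := ℝ) (E := ℝ) (F := ℝ) (p := q))
  generalize α (fibreMap (fibreInv Y) q) = A at h4 ⊢
  generalize β (fibreMap (fibreInv Y) q) = B at h4 ⊢
  have h5 : ∀ v : ℝ × ℝ, A * v.1 + B * fderiv ℝ (fibreInv Y) q v = v.2 := fun v => by
    simpa using DFunLike.congr_fun h4 v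
  -- The derivative in the direction `(0, 1)` would otherwise read `0 = 1`.
  have hB : B ≠ 0 := by
    rintro rfl
    simpa using h5 (0, 1)
  suffices hg : gradForm (-A / B) (1 / B) = fderiv ℝ (fibreInv Y) q by
    rw [hg]
    exact hXq.hasFDerivAt
  refine ContinuousLinearMap.ext fun v => ?_
  have := h5 v
  rw [gradForm_apply, ← this]
  field_simp
  ring

/-- If the gradient of `P` is `η` times that of `Y`, then the gradient of `P` in the coordinates
`(t, Y)` is `(0, η)`. -/
theorem isPotential_comp_fibreInv (h : SlopeAtLeast m Y) (hm : 0 < m) {P α β η : ℝ × ℝ → ℝ}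
    (hY : IsPotential Y α β) (hP : IsPotential P (fun p => α p * η p) (fun p => β p * η p)) :
    IsPotential (fun q => P (fibreMap (fibreInv Y) q)) (fun _ => 0)
      (fun q => η (fibreMap (fibreInv Y) q)) := by
  obtain ⟨L, hL⟩ := hY.lipschitz
  obtain ⟨L', hL'⟩ := hP.lipschitz
  have hX := h.lipschitz_fibreInv hm hL
  refine ⟨⟨_, hL'.comp hX.fibreMap⟩, ?_⟩
  filter_upwards [hX.ae_differentiableAt, (h.quasiMeasurePreserving_inv hm hL).ae hY.ae_hasFDerivAt,
    (h.quasiMeasurePreserving_inv hm hL).ae hP.ae_hasFDerivAt] with q hXq hYq hPq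
  have h1 : HasFDerivAt (fibreMap (fibreInv Y))
      ((ContinuousLinearMap.fst ℝ ℝ ℝ).prod (fderiv ℝ (fibreInv Y) q)) q :=
    (hasFDerivAt_fst (𝕜 := ℝ) (E := ℝ) (F := ℝ) (p := q)).prodMk hXq.hasFDerivAt
  have h2 := HasFDerivAt.comp q hYq h1
  have h3 : Y ∘ fibreMap (fibreInv Y) = fun q => q.2 :=
    funext fun q => h.apply_fibreInv hm hL.continuous q.1 q.2
  rw [h3] at h2
  have h4 := h2.unique (hasFDerivAt_snd (𝕜 := ℝ) (E := ℝ) (F := ℝ) (p := q))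
  have h6 := HasFDerivAt.comp q hPq h1
  suffices hg : gradForm 0 (η (fibreMap (fibreInv Y) q)) =
      (gradForm (α (fibreMap (fibreInv Y) q) * η (fibreMap (fibreInv Y) q))
        (β (fibreMap (fibreInv Y) q) * η (fibreMap (fibreInv Y) q))).comp
        ((ContinuousLinearMap.fst ℝ ℝ ℝ).prod (fderiv ℝ (fibreInv Y) q)) by
    rw [hg]
    exact h6
  refine ContinuousLinearMap.ext fun v => ?_
  have h5 := DFunLike.congr_fun h4 v
  simp only [ContinuousLinearMap.comp_apply, ContinuousLinearMap.prod_apply, gradForm_apply,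
    ContinuousLinearMap.coe_fst', ContinuousLinearMap.coe_snd'] at h5 ⊢
  rw [← h5]
  ring

end SlopeAtLeast

open scoped Convolution

/-! ### Divergence-free fields on the plane and their potentials -/

/-- The field `(ρ, F)` is divergence-free in the sense of distributions. -/
def IsDivFree (ρ F : ℝ × ℝ → ℝ) : Prop :=
  ∀ φ : ℝ × ℝ → ℝ, ContDiff ℝ ∞ φ → HasCompactSupport φ →
    ∫ p, (ρ p * fderiv ℝ φ p (1, 0) + F p * fderiv ℝ φ p (0, 1)) = 0

theorem locallyIntegrable_of_bounded {ρ : ℝ × ℝ → ℝ} (hρ : AEStronglyMeasurable ρ) {C : ℝ}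
    (hC : ∀ p, |ρ p| ≤ C) : LocallyIntegrable ρ :=
  (memLp_top_of_bound hρ C (Eventually.of_forall hC)).locallyIntegrable le_top

theorem integrable_mul_fderiv {ρ : ℝ × ℝ → ℝ} (hρ : LocallyIntegrable ρ) {φ : ℝ × ℝ → ℝ}
    (hφ : ContDiff ℝ ∞ φ) (hc : HasCompactSupport φ) (v : ℝ × ℝ) :
    Integrable (fun p => ρ p * fderiv ℝ φ p v) := by
  have h1 : Continuous (fun p => fderiv ℝ φ p v) :=
    (hφ.continuous_fderiv (by simp)).clm_apply continuous_const
  have h2 : HasCompactSupport (fun p => fderiv ℝ φ p v) := hc.fderiv_apply ℝ v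
  have := hρ.integrable_smul_left_of_hasCompactSupport h1 h2
  simpa [mul_comm] using this

/-- Convolution with a bump function. -/
def mollify (b : ContDiffBump (0 : ℝ × ℝ)) (ρ : ℝ × ℝ → ℝ) : ℝ × ℝ → ℝ :=
  b.normed volume ⋆[ContinuousLinearMap.lsmul ℝ ℝ, volume] ρ

section mollify

variable {ρ F : ℝ × ℝ → ℝ} (b : ContDiffBump (0 : ℝ × ℝ))

theorem abs_mollify_le (hρ : AEStronglyMeasurable ρ) {C : ℝ} (hC : ∀ p, |ρ p| ≤ C) (p : ℝ × ℝ) :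
    |mollify b ρ p| ≤ C := by
  have h := dist_convolution_le (μ := (volume : Measure (ℝ × ℝ))) (f := b.normed volume) (g := ρ)
    (x₀ := p) (R := b.rOut) (ε := C) (z₀ := 0) ((abs_nonneg _).trans (hC p))
    (by rw [b.support_normed_eq]) b.nonneg_normed b.integral_normed hρ
    (fun x _ => by simpa using hC x)
  simpa [mollify] using h

/-- The derivative of `mollify b ρ`. -/
def mollifyDeriv (b : ContDiffBump (0 : ℝ × ℝ)) (ρ : ℝ × ℝ → ℝ) : ℝ × ℝ → ℝ × ℝ →L[ℝ] ℝ :=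
  fderiv ℝ (b.normed volume) ⋆[(ContinuousLinearMap.lsmul ℝ ℝ).precompL (ℝ × ℝ), volume] ρ

theorem hasFDerivAt_mollify (hρ : LocallyIntegrable ρ) (p : ℝ × ℝ) :
    HasFDerivAt (mollify b ρ) (mollifyDeriv b ρ p) p :=
  b.hasCompactSupport_normed.hasFDerivAt_convolution_left _ b.contDiff_normed hρ p

theorem mollifyDeriv_apply (hρ : LocallyIntegrable ρ) (p v : ℝ × ℝ) :
    mollifyDeriv b ρ p v = ∫ q, fderiv ℝ (b.normed volume) (p - q) v * ρ q := by
  have hex : ConvolutionExistsAt (fderiv ℝ (b.normed volume)) ρ p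
      ((ContinuousLinearMap.lsmul ℝ ℝ).precompL (ℝ × ℝ)) (volume : Measure (ℝ × ℝ)) :=
    (b.hasCompactSupport_normed.fderiv ℝ).convolutionExists_left _
      ((b.contDiff_normed (n := 1)).continuous_fderiv (by simp)) hρ p
  rw [mollifyDeriv, convolution_eq_swap, ContinuousLinearMap.integral_apply hex.integrable_swap]
  rfl

/-- The reflected bump `q ↦ b (p - q)` is an admissible test function; its derivatives are minus
those of the bump, so the weak equation becomes the pointwise equation for the mollified field at
`p`. -/
theorem IsDivFree.mollifyDeriv_add_eq_zero (h : IsDivFree ρ F) (hρ : LocallyIntegrable ρ)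
    (hF : LocallyIntegrable F) (p : ℝ × ℝ) :
    mollifyDeriv b ρ p (1, 0) + mollifyDeriv b F p (0, 1) = 0 := by
  set φ : ℝ × ℝ → ℝ := fun q => b.normed volume (p - q) with hφ
  have hsm : ContDiff ℝ ∞ φ := b.contDiff_normed.comp (contDiff_const.sub contDiff_id)
  have hcs : HasCompactSupport φ :=
    b.hasCompactSupport_normed.comp_homeomorph (Homeomorph.subLeft p)
  have hd : ∀ q v, fderiv ℝ φ q v = -fderiv ℝ (b.normed volume) (p - q) v := by
    intro q v
    have h1 : HasFDerivAt (b.normed volume) (fderiv ℝ (b.normed volume) (p - q)) (p - q) :=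
      ((b.contDiff_normed (n := 1)).differentiable (by simp)).differentiableAt.hasFDerivAt
    have h2 : HasFDerivAt (fun q : ℝ × ℝ => p - q) (-ContinuousLinearMap.id ℝ (ℝ × ℝ)) q :=
      (hasFDerivAt_id q).const_sub p
    have h3 : HasFDerivAt φ _ q := HasFDerivAt.comp q h1 h2
    rw [h3.fderiv]
    simp
  have h0 := h φ hsm hcs
  rw [integral_add (integrable_mul_fderiv hρ hsm hcs _) (integrable_mul_fderiv hF hsm hcs _)] at h0
  rw [mollifyDeriv_apply b hρ, mollifyDeriv_apply b hF]
  simp only [hd, mul_neg, integral_neg] at h0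
  simp only [mul_comm (ρ _), mul_comm (F _)] at h0
  linarith

theorem continuous_mollify (hρ : LocallyIntegrable ρ) : Continuous (mollify b ρ) :=
  continuous_iff_continuousAt.2 fun p => (hasFDerivAt_mollify b hρ p).continuousAt

theorem IsDivFree.integral_rectangle_mollify (h : IsDivFree ρ F) (hρ : LocallyIntegrable ρ)
    (hF : LocallyIntegrable F) (s t x y : ℝ) :
    (∫ ξ in x..y, mollify b ρ (t, ξ)) - (∫ ξ in x..y, mollify b ρ (s, ξ)) +
      ((∫ τ in s..t, mollify b F (τ, y)) - ∫ τ in s..t, mollify b F (τ, x)) = 0 := by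
  have := integral2_divergence_prod_of_hasFDerivAt (mollify b ρ) (mollify b F)
    (mollifyDeriv b ρ) (mollifyDeriv b F) s x t y (continuous_mollify b hρ).continuousOn
    (continuous_mollify b hF).continuousOn (fun p _ => hasFDerivAt_mollify b hρ p)
    (fun p _ => hasFDerivAt_mollify b hF p) (by simp [h.mollifyDeriv_add_eq_zero b hρ hF])
  simp only [h.mollifyDeriv_add_eq_zero b hρ hF, intervalIntegral.integral_zero] at this
  linarith

end mollify

/-- Bump functions concentrating at the origin. -/
def bumpSeq (k : ℕ) : ContDiffBump (0 : ℝ × ℝ) where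
  rIn := 1 / (k + 1)
  rOut := 2 * (1 / (k + 1))
  rIn_pos := by positivity
  rIn_lt_rOut := by
    have : (0 : ℝ) < 1 / (k + 1) := by positivity
    linarith

theorem ae_tendsto_mollify {ρ : ℝ × ℝ → ℝ} (hρ : LocallyIntegrable ρ) :
    ∀ᵐ p, Tendsto (fun k => mollify (bumpSeq k) ρ p) atTop (𝓝 (ρ p)) := by
  refine ContDiffBump.ae_convolution_tendsto_right_of_locallyIntegrable (K := 2) ?_ ?_ hρ
  · have := (tendsto_one_div_add_atTop_nhds_zero_nat (𝕜 := ℝ)).const_mul 2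
    simpa [bumpSeq] using this
  · exact Eventually.of_forall fun k => le_rfl

theorem tendsto_intervalIntegral_of_bounded {f : ℕ → ℝ → ℝ} {g : ℝ → ℝ} {C : ℝ}
    (hf : ∀ k, Continuous (f k)) (hC : ∀ k x, |f k x| ≤ C)
    (h : ∀ᵐ x, Tendsto (fun k => f k x) atTop (𝓝 (g x))) (a b : ℝ) :
    Tendsto (fun k => ∫ x in a..b, f k x) atTop (𝓝 (∫ x in a..b, g x)) := by
  refine intervalIntegral.tendsto_integral_filter_of_dominated_convergence (fun _ => C) ?_ ?_ ?_ ?_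
  · exact Eventually.of_forall fun k => (hf k).aestronglyMeasurable
  · exact Eventually.of_forall fun k => Eventually.of_forall fun x _ => hC k x
  · simp
  · filter_upwards [h] with x hx _ using hx

/-- Green's formula on almost every rectangle. -/
theorem IsDivFree.integral_rectangle {ρ F : ℝ × ℝ → ℝ} (h : IsDivFree ρ F)
    (hρ : AEStronglyMeasurable ρ) (hF : AEStronglyMeasurable F) {C : ℝ} (hCρ : ∀ p, |ρ p| ≤ C)
    (hCF : ∀ p, |F p| ≤ C) :
    ∃ T X : Set ℝ, (∀ᵐ t, t ∈ T) ∧ (∀ᵐ x, x ∈ X) ∧ ∀ s ∈ T, ∀ t ∈ T, ∀ x ∈ X, ∀ y ∈ X,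
      (∫ ξ in x..y, ρ (t, ξ)) - (∫ ξ in x..y, ρ (s, ξ)) +
      ((∫ τ in s..t, F (τ, y)) - ∫ τ in s..t, F (τ, x)) = 0 := by
  have hρl := locallyIntegrable_of_bounded hρ hCρ
  have hFl := locallyIntegrable_of_bounded hF hCF
  refine ⟨_, _, ae_ae_of_ae_plane (ae_tendsto_mollify hρl),
    ae_ae_of_ae_plane_swap (ae_tendsto_mollify hFl), ?_⟩
  intro s hs t ht x hx y hy
  have hcρ : ∀ t k, Continuous fun ξ => mollify (bumpSeq k) ρ (t, ξ) := fun t k =>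
    (continuous_mollify (bumpSeq k) hρl).comp (Continuous.prodMk_right t)
  have hcF : ∀ x k, Continuous fun τ => mollify (bumpSeq k) F (τ, x) := fun x k =>
    (continuous_mollify (bumpSeq k) hFl).comp (Continuous.prodMk_left x)
  have h1 := tendsto_intervalIntegral_of_bounded (hcρ t)
    (fun k ξ => abs_mollify_le (bumpSeq k) hρ hCρ _) ht x y
  have h2 := tendsto_intervalIntegral_of_bounded (hcρ s)
    (fun k ξ => abs_mollify_le (bumpSeq k) hρ hCρ _) hs x y
  have h3 := tendsto_intervalIntegral_of_bounded (hcF y)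
    (fun k ξ => abs_mollify_le (bumpSeq k) hF hCF _) hy s t
  have h4 := tendsto_intervalIntegral_of_bounded (hcF x)
    (fun k ξ => abs_mollify_le (bumpSeq k) hF hCF _) hx s t
  refine tendsto_nhds_unique ((h1.sub h2).add (h3.sub h4)) ?_
  simp only [h.integral_rectangle_mollify _ hρl hFl]
  exact tendsto_const_nhds

theorem intervalIntegrable_of_bounded {f : ℝ → ℝ} (hf : AEStronglyMeasurable f) {C : ℝ}
    (hC : ∀ x, |f x| ≤ C) (a b : ℝ) : IntervalIntegrable f volume a b :=
  intervalIntegrable_const (c := C) |>.mono_fun hf.restrict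
    (Eventually.of_forall fun x => (hC x).trans (le_abs_self C))

theorem abs_intervalIntegral_le {f : ℝ → ℝ} {C : ℝ}
    (hC : ∀ x, |f x| ≤ C) (a b : ℝ) : |∫ x in a..b, f x| ≤ C * |b - a| := by
  have := intervalIntegral.norm_integral_le_of_norm_le_const (f := f) (a := a) (b := b) (C := C)
    (fun x _ => hC x)
  simpa using this

theorem lipschitzWith_intervalIntegral {f : ℝ → ℝ} (hf : AEStronglyMeasurable f) {C : ℝ}
    (hC : ∀ x, |f x| ≤ C) (a : ℝ) : LipschitzWith C.toNNReal (fun x => ∫ ξ in a..x, f ξ) := by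
  refine LipschitzWith.of_dist_le_mul fun x y => ?_
  rw [Real.coe_toNNReal _ ((abs_nonneg _).trans (hC 0)), Real.dist_eq, Real.dist_eq,
    intervalIntegral.integral_interval_sub_left (intervalIntegrable_of_bounded hf hC _ _)
      (intervalIntegrable_of_bounded hf hC _ _)]
  exact abs_intervalIntegral_le hC y x

theorem ae_hasDerivAt_intervalIntegral {f : ℝ → ℝ} (hf : AEStronglyMeasurable f) {C : ℝ}
    (hC : ∀ x, |f x| ≤ C) : ∀ᵐ x, ∀ a, HasDerivAt (fun x => ∫ ξ in a..x, f ξ) (f x) x :=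
  LocallyIntegrable.ae_hasDerivAt_integral
    ((memLp_top_of_bound hf C (Eventually.of_forall hC)).locallyIntegrable le_top)

theorem ae_plane_of_ae_ae {P : ℝ × ℝ → Prop} (hP : MeasurableSet {p | P p})
    (h : ∀ᵐ t : ℝ, ∀ᵐ x : ℝ, P (t, x)) : ∀ᵐ p, P p := by
  rw [Measure.volume_eq_prod]
  exact (Measure.ae_prod_iff_ae_ae hP).2 h

theorem ae_plane_of_ae_ae_swap {P : ℝ × ℝ → Prop} (hP : MeasurableSet {p | P p})
    (h : ∀ᵐ x : ℝ, ∀ᵐ t : ℝ, P (t, x)) : ∀ᵐ p, P p := by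
  have h1 : ∀ᵐ p : ℝ × ℝ, P p.swap := ae_plane_of_ae_ae (hP.preimage measurable_swap) h
  have := Measure.measurePreserving_swap (μ := (volume : Measure ℝ)) (ν := (volume : Measure ℝ))
  exact this.quasiMeasurePreserving.ae h1

/-- A bounded measurable divergence-free field has a Lipschitz potential. -/
theorem IsDivFree.exists_isPotential_of_measurable {ρ F : ℝ × ℝ → ℝ} (h : IsDivFree ρ F)
    (hρ : Measurable ρ) (hF : Measurable F) {C : ℝ} (hCρ : ∀ p, |ρ p| ≤ C)
    (hCF : ∀ p, |F p| ≤ C) :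
    ∃ Y, IsPotential Y (fun p => -F p) ρ := by
  have hC0 : 0 ≤ C := (abs_nonneg _).trans (hCρ 0)
  obtain ⟨T, X, hT, hX, hG⟩ :=
    h.integral_rectangle hρ.aestronglyMeasurable hF.aestronglyMeasurable hCρ hCF
  obtain ⟨t₀, ht₀⟩ := hT.exists
  obtain ⟨x₀, hx₀⟩ := hX.exists
  have hρs : ∀ t, AEStronglyMeasurable (fun ξ => ρ (t, ξ)) := fun t =>
    (hρ.comp measurable_prodMk_left).aestronglyMeasurable
  have hFs : ∀ x, AEStronglyMeasurable (fun τ => F (τ, x)) := fun x =>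
    (hF.comp measurable_prodMk_right).aestronglyMeasurable
  have hiρ := fun t => intervalIntegrable_of_bounded (hρs t) (fun x => hCρ (t, x))
  have hiF := fun x => intervalIntegrable_of_bounded (hFs x) (fun t => hCF (t, x))
  -- The potential is integrated along the line `x = x₀` and then along the time slice. Its
  -- `x`-increments are exact for every `t`, while Green's formula gives its `t`-increments only for
  -- times in `T` and abscissae in `X`.
  set G : ℝ × ℝ → ℝ := fun p => (∫ ξ in x₀..p.2, ρ (p.1, ξ)) - ∫ τ in t₀..p.1, F (τ, x₀) with hGdef
  have hsnd : ∀ t x y, G (t, y) - G (t, x) = ∫ ξ in x..y, ρ (t, ξ) := by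
    intro t x y
    simp only [hGdef]
    rw [← intervalIntegral.integral_interval_sub_left (hiρ t x₀ y) (hiρ t x₀ x)]
    ring
  have hfst : ∀ s ∈ T, ∀ t ∈ T, ∀ x ∈ X, G (t, x) - G (s, x) = -∫ τ in s..t, F (τ, x) := by
    intro s hs t ht x hx
    have h1 := hG s hs t ht x₀ hx₀ x hx
    have h2 := intervalIntegral.integral_interval_sub_left (hiF x₀ t₀ t) (hiF x₀ t₀ s)
    simp only [hGdef]
    linarith
  have hsndL : ∀ t x y, |G (t, y) - G (t, x)| ≤ C * |y - x| := fun t x y => by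
    rw [hsnd]
    exact abs_intervalIntegral_le (fun ξ => hCρ (t, ξ)) x y
  have hcont : ∀ t, Continuous fun x => G (t, x) := fun t => by
    have : LipschitzWith C.toNNReal fun x => G (t, x) := by
      refine LipschitzWith.of_dist_le_mul fun x y => ?_
      rw [Real.coe_toNNReal _ hC0]
      exact hsndL t y x
    exact this.continuous
  have hfstL : ∀ s ∈ T, ∀ t ∈ T, ∀ x, |G (t, x) - G (s, x)| ≤ C * |t - s| := by
    intro s hs t ht x
    have hclosed : IsClosed {x | |G (t, x) - G (s, x)| ≤ C * |t - s|} :=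
      isClosed_le ((hcont t).sub (hcont s)).abs continuous_const
    have hXd : Dense X := Measure.dense_of_ae hX
    have hsub : X ⊆ {x | |G (t, x) - G (s, x)| ≤ C * |t - s|} := fun x hx => by
      rw [mem_ofPred_eq, hfst s hs t ht x hx, abs_neg]
      exact abs_intervalIntegral_le (fun τ => hCF (τ, x)) s t
    exact hclosed.closure_subset_iff.2 hsub (hXd x)
  -- For `t ∉ T` the slice `ρ (t, ·)` is arbitrary and `G` may jump, so only the restriction to the
  -- times in `T` is kept and then extended to a Lipschitz function.
  have hlip : LipschitzOnWith (C.toNNReal + C.toNNReal) G (T ×ˢ univ) := by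
    refine LipschitzOnWith.of_dist_le_mul ?_
    rintro ⟨t, x⟩ ⟨ht, -⟩ ⟨s, y⟩ ⟨hs, -⟩
    rw [NNReal.coe_add, Real.coe_toNNReal _ hC0, Real.dist_eq]
    have h1 := hfstL s hs t ht x
    have h2 := hsndL s y x
    have h3 : |t - s| ≤ dist ((t, x) : ℝ × ℝ) (s, y) := le_max_left _ _
    have h4 : |x - y| ≤ dist ((t, x) : ℝ × ℝ) (s, y) := le_max_right _ _
    have h5 := abs_sub_le (G (t, x)) (G (s, x)) (G (s, y))
    nlinarith
  obtain ⟨Y, hYL, hYG⟩ := hlip.extend_real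
  have hGY : ∀ t ∈ T, ∀ x, G (t, x) = Y (t, x) := fun t ht x => hYG ⟨ht, mem_univ x⟩
  refine ⟨Y, ⟨_, hYL⟩, ?_⟩
  have hYm : ∀ v : ℝ × ℝ, Measurable fun p => fderiv ℝ Y p v := fun v =>
    measurable_fderiv_apply_const ℝ Y v
  have hdiff := hYL.ae_differentiableAt (μ := (volume : Measure (ℝ × ℝ)))
  -- The total derivative exists almost everywhere by Rademacher, so it suffices to identify both
  -- partial derivatives slice by slice; measurability of the exceptional set is what lets Fubini
  -- return to the plane.
  have hd2 : ∀ᵐ p, fderiv ℝ Y p (0, 1) = ρ p := by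
    refine ae_plane_of_ae_ae (measurableSet_eq_fun (hYm _) hρ) ?_
    filter_upwards [hT, ae_ae_of_ae_plane hdiff] with t ht hdt
    filter_upwards [hdt, ae_hasDerivAt_intervalIntegral (hρs t) (fun x => hCρ (t, x))] with x hx hx'
    have h1 : HasDerivAt (fun y => Y (t, y)) (ρ (t, x)) x := by
      have h2 : (fun y => Y (t, y)) = fun y => (∫ ξ in (0 : ℝ)..y, ρ (t, ξ)) + G (t, 0) := by
        ext y
        rw [← hGY t ht, ← hsnd]
        ring
      rw [h2]
      exact (hx' 0).add_const _
    have h3 : HasDerivAt (fun y : ℝ => (t, y)) ((0 : ℝ), (1 : ℝ)) x :=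
      (hasDerivAt_const x t).prodMk (hasDerivAt_id x)
    exact (HasFDerivAt.comp_hasDerivAt x (f := fun y : ℝ => (t, y)) (l := Y)
      hx.hasFDerivAt h3).unique h1
  have hd1 : ∀ᵐ p, fderiv ℝ Y p (1, 0) = -F p := by
    refine ae_plane_of_ae_ae_swap (measurableSet_eq_fun (hYm _) hF.neg) ?_
    filter_upwards [hX, ae_ae_of_ae_plane_swap hdiff] with x hx hdx
    filter_upwards [hdx, ae_hasDerivAt_intervalIntegral (hFs x) (fun t => hCF (t, x))] with t ht ht'
    have h1 : HasDerivAt (fun s => Y (s, x)) (-F (t, x)) t := by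
      have h2 : (fun s => Y (s, x)) = fun s => -(∫ τ in t₀..s, F (τ, x)) + Y (t₀, x) := by
        refine eq_of_ae_eq_of_continuous (hYL.slice_fst x).continuous ?_ ?_
        · exact (lipschitzWith_intervalIntegral (hFs x)
            (fun t => hCF (t, x)) t₀).continuous.neg.add continuous_const
        · filter_upwards [hT] with s hs
          rw [← hfst t₀ ht₀ s hs x hx, ← hGY s hs, ← hGY t₀ ht₀]
          ring
      rw [h2]
      exact (ht' t₀).neg.add_const _
    have h3 : HasDerivAt (fun s : ℝ => (s, x)) ((1 : ℝ), (0 : ℝ)) t :=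
      (hasDerivAt_id t).prodMk (hasDerivAt_const t x)
    exact (HasFDerivAt.comp_hasDerivAt t (f := fun s : ℝ => (s, x)) (l := Y)
      ht.hasFDerivAt h3).unique h1
  filter_upwards [hdiff, hd1, hd2] with p hp h1 h2
  suffices hg : gradForm (-F p) (ρ p) = fderiv ℝ Y p by
    rw [hg]
    exact hp.hasFDerivAt
  refine ContinuousLinearMap.ext fun v => ?_
  have hv : v = v.1 • ((1 : ℝ), (0 : ℝ)) + v.2 • ((0 : ℝ), (1 : ℝ)) := by ext <;> simp
  rw [gradForm_apply]
  conv_rhs => rw [hv, map_add, map_smul, map_smul, h1, h2]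
  simp only [smul_eq_mul]
  ring

theorem IsDivFree.congr_ae {ρ F ρ' F' : ℝ × ℝ → ℝ} (h : IsDivFree ρ F) (hρ : ∀ᵐ p, ρ p = ρ' p)
    (hF : ∀ᵐ p, F p = F' p) : IsDivFree ρ' F' := by
  intro φ h1 h2
  refine (integral_congr_ae ?_).trans (h φ h1 h2)
  filter_upwards [hρ, hF] with p hp hp'
  rw [hp, hp']

/-- A bounded divergence-free field has a Lipschitz potential, which may be normalised at the
origin. -/
theorem IsDivFree.exists_isPotential {ρ F : ℝ × ℝ → ℝ} (h : IsDivFree ρ F)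
    (hρ : AEStronglyMeasurable ρ) (hF : AEStronglyMeasurable F) {C : ℝ}
    (hCρ : ∀ᵐ p, |ρ p| ≤ C) (hCF : ∀ᵐ p, |F p| ≤ C) :
    ∃ Y, IsPotential Y (fun p => -F p) ρ ∧ Y (0, 0) = 0 := by
  have hC0 : 0 ≤ C := by
    obtain ⟨p, hp⟩ := hCρ.exists
    exact (abs_nonneg _).trans hp
  -- Clipping a measurable representative to `[-C, C]` makes the bound hold everywhere without
  -- changing the field off a null set.
  have hcl : ∀ r : ℝ, |max (-C) (min C r)| ≤ C := fun r =>
    abs_le.2 ⟨le_max_left _ _, max_le (by linarith) (min_le_left _ _)⟩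
  have hcl' : ∀ r : ℝ, |r| ≤ C → max (-C) (min C r) = r := fun r hr => by
    rw [abs_le] at hr
    rw [min_eq_right hr.2, max_eq_right hr.1]
  have key : ∀ f : ℝ × ℝ → ℝ, ∀ hf : AEStronglyMeasurable f, (∀ᵐ p, |f p| ≤ C) →
      Measurable (fun p => max (-C) (min C (hf.mk f p))) ∧
      ∀ᵐ p, f p = max (-C) (min C (hf.mk f p)) := by
    intro f hf hfC
    refine ⟨measurable_const.max (measurable_const.min hf.stronglyMeasurable_mk.measurable), ?_⟩
    filter_upwards [hf.ae_eq_mk, hfC] with p hp hp'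
    rw [← hp, hcl' _ hp']
  obtain ⟨m1, e1⟩ := key ρ hρ hCρ
  obtain ⟨m2, e2⟩ := key F hF hCF
  obtain ⟨Y, hY⟩ := (h.congr_ae e1 e2).exists_isPotential_of_measurable m1 m2 (fun _ => hcl _)
    (fun _ => hcl _)
  have hY' : IsPotential Y (fun p => -F p) ρ := by
    refine hY.congr_ae ?_ ?_
    · filter_upwards [e2] with p hp
      rw [← hp]
    · filter_upwards [e1] with p hp
      rw [← hp]
  exact ⟨fun p => Y p - Y (0, 0), hY'.sub_const _, by simp⟩

/-- The rotated gradient of a Lipschitz function is divergence-free. -/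
theorem IsPotential.isDivFree {Y ρ F : ℝ × ℝ → ℝ} (h : IsPotential Y (fun p => -F p) ρ)
    (hρ : LocallyIntegrable ρ) (hF : LocallyIntegrable F) : IsDivFree ρ F := by
  intro φ hφ hc
  obtain ⟨L, hL⟩ := h.lipschitz
  have hline : ∀ v : ℝ × ℝ, ∀ᵐ p, lineDeriv ℝ Y p v = -F p * v.1 + ρ p * v.2 := by
    intro v
    filter_upwards [h.ae_hasFDerivAt] with p hp
    rw [hp.differentiableAt.lineDeriv_eq_fderiv, hp.fderiv, gradForm_apply]
  have hψ : ∀ v : ℝ × ℝ, ContDiff ℝ ∞ (fun p => fderiv ℝ φ p v) := fun v =>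
    (hφ.fderiv_right (m := ∞) (by simp)).clm_apply contDiff_const
  have hψc : ∀ v : ℝ × ℝ, HasCompactSupport (fun p => fderiv ℝ φ p v) := fun v =>
    hc.fderiv_apply ℝ v
  -- Integrating by parts moves the derivative of the Lipschitz function onto `φ`; the two resulting
  -- terms contain opposite orders of the mixed second derivative and cancel by symmetry.
  have hibp : ∀ v w : ℝ × ℝ, ∫ p, lineDeriv ℝ Y p v * fderiv ℝ φ p w =
      -∫ p, fderiv ℝ (fderiv ℝ φ) p v w * Y p := by
    intro v w
    obtain ⟨D, hD⟩ := ((hψ w).of_le (by simp : (1 : WithTop ℕ∞) ≤ ∞)).lipschitzWith_of_hasCompactSupport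
      (hψc w) (by simp)
    rw [hL.integral_lineDeriv_mul_eq hD (hψc w) v, ← integral_neg]
    refine integral_congr_ae (Eventually.of_forall fun p => ?_)
    have hd : DifferentiableAt ℝ (fun p => fderiv ℝ φ p w) p :=
      (hψ w).differentiable (by simp) p
    have hd' : DifferentiableAt ℝ (fderiv ℝ φ) p :=
      (hφ.fderiv_right (m := ∞) (by simp)).differentiable (by simp) p
    dsimp only
    rw [hd.lineDeriv_eq_fderiv, fderiv_clm_apply hd' (differentiableAt_const w)]
    simp
  have hsymm : ∀ p, fderiv ℝ (fderiv ℝ φ) p (0, 1) (1, 0) = fderiv ℝ (fderiv ℝ φ) p (1, 0) (0, 1) :=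
    fun p => (hφ.contDiffAt.isSymmSndFDerivAt (by
      rw [minSmoothness_of_isRCLikeNormedField]
      exact WithTop.coe_le_coe.2 (le_top : (2 : ℕ∞) ≤ ⊤))) _ _
  have h1 := hibp (0, 1) (1, 0)
  have h2 := hibp (1, 0) (0, 1)
  simp only [hsymm] at h1
  have e1 : ∫ p, lineDeriv ℝ Y p (0, 1) * fderiv ℝ φ p (1, 0) =
      ∫ p, ρ p * fderiv ℝ φ p (1, 0) := by
    refine integral_congr_ae ?_
    filter_upwards [hline (0, 1)] with p hp
    rw [hp]
    simp
  have e2 : ∫ p, lineDeriv ℝ Y p (1, 0) * fderiv ℝ φ p (0, 1) =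
      -∫ p, F p * fderiv ℝ φ p (0, 1) := by
    rw [← integral_neg]
    refine integral_congr_ae ?_
    filter_upwards [hline (1, 0)] with p hp
    rw [hp]
    simp
  rw [integral_add (integrable_mul_fderiv hρ hφ hc _) (integrable_mul_fderiv hF hφ hc _)]
  linarith

/-! ### Functions constant along the level lines of a potential -/

/-- If the gradient of `P` is `η` times that of `Y`, and `η` is a function `q` of `Y` for `t < 0`,
then this holds everywhere. -/
theorem ae_eq_comp_of_isPotential {Y P α β η : ℝ × ℝ → ℝ} {m : ℝ} (hs : SlopeAtLeast m Y)
    (hm : 0 < m) (hY : IsPotential Y α β)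
    (hP : IsPotential P (fun p => α p * η p) (fun p => β p * η p)) {q : ℝ → ℝ}
    (hq : ∀ᵐ p : ℝ × ℝ, p.1 < 0 → η p = q (Y p)) : ∀ᵐ p, η p = q (Y p) := by
  obtain ⟨L, hL⟩ := hY.lipschitz
  have hPt := hs.isPotential_comp_fibreInv hm hY hP
  set R : ℝ × ℝ → ℝ := fun q => P (fibreMap (fibreInv Y) q) with hR
  -- In the coordinates `(t, Y)` the gradient of `P` is `(0, η)`. Thus `P` does not depend on `t`,
  -- and neither does its derivative `η`, which can be read off at negative times.
  have hconst : ∀ t y, R (t, y) = R (0, y) := fun t y => by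
    obtain ⟨L', hL'⟩ := hPt.lipschitz
    exact eq_of_ae_hasDerivAt_fst_zero hL' ordConnected_univ
      (by filter_upwards [hPt.ae_hasFDerivAt] with p hp _ using hp.hasDerivAt_fst)
      (mem_univ t) (mem_univ 0) y
  have h1 : ∀ᵐ p : ℝ × ℝ, deriv (fun y => R (0, y)) p.2 = η (fibreMap (fibreInv Y) p) := by
    filter_upwards [hPt.ae_hasFDerivAt] with p hp
    have := hp.hasDerivAt_snd
    simp only [hconst p.1] at this
    exact this.deriv
  have h2 : ∀ᵐ p : ℝ × ℝ, p.1 < 0 → η (fibreMap (fibreInv Y) p) = q p.2 := by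
    filter_upwards [(hs.quasiMeasurePreserving_inv hm hL).ae hq] with p hp hp0
    rw [hp hp0]
    congr 1
    exact hs.apply_fibreInv hm hL.continuous p.1 p.2
  have h3 : ∀ᵐ t : ℝ, ∀ᵐ y : ℝ, t < 0 → deriv (fun y => R (0, y)) y = q y := by
    refine ae_ae_of_ae_plane (P := fun p => p.1 < 0 → deriv (fun y => R (0, y)) p.2 = q p.2) ?_
    filter_upwards [h1, h2] with p hp hp' hp0
    rw [hp, hp' hp0]
  have h4 : ∀ᵐ y : ℝ, deriv (fun y => R (0, y)) y = q y := by
    -- A single good negative time suffices, because the identity for `R (0, ·)` does not involve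
    -- `t`.
    obtain ⟨t, ht0, ht⟩ := (Measure.dense_of_ae h3).exists_mem_open (isOpen_Iio (a := (0 : ℝ)))
      ⟨-1, by simp⟩
    filter_upwards [ht0] with y hy using hy ht
  have h5 : ∀ᵐ p : ℝ × ℝ, deriv (fun y => R (0, y)) p.2 = q p.2 :=
    (Measure.quasiMeasurePreserving_snd (μ := (volume : Measure ℝ))
      (ν := (volume : Measure ℝ))).ae h4
  have h6 : ∀ᵐ p : ℝ × ℝ, η (fibreMap (fibreInv Y) p) = q p.2 := by
    filter_upwards [h1, h5] with p hp hp'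
    rw [← hp, hp']
  filter_upwards [(hs.quasiMeasurePreserving hm hL).ae h6] with p hp
  rw [hs.fibreMap_inv_fibreMap hm hL.continuous] at hp
  exact hp

/-! ### Initial data as values for negative times -/

/-- The function equal to `ρ` for `t > 0` and to `r (x)` for `t ≤ 0`. -/
def extendPast (ρ : ℝ × ℝ → ℝ) (r : ℝ → ℝ) (p : ℝ × ℝ) : ℝ := if 0 < p.1 then ρ p else r p.2

theorem extendPast_of_pos {ρ : ℝ × ℝ → ℝ} {r : ℝ → ℝ} {p : ℝ × ℝ} (h : 0 < p.1) :
    extendPast ρ r p = ρ p := if_pos h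

theorem extendPast_of_nonpos {ρ : ℝ × ℝ → ℝ} {r : ℝ → ℝ} {p : ℝ × ℝ} (h : p.1 ≤ 0) :
    extendPast ρ r p = r p.2 := if_neg h.not_gt

theorem measurableSet_halfPlane : MeasurableSet (Ioi (0 : ℝ) ×ˢ (univ : Set ℝ)) :=
  measurableSet_Ioi.prod MeasurableSet.univ

theorem ae_halfPlane_iff {P : ℝ × ℝ → Prop} :
    (∀ᵐ p ∂halfPlane, P p) ↔ ∀ᵐ p : ℝ × ℝ, 0 < p.1 → P p := by
  rw [halfPlane, ae_restrict_iff' measurableSet_halfPlane]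
  simp

theorem aestronglyMeasurable_extendPast {ρ : ℝ × ℝ → ℝ} {r : ℝ → ℝ}
    (hρ : AEStronglyMeasurable ρ halfPlane) (hr : AEStronglyMeasurable r) :
    AEStronglyMeasurable (extendPast ρ r) := by
  have h2 : AEStronglyMeasurable (fun p : ℝ × ℝ => r p.2) :=
    hr.comp_quasiMeasurePreserving (Measure.quasiMeasurePreserving_snd (μ := (volume : Measure ℝ))
      (ν := (volume : Measure ℝ)))
  have := AEStronglyMeasurable.piecewise (μ := (volume : Measure (ℝ × ℝ))) (f := ρ)
    (g := fun p : ℝ × ℝ => r p.2) measurableSet_halfPlane hρ h2.restrict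
  refine this.congr (Eventually.of_forall fun p => ?_)
  by_cases hp : 0 < p.1 <;> simp [Set.piecewise, extendPast, hp]

/-- The weak formulation with initial data, as an integral over the whole plane. -/
theorem integral_extendPast {ρ F : ℝ × ℝ → ℝ} {r : ℝ → ℝ}
    (hρ : LocallyIntegrable (extendPast ρ r)) (hF : LocallyIntegrable (extendPast F 0))
    {φ : ℝ × ℝ → ℝ} (hφ : ContDiff ℝ ∞ φ) (hc : HasCompactSupport φ) :
    ∫ p, (extendPast ρ r p * fderiv ℝ φ p (1, 0) + extendPast F 0 p * fderiv ℝ φ p (0, 1)) =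
      (∫ p, (ρ p * fderiv ℝ φ p (1, 0) + F p * fderiv ℝ φ p (0, 1)) ∂halfPlane) +
        ∫ x, r x * φ (0, x) := by
  have hi : Integrable (fun p => extendPast ρ r p * fderiv ℝ φ p (1, 0) +
      extendPast F 0 p * fderiv ℝ φ p (0, 1)) :=
    (integrable_mul_fderiv hρ hφ hc (1, 0)).add (integrable_mul_fderiv hF hφ hc (0, 1))
  rw [← integral_add_compl measurableSet_halfPlane hi]
  congr 1
  · refine setIntegral_congr_fun measurableSet_halfPlane fun p hp => ?_
    simp only [mem_prod, mem_Ioi, mem_univ, and_true] at hp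
    simp [extendPast_of_pos hp]
  · have hcompl : (Ioi (0 : ℝ) ×ˢ (univ : Set ℝ))ᶜ = Iic (0 : ℝ) ×ˢ univ := by
      ext p
      simp
    rw [hcompl]
    have h1 : ∫ p in Iic (0 : ℝ) ×ˢ univ, (extendPast ρ r p * fderiv ℝ φ p (1, 0) +
        extendPast F 0 p * fderiv ℝ φ p (0, 1)) =
        ∫ p in Iic (0 : ℝ) ×ˢ univ, r p.2 * fderiv ℝ φ p (1, 0) := by
      refine setIntegral_congr_fun (measurableSet_Iic.prod MeasurableSet.univ) fun p hp => ?_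
      simp only [mem_prod, mem_Iic, mem_univ, and_true] at hp
      simp [extendPast_of_nonpos hp]
    have h2 : IntegrableOn (fun p : ℝ × ℝ => r p.2 * fderiv ℝ φ p (1, 0)) (Iic (0 : ℝ) ×ˢ univ) := by
      refine (integrable_mul_fderiv hρ hφ hc (1, 0)).integrableOn.congr_fun (fun p hp => ?_)
        (measurableSet_Iic.prod MeasurableSet.univ)
      simp only [mem_prod, mem_Iic, mem_univ, and_true] at hp
      simp [extendPast_of_nonpos hp]
    rw [h1]
    have hrestr : (volume : Measure (ℝ × ℝ)).restrict (Iic (0 : ℝ) ×ˢ univ) =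
        ((volume : Measure ℝ).restrict (Iic 0)).prod volume := by
      rw [Measure.volume_eq_prod, ← Measure.prod_restrict, Measure.restrict_univ]
    rw [IntegrableOn, hrestr] at h2
    -- Integrating over time first, `∂ₜ φ (·, x)` contributes `φ (0, x)` over the past, which is
    -- exactly the initial term.
    rw [hrestr, integral_prod_symm _ h2]
    refine integral_congr_ae (Eventually.of_forall fun x => ?_)
    simp only [integral_const_mul]
    congr 1
    have hd : ∀ t ∈ Iic (0 : ℝ),
        HasDerivAt (fun s => φ (s, x)) (fderiv ℝ φ (t, x) (1, 0)) t := by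
      intro t _
      have h3 : HasDerivAt (fun s : ℝ => (s, x)) ((1 : ℝ), (0 : ℝ)) t :=
        (hasDerivAt_id t).prodMk (hasDerivAt_const t x)
      exact HasFDerivAt.comp_hasDerivAt t (f := fun s : ℝ => (s, x)) (l := φ)
        (hφ.differentiable (by simp) (t, x)).hasFDerivAt h3
    have hemb : Topology.IsClosedEmbedding (fun s : ℝ => (s, x)) :=
      (Isometry.of_dist_eq (fun a b => by simp [Prod.dist_eq])).isClosedEmbedding
    have hcs : HasCompactSupport (fun s : ℝ => φ (s, x)) := hc.comp_isClosedEmbedding hemb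
    have hcs' : HasCompactSupport (fun s : ℝ => fderiv ℝ φ (s, x) (1, 0)) :=
      (hc.fderiv_apply ℝ (1, 0)).comp_isClosedEmbedding hemb
    have hcont : Continuous (fun s : ℝ => fderiv ℝ φ (s, x) (1, 0)) :=
      ((hφ.continuous_fderiv (by simp)).clm_apply continuous_const).comp
        (Continuous.prodMk_left x)
    have := integral_Iic_of_hasDerivAt_of_tendsto' hd
      (hcont.integrable_of_hasCompactSupport hcs').integrableOn
      (hcs.is_zero_at_infty.mono_left atBot_le_cocompact)
    rw [this, sub_zero]

/-! ### The algebra of rich linearly degenerate systems -/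

theorem update_mem_Icc {n : ℕ} {a b w : Fin n → ℝ} (hw : w ∈ Icc a b) {j : Fin n} {s : ℝ}
    (hs : s ∈ Icc (a j) (b j)) : Function.update w j s ∈ Icc a b := by
  constructor <;> intro i <;> by_cases h : i = j
  · subst h; simpa using hs.1
  · simpa [h] using hw.1 i
  · subst h; simpa using hs.2
  · simpa [h] using hw.2 i

theorem apply_mem_Icc {n : ℕ} {a b w : Fin n → ℝ} (hw : w ∈ Icc a b) (j : Fin n) :
    w j ∈ Icc (a j) (b j) := ⟨hw.1 j, hw.2 j⟩

/-- A function on a box with vanishing mixed second differences is a sum of functions of single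
variables. -/
theorem eq_add_sum_of_mixed_difference {n : ℕ} {a b : Fin n → ℝ} {K : (Fin n → ℝ) → ℝ}
    (hK : ∀ w ∈ Icc a b, ∀ i j, i ≠ j → ∀ s ∈ Icc (a i) (b i), ∀ r ∈ Icc (a j) (b j),
      K (Function.update (Function.update w i s) j r) - K (Function.update w i s) =
        K (Function.update w j r) - K w)
    {u w : Fin n → ℝ} (hu : u ∈ Icc a b) (hw : w ∈ Icc a b) :
    K w = K u + ∑ j, (K (Function.update u j (w j)) - K u) := by
  classical
  have hmem : ∀ S : Finset (Fin n), S.piecewise w u ∈ Icc a b := by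
    intro S
    constructor <;> intro i <;> by_cases h : i ∈ S
    · simpa [h] using hw.1 i
    · simpa [h] using hu.1 i
    · simpa [h] using hw.2 i
    · simpa [h] using hu.2 i
  -- The increment in the `j`-th variable is unaffected when other entries of `u` are replaced one
  -- at a time by those of `w`; replacing all entries successively then telescopes.
  have hstep : ∀ (S : Finset (Fin n)) (j : Fin n), j ∉ S →
      K (Function.update (S.piecewise w u) j (w j)) - K (S.piecewise w u) =
        K (Function.update u j (w j)) - K u := by
    intro S j
    induction S using Finset.induction_on with
    | empty => simp
    | insert i S hi ih =>
      intro hj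
      rw [Finset.mem_insert, not_or] at hj
      rw [Finset.piecewise_insert, hK _ (hmem S) i j (Ne.symm hj.1) _ (apply_mem_Icc hw i) _
        (apply_mem_Icc hw j), ih hj.2]
  have hsum : ∀ S : Finset (Fin n),
      K (S.piecewise w u) = K u + ∑ j ∈ S, (K (Function.update u j (w j)) - K u) := by
    intro S
    induction S using Finset.induction_on with
    | empty => simp
    | insert i S hi ih =>
      rw [Finset.piecewise_insert, Finset.sum_insert hi, ← hstep S i hi]
      linarith
  simpa using hsum Finset.univ

namespace IsRichSystem

variable {n : ℕ} {Ω : Set (Fin n → ℝ)} {lam : Fin n → (Fin n → ℝ) → ℝ} {N : (Fin n → ℝ) → ℝ}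

theorem differentiableAt_lam (h : IsRichSystem Ω lam N) (i : Fin n) {w : Fin n → ℝ} (hw : w ∈ Ω) :
    DifferentiableAt ℝ (lam i) w :=
  ((h.contDiffOn_lam i).contDiffAt (h.isOpen.mem_nhds hw)).differentiableAt (by simp)

theorem differentiableAt_N (h : IsRichSystem Ω lam N) {w : Fin n → ℝ} (hw : w ∈ Ω) :
    DifferentiableAt ℝ N w :=
  (h.contDiffOn_N.contDiffAt (h.isOpen.mem_nhds hw)).differentiableAt (by simp)

/-- In the `k`-th direction richness turns the derivative into `∂ₖ N` times `(λₖ - λᵢ) - (λₖ - λⱼ) +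
(λᵢ - λⱼ) = 0`. -/
theorem fderiv_mul_sub_eq_zero (h : IsRichSystem Ω lam N) (i j : Fin n) {w : Fin n → ℝ}
    (hw : w ∈ Ω) : fderiv ℝ (fun w => N w * (lam i w - lam j w)) w = 0 := by
  have h1 := (h.differentiableAt_N hw).hasFDerivAt
  have h2 := (h.differentiableAt_lam i hw).hasFDerivAt.sub (h.differentiableAt_lam j hw).hasFDerivAt
  have h3 : HasFDerivAt (fun w => N w * (lam i w - lam j w)) _ w := h1.mul h2
  rw [h3.fderiv]
  refine ContinuousLinearMap.ext fun v => ?_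
  have hv : v = ∑ k, v k • (Pi.single k (1 : ℝ) : Fin n → ℝ) := by
    ext l
    simp [Finset.sum_apply, Pi.single_apply]
  rw [hv, map_sum, map_sum]
  refine Finset.sum_congr rfl fun k _ => ?_
  rw [map_smul]
  have hi := h.rich w hw i k
  have hj := h.rich w hw j k
  simp only [pderivW] at hi hj
  simp only [add_apply, smul_apply, sub_apply, smul_eq_mul]
  have : N w * (fderiv ℝ (lam i) w (Pi.single k 1) - fderiv ℝ (lam j) w (Pi.single k 1)) +
      (lam i w - lam j w) * fderiv ℝ N w (Pi.single k 1) = 0 := by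
    linarith
  rw [this]
  simp

theorem exists_lagrangianSpeeds (h : IsRichSystem Ω lam N) {u : Fin n → ℝ} (hu : u ∈ Ω) :
    ∃ lamT, IsLagrangianSpeeds Ω lam N lamT := by
  rcases isEmpty_or_nonempty (Fin n) with hn | ⟨⟨k⟩⟩
  · exact ⟨0, 0, fun w _ i => hn.elim i⟩
  · refine ⟨fun i => N u * lam i u, fun w => N w * lam k w - N u * lam k u, fun w hw i => ?_⟩
    have hd : DifferentiableOn ℝ (fun w => N w * (lam i w - lam k w)) Ω := fun w hw =>
      ((h.differentiableAt_N hw).mul ((h.differentiableAt_lam i hw).sub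
        (h.differentiableAt_lam k hw))).differentiableWithinAt
    have := h.isOpen.is_const_of_fderiv_eq_zero h.isPreconnected hd
      (fun w hw => h.fderiv_mul_sub_eq_zero i k hw) hw hu
    linarith

theorem sub_speed (h : IsRichSystem Ω lam N) {lamT : Fin n → ℝ}
    (hT : IsLagrangianSpeeds Ω lam N lamT) {w : Fin n → ℝ} (hw : w ∈ Ω) (i j : Fin n) :
    lam i w - lam j w = (lamT i - lamT j) * (1 / N w) := by
  obtain ⟨M, hM⟩ := hT
  have h1 := hM w hw i
  have h2 := hM w hw j
  have := h.N_pos w hw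
  field_simp
  linarith

theorem speed_strictMono (h : IsRichSystem Ω lam N) {lamT : Fin n → ℝ}
    (hT : IsLagrangianSpeeds Ω lam N lamT) {w : Fin n → ℝ} (hw : w ∈ Ω) : StrictMono lamT := by
  intro i j hij
  have h1 := h.sub_speed hT hw j i
  have h2 : lam i w < lam j w := h.strictlyHyperbolic w hw hij
  have h3 : 0 < 1 / N w := one_div_pos.2 (h.N_pos w hw)
  have h4 : 0 < (lamT j - lamT i) * (1 / N w) := by linarith
  have := (pos_iff_pos_of_mul_pos h4).2 h3
  linarith

variable {a b : Fin n → ℝ}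

/-- Integrated form of linear degeneracy; the box keeps the whole segment inside `Ω`. -/
theorem lam_update_self (h : IsRichSystem Ω lam N) (hab : Icc a b ⊆ Ω) {w : Fin n → ℝ}
    (hw : w ∈ Icc a b) (j : Fin n) {s : ℝ} (hs : s ∈ Icc (a j) (b j)) :
    lam j (Function.update w j s) = lam j w := by
  have hd : ∀ r ∈ Icc (a j) (b j),
      HasDerivWithinAt (fun r => lam j (Function.update w j r)) 0 (Icc (a j) (b j)) r := by
    intro r hr
    have hΩ := hab (update_mem_Icc hw hr)
    have h1 := HasFDerivAt.comp_hasDerivAt r (f := Function.update w j) (l := lam j)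
      (h.differentiableAt_lam j hΩ).hasFDerivAt (hasDerivAt_update w j r)
    have h2 := h.linearlyDegenerate _ hΩ j
    rw [pderivW] at h2
    rw [h2] at h1
    exact h1.hasDerivWithinAt
  have := (convex_Icc (a j) (b j)).norm_image_sub_le_of_norm_hasDerivWithin_le (C := 0) hd
    (by simp) (apply_mem_Icc hw j) hs
  simpa [sub_eq_zero] using this

/-- The function `(λ̃ᵢ - λ̃ⱼ) / N` equals `λᵢ - λⱼ`. Since `λᵢ` ignores `wᵢ` and `λⱼ` ignores `wⱼ`,
each has vanishing mixed second difference in `(wᵢ, wⱼ)`, hence so has `1 / N`. -/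
theorem mixed_difference (h : IsRichSystem Ω lam N) {lamT : Fin n → ℝ}
    (hT : IsLagrangianSpeeds Ω lam N lamT) (hab : Icc a b ⊆ Ω) {w : Fin n → ℝ}
    (hw : w ∈ Icc a b) {i j : Fin n} (hij : i ≠ j) {s r : ℝ} (hs : s ∈ Icc (a i) (b i))
    (hr : r ∈ Icc (a j) (b j)) :
    1 / N (Function.update (Function.update w i s) j r) - 1 / N (Function.update w i s) =
      1 / N (Function.update w j r) - 1 / N w := by
  have hi := update_mem_Icc hw hs
  have hj := update_mem_Icc hw hr
  have hij' := update_mem_Icc hi hr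
  have e1 := h.sub_speed hT (hab hij') i j
  have e2 := h.sub_speed hT (hab hi) i j
  have e3 := h.sub_speed hT (hab hj) i j
  have e4 := h.sub_speed hT (hab hw) i j
  rw [h.lam_update_self hab hi j hr, Function.update_comm hij,
    h.lam_update_self hab hj i hs] at e1
  rw [h.lam_update_self hab hw i hs] at e2
  rw [h.lam_update_self hab hw j hr] at e3
  rw [Function.update_comm hij]
  have hne : lamT i - lamT j ≠ 0 :=
    sub_ne_zero.2 fun heq => hij ((h.speed_strictMono hT (hab hw)).injective heq)
  apply mul_left_cancel₀ hne
  linarith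

/-- The increment of `1 / N` when the `j`-th entry of `u` is replaced by `s`. -/
def _root_.invIncr (N : (Fin n → ℝ) → ℝ) (u : Fin n → ℝ) (j : Fin n) (s : ℝ) : ℝ :=
  1 / N (Function.update u j s) - 1 / N u

theorem one_div_eq (h : IsRichSystem Ω lam N) {lamT : Fin n → ℝ}
    (hT : IsLagrangianSpeeds Ω lam N lamT) (hab : Icc a b ⊆ Ω) {u w : Fin n → ℝ}
    (hu : u ∈ Icc a b) (hw : w ∈ Icc a b) :
    1 / N w = 1 / N u + ∑ j, invIncr N u j (w j) :=
  eq_add_sum_of_mixed_difference (K := fun w => 1 / N w)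
    (fun _ hw _ _ hij _ hs _ hr => h.mixed_difference hT hab hw hij hs hr) hu hw

/-- As `λⱼ` is unchanged when `wⱼ` moves, the increment of `λᵢ` is that of `λᵢ - λⱼ = (λ̃ᵢ - λ̃ⱼ) /
N`. -/
theorem lam_update_sub (h : IsRichSystem Ω lam N) {lamT : Fin n → ℝ}
    (hT : IsLagrangianSpeeds Ω lam N lamT) (hab : Icc a b ⊆ Ω) {w : Fin n → ℝ}
    (hw : w ∈ Icc a b) (i j : Fin n) {s : ℝ} (hs : s ∈ Icc (a j) (b j)) :
    lam i (Function.update w j s) - lam i w = (lamT i - lamT j) * invIncr N w j s := by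
  have e1 := h.sub_speed hT (hab (update_mem_Icc hw hs)) i j
  have e2 := h.sub_speed hT (hab hw) i j
  rw [h.lam_update_self hab hw j hs] at e1
  rw [invIncr]
  linarith

theorem lam_eq (h : IsRichSystem Ω lam N) {lamT : Fin n → ℝ}
    (hT : IsLagrangianSpeeds Ω lam N lamT) (hab : Icc a b ⊆ Ω) {u w : Fin n → ℝ}
    (hu : u ∈ Icc a b) (hw : w ∈ Icc a b) (i : Fin n) :
    lam i w = lam i u + ∑ j, (lamT i - lamT j) * invIncr N u j (w j) := by
  rw [eq_add_sum_of_mixed_difference (K := lam i) ?_ hu hw]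
  · congr 1
    exact Finset.sum_congr rfl fun j _ => h.lam_update_sub hT hab hu i j (apply_mem_Icc hw j)
  · intro w hw k j hkj s hs r hr
    rw [h.lam_update_sub hT hab (update_mem_Icc hw hs) i j hr, h.lam_update_sub hT hab hw i j hr,
      invIncr, invIncr, h.mixed_difference hT hab hw hkj hs hr]

theorem locallyLipschitzOn_one_div (h : IsRichSystem Ω lam N) (hab : Icc a b ⊆ Ω) :
    LocallyLipschitzOn (Icc a b) (fun w => 1 / N w) := by
  intro w hw
  have hc : ContDiffAt ℝ 1 (fun w => 1 / N w) w := by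
    have := (h.contDiffOn_N.contDiffAt (h.isOpen.mem_nhds (hab hw))).of_le
      (by simp : (1 : WithTop ℕ∞) ≤ ∞)
    exact contDiffAt_const.div this (h.N_pos w (hab hw)).ne'
  obtain ⟨K, t, ht, hK⟩ := hc.exists_lipschitzOnWith
  exact ⟨K, t, mem_nhdsWithin_of_mem_nhds ht, hK⟩

/-- This transfers integrability from `w⁰ - w̄` to the increments of `1 / N`. -/
theorem exists_lipschitz_invIncr (h : IsRichSystem Ω lam N) (hab : Icc a b ⊆ Ω) {u : Fin n → ℝ}
    (hu : u ∈ Icc a b) :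
    ∃ C : ℝ, 0 ≤ C ∧ ∀ j, ∀ s ∈ Icc (a j) (b j), ∀ r ∈ Icc (a j) (b j),
      |invIncr N u j s - invIncr N u j r| ≤ C * |s - r| := by
  obtain ⟨K, hK⟩ := (h.locallyLipschitzOn_one_div hab).exists_lipschitzOnWith_of_compact isCompact_Icc
  refine ⟨K, K.2, fun j s hs r hr => ?_⟩
  have := hK.dist_le_mul _ (update_mem_Icc hu hs) _ (update_mem_Icc hu hr)
  have hd : dist (Function.update u j s) (Function.update u j r) ≤ |s - r| := by
    refine (dist_pi_le_iff (abs_nonneg _)).2 fun i => ?_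
    by_cases hi : i = j
    · subst hi; simp [Real.dist_eq]
    · simp [hi]
  have h2 : |invIncr N u j s - invIncr N u j r| ≤
      K * dist (Function.update u j s) (Function.update u j r) := by
    simpa [invIncr, Real.dist_eq] using this
  exact h2.trans (mul_le_mul_of_nonneg_left hd K.2)

theorem exists_bounds_N (h : IsRichSystem Ω lam N) {K : Set (Fin n → ℝ)} (hK : K ⊆ Ω)
    (hc : IsCompact K) : ∃ m C : ℝ, 0 < m ∧ (∀ w ∈ K, m ≤ N w) ∧ (∀ w ∈ K, N w ≤ C) ∧
      ∀ w ∈ K, ∀ i, |lam i w| ≤ C := by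
  have hN : ContinuousOn N K := h.contDiffOn_N.continuousOn.mono hK
  rcases K.eq_empty_or_nonempty with rfl | hne
  · exact ⟨1, 0, by simp⟩
  obtain ⟨w₀, hw₀, hmin⟩ := hc.exists_isMinOn hne hN
  obtain ⟨C, hC⟩ := hc.exists_bound_of_continuousOn hN
  have hl : ∀ i, ∃ C, ∀ w ∈ K, ‖lam i w‖ ≤ C := fun i =>
    hc.exists_bound_of_continuousOn ((h.contDiffOn_lam i).continuousOn.mono hK)
  choose D hD using hl
  have hD0 : ∀ i, 0 ≤ D i := fun i => (norm_nonneg _).trans (hD i w₀ hw₀)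
  have hC0 : 0 ≤ C := (norm_nonneg _).trans (hC w₀ hw₀)
  refine ⟨N w₀, C + ∑ i, D i, h.N_pos _ (hK hw₀), fun w hw => hmin hw, fun w hw => ?_,
    fun w hw i => ?_⟩
  · have := (le_abs_self _).trans (hC w hw)
    have := Finset.sum_nonneg fun i (_ : i ∈ Finset.univ) => hD0 i
    linarith
  · have h1 : |lam i w| ≤ D i := hD i w hw
    have h2 := Finset.single_le_sum (fun i (_ : i ∈ Finset.univ) => hD0 i) (Finset.mem_univ i)
    linarith

end IsRichSystem

/-! ### Continuity in `L¹` of compositions with expanding maps of the line -/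

theorem antilipschitzWith_of_slope {f : ℝ → ℝ} {m : ℝ} (hm : 0 < m)
    (h : ∀ x y, x ≤ y → m * (y - x) ≤ f y - f x) : AntilipschitzWith (1 / m).toNNReal f := by
  refine AntilipschitzWith.of_le_mul_dist fun x y => ?_
  rw [Real.coe_toNNReal _ (by positivity), Real.dist_eq, Real.dist_eq, div_mul_eq_mul_div,
    le_div_iff₀ hm, one_mul, mul_comm]
  rcases le_total x y with hxy | hxy
  · rw [abs_sub_comm, abs_of_nonneg (sub_nonneg.2 hxy), abs_sub_comm]
    exact (h x y hxy).trans (le_abs_self _)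
  · rw [abs_of_nonneg (sub_nonneg.2 hxy)]
    exact (h y x hxy).trans (le_abs_self _)

theorem volume_preimage_le_of_slope {f : ℝ → ℝ} {m : ℝ} (hm : 0 < m)
    (h : ∀ x y, x ≤ y → m * (y - x) ≤ f y - f x) (s : Set ℝ) :
    volume (f ⁻¹' s) ≤ ((1 / m).toNNReal : ENNReal) * volume s := by
  have := (antilipschitzWith_of_slope hm h).hausdorffMeasure_preimage_le zero_le_one s
  rw [hausdorffMeasure_real] at this
  simpa using this

theorem quasiMeasurePreserving_of_slope {f : ℝ → ℝ} {m : ℝ} (hm : 0 < m) (hf : Measurable f)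
    (h : ∀ x y, x ≤ y → m * (y - x) ≤ f y - f x) :
    Measure.QuasiMeasurePreserving f volume volume := by
  refine ⟨hf, Measure.AbsolutelyContinuous.mk fun s hs h0 => ?_⟩
  rw [Measure.map_apply hf hs]
  have := volume_preimage_le_of_slope hm h s
  rw [h0, mul_zero] at this
  exact le_antisymm this zero_le

/-- A map with slope at least `m` pushes Lebesgue measure forward to a measure bounded by `1 / m`
times Lebesgue measure. -/
theorem eLpNorm_comp_le_of_slope {f : ℝ → ℝ} {m : ℝ} (hm : 0 < m) (hf : Measurable f)
    (h : ∀ x y, x ≤ y → m * (y - x) ≤ f y - f x) {u : ℝ → ℝ} (hu : AEStronglyMeasurable u) :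
    eLpNorm (fun x => u (f x)) 1 volume ≤ ((1 / m).toNNReal : ENNReal) * eLpNorm u 1 volume := by
  have hq := quasiMeasurePreserving_of_slope hm hf h
  have h1 : eLpNorm (u ∘ f) 1 volume = eLpNorm u 1 (Measure.map f volume) :=
    (eLpNorm_map_measure (hu.mono_ac hq.absolutelyContinuous) hf.aemeasurable).symm
  have hle : Measure.map f volume ≤ ((1 / m).toNNReal : ENNReal) • (volume : Measure ℝ) := by
    refine Measure.le_iff.2 fun s hs => ?_
    rw [Measure.map_apply hf hs]
    simpa using volume_preimage_le_of_slope hm h s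
  calc eLpNorm (u ∘ f) 1 volume = eLpNorm u 1 (Measure.map f volume) := h1
    _ ≤ eLpNorm u 1 (((1 / m).toNNReal : ENNReal) • (volume : Measure ℝ)) :=
      eLpNorm_mono_measure _ hle
    _ = _ := by
      rw [eLpNorm_one_eq_lintegral_enorm, lintegral_smul_measure, eLpNorm_one_eq_lintegral_enorm]
      rfl

theorem integrable_comp_of_slope {f : ℝ → ℝ} {m : ℝ} (hm : 0 < m) (hf : Measurable f)
    (h : ∀ x y, x ≤ y → m * (y - x) ≤ f y - f x) {u : ℝ → ℝ} (hu : Integrable u) :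
    Integrable (fun x => u (f x)) := by
  rw [← memLp_one_iff_integrable] at hu ⊢
  refine ⟨hu.1.comp_quasiMeasurePreserving (quasiMeasurePreserving_of_slope hm hf h), ?_⟩
  exact (eLpNorm_comp_le_of_slope hm hf h hu.1).trans_lt
    (ENNReal.mul_lt_top ENNReal.coe_lt_top hu.2)

/-- Dominated convergence: since `θ t` stays within `C` of `θ₀`, the integrand lives on the preimage
under `θ₀` of the `C`-thickened support, which has finite measure because `θ₀` is expanding. -/
theorem tendsto_eLpNorm_comp_sub_of_hasCompactSupport {ι : Type*} {l : Filter ι}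
    [l.IsCountablyGenerated] {g : ℝ → ℝ} (hg : Continuous g) (hgc : HasCompactSupport g)
    {θ : ι → ℝ → ℝ} {θ₀ : ℝ → ℝ} {m : ℝ} (hm : 0 < m) (hθ : ∀ t, Measurable (θ t))
    (hθ₀ : Measurable θ₀) (hs₀ : ∀ x y, x ≤ y → m * (y - x) ≤ θ₀ y - θ₀ x)
    (hlim : ∀ x, Tendsto (fun t => θ t x) l (𝓝 (θ₀ x)))
    {C : ℝ} (hC : ∀ᶠ t in l, ∀ x, |θ t x - θ₀ x| ≤ C) :
    Tendsto (fun t => eLpNorm (fun x => g (θ t x) - g (θ₀ x)) 1 volume) l (𝓝 0) := by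
  obtain ⟨B, hB⟩ := hgc.exists_bound_of_continuous hg
  set K := Metric.cthickening C (tsupport g) with hK
  have hKc : IsCompact K := hgc.isCompact.cthickening
  simp only [eLpNorm_one_eq_lintegral_enorm]
  have h0 : (0 : ENNReal) = ∫⁻ _ : ℝ, 0 := by simp
  rw [h0]
  refine tendsto_lintegral_filter_of_dominated_convergence
    (indicator (θ₀ ⁻¹' K) fun _ => ENNReal.ofReal (2 * B)) ?_ ?_ ?_ ?_
  · exact Eventually.of_forall fun t =>
      ((hg.measurable.comp (hθ t)).sub (hg.measurable.comp hθ₀)).enorm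
  · filter_upwards [hC] with t ht
    refine Eventually.of_forall fun x => ?_
    by_cases hx : x ∈ θ₀ ⁻¹' K
    · rw [indicator_of_mem hx, ← ofReal_norm]
      refine ENNReal.ofReal_le_ofReal ?_
      have := norm_sub_le (g (θ t x)) (g (θ₀ x))
      linarith [hB (θ t x), hB (θ₀ x)]
    · have h1 : g (θ t x) = 0 := by
        by_contra hne
        refine hx (Metric.mem_cthickening_of_dist_le (θ₀ x) (θ t x) C _
          (subset_tsupport g hne) ?_)
        rw [dist_comm, Real.dist_eq]
        exact ht x
      have h2 : g (θ₀ x) = 0 := by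
        by_contra hne
        exact hx (Metric.self_subset_cthickening _ (subset_tsupport g hne))
      simp [h1, h2]
  · rw [lintegral_indicator (hθ₀ hKc.isClosed.measurableSet), lintegral_const,
      Measure.restrict_apply_univ]
    refine ENNReal.mul_ne_top ENNReal.ofReal_ne_top (ne_top_of_le_ne_top ?_
      (volume_preimage_le_of_slope hm hs₀ K))
    exact ENNReal.mul_ne_top ENNReal.coe_ne_top hKc.measure_ne_top
  · refine Eventually.of_forall fun x => ?_
    have h1 : Tendsto (fun t => g (θ t x) - g (θ₀ x)) l (𝓝 0) := by
      have := ((hg.tendsto _).comp (hlim x)).sub_const (g (θ₀ x))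
      simpa using this
    simpa using h1.enorm

/-- If expanding maps `θ t` of the line converge pointwise to `θ₀` within bounded distance, then
`u ∘ θ t` converges to `u ∘ θ₀` in `L¹` for all integrable `u`. -/
theorem tendsto_eLpNorm_comp_sub {ι : Type*} {l : Filter ι}
    [l.IsCountablyGenerated] {u : ℝ → ℝ} (hu : Integrable u)
    {θ : ι → ℝ → ℝ} {θ₀ : ℝ → ℝ} {m : ℝ} (hm : 0 < m) (hθ : ∀ t, Measurable (θ t))
    (hθ₀ : Measurable θ₀) (hs : ∀ t x y, x ≤ y → m * (y - x) ≤ θ t y - θ t x)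
    (hs₀ : ∀ x y, x ≤ y → m * (y - x) ≤ θ₀ y - θ₀ x)
    (hlim : ∀ x, Tendsto (fun t => θ t x) l (𝓝 (θ₀ x)))
    {C : ℝ} (hC : ∀ᶠ t in l, ∀ x, |θ t x - θ₀ x| ≤ C) :
    Tendsto (fun t => eLpNorm (fun x => u (θ t x) - u (θ₀ x)) 1 volume) l (𝓝 0) := by
  set c : ENNReal := ((1 / m).toNNReal : ENNReal) with hc
  rw [ENNReal.tendsto_nhds_zero]
  intro ε hε
  have hctop : 2 * c + 1 ≠ ⊤ := by simp [hc, ENNReal.mul_eq_top]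
  -- Replacing `u` by a continuous compactly supported `g` costs `c = 1 / m` times the approximation
  -- error for each of `θ t` and `θ₀`; the difference for `g` costs one more unit.
  have hδ : ε / (2 * c + 1) ≠ 0 := ENNReal.div_ne_zero.2 ⟨hε.ne', hctop⟩
  obtain ⟨g, hgc, hgu, hg, -⟩ := (memLp_one_iff_integrable.2 hu).exists_hasCompactSupport_eLpNorm_sub_le
    ENNReal.one_ne_top hδ
  have hgl := tendsto_eLpNorm_comp_sub_of_hasCompactSupport hg hgc hm hθ hθ₀ hs₀ hlim hC
  rw [ENNReal.tendsto_nhds_zero] at hgl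
  have hum := hu.aestronglyMeasurable
  have hdm : AEStronglyMeasurable (u - g) := hum.sub hg.aestronglyMeasurable
  filter_upwards [hgl (ε / (2 * c + 1)) (pos_iff_ne_zero.2 hδ)] with t ht
  have hqt := quasiMeasurePreserving_of_slope hm (hθ t) (hs t)
  have hq₀ := quasiMeasurePreserving_of_slope hm hθ₀ hs₀
  have e1 := (eLpNorm_comp_le_of_slope hm (hθ t) (hs t) hdm).trans
    (mul_le_mul_right hgu c)
  have e2 := (eLpNorm_comp_le_of_slope hm hθ₀ hs₀ hdm).trans
    (mul_le_mul_right hgu c)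
  have hsplit : (fun x => u (θ t x) - u (θ₀ x)) =
      ((fun x => (u - g) (θ t x)) + fun x => g (θ t x) - g (θ₀ x)) - fun x => (u - g) (θ₀ x) := by
    ext x
    simp only [Pi.sub_apply, Pi.add_apply]
    ring
  have m1 : AEStronglyMeasurable (fun x => (u - g) (θ t x)) := hdm.comp_quasiMeasurePreserving hqt
  have m2 : AEStronglyMeasurable (fun x => (u - g) (θ₀ x)) := hdm.comp_quasiMeasurePreserving hq₀
  have m3 : AEStronglyMeasurable (fun x => g (θ t x) - g (θ₀ x)) :=
    ((hg.measurable.comp (hθ t)).sub (hg.measurable.comp hθ₀)).aestronglyMeasurable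
  rw [hsplit]
  calc _ ≤ eLpNorm (fun x => (u - g) (θ t x)) 1 volume +
        eLpNorm (fun x => g (θ t x) - g (θ₀ x)) 1 volume +
        eLpNorm (fun x => (u - g) (θ₀ x)) 1 volume :=
        (eLpNorm_sub_le (m1.add m3) m2 le_rfl).trans
          (add_le_add_left (eLpNorm_add_le m1 m3 le_rfl) _)
    _ ≤ c * (ε / (2 * c + 1)) + ε / (2 * c + 1) + c * (ε / (2 * c + 1)) :=
        add_le_add (add_le_add e1 ht) e2
    _ = (2 * c + 1) * (ε / (2 * c + 1)) := by ring
    _ ≤ ε := ENNReal.mul_div_le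

/-! ### Measurability of compositions and further calculus of potentials -/

theorem aestronglyMeasurable_comp_of_continuousOn {α E : Type*} [MeasurableSpace α]
    [TopologicalSpace E] [MeasurableSpace E] [BorelSpace E] {μ : Measure α}
    {f : E → ℝ} {K : Set E} (hf : ContinuousOn f K) (hK : MeasurableSet K) {w : α → E}
    (hw : AEMeasurable w μ) (hmem : ∀ᵐ x ∂μ, w x ∈ K) : AEStronglyMeasurable (fun x => f (w x)) μ := by
  classical
  have h1 : Measurable (K.piecewise f 0) := hf.measurable_piecewise continuousOn_const hK
  refine ((h1.comp_aemeasurable hw).congr ?_).aestronglyMeasurable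
  filter_upwards [hmem] with x hx
  simp [hx]

/-- The primitive of `q` fails to have derivative `q` only on a null set, which `(t, x) ↦ (t, Y)`
pulls back to a null set thanks to the slope bound; elsewhere the chain rule holds. -/
theorem IsPotential.comp_integral {Y α β : ℝ × ℝ → ℝ} (h : IsPotential Y α β) {m : ℝ} (hm : 0 < m)
    (hs : SlopeAtLeast m Y) {q : ℝ → ℝ} (hq : AEStronglyMeasurable q) {C : ℝ}
    (hC : ∀ x, |q x| ≤ C) :
    IsPotential (fun p => ∫ y in (0 : ℝ)..Y p, q y) (fun p => α p * q (Y p))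
      (fun p => β p * q (Y p)) := by
  obtain ⟨L, hL⟩ := h.lipschitz
  refine ⟨⟨_, (lipschitzWith_intervalIntegral hq hC 0).comp hL⟩, ?_⟩
  have h1 : ∀ᵐ p : ℝ × ℝ, HasDerivAt (fun x => ∫ y in (0 : ℝ)..x, q y) (q p.2) p.2 := by
    refine (Measure.quasiMeasurePreserving_snd (μ := (volume : Measure ℝ))
      (ν := (volume : Measure ℝ))).ae (p := fun x => HasDerivAt (fun x => ∫ y in (0 : ℝ)..x, q y)
        (q x) x) ?_
    filter_upwards [ae_hasDerivAt_intervalIntegral hq hC] with x hx using hx 0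
  filter_upwards [h.ae_hasFDerivAt, (hs.quasiMeasurePreserving hm hL).ae h1] with p hp hp1
  have h2 := HasDerivAt.comp_hasFDerivAt p hp1 hp
  have h3 : gradForm (α p * q (Y p)) (β p * q (Y p)) = q (Y p) • gradForm (α p) (β p) :=
    ContinuousLinearMap.ext fun v => by
      simp only [gradForm_apply, smul_apply, smul_eq_mul]
      ring
  rw [h3]
  exact h2

theorem ae_fst_ne_zero : ∀ᵐ p : ℝ × ℝ, p.1 ≠ 0 := by
  have : ∀ᵐ t : ℝ, t ≠ 0 := by simp [ae_iff]
  exact (Measure.quasiMeasurePreserving_fst (μ := (volume : Measure ℝ))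
    (ν := (volume : Measure ℝ))).ae this

/-- The indicator function of `t > 0`. -/
def posTime (p : ℝ × ℝ) : ℝ := if 0 < p.1 then 1 else 0

theorem abs_posTime_le (p : ℝ × ℝ) : |posTime p| ≤ 1 := by
  by_cases hp : 0 < p.1 <;> simp [posTime, hp]

theorem measurable_posTime : Measurable posTime :=
  Measurable.ite (measurableSet_lt measurable_const measurable_fst) measurable_const
    measurable_const

/-- Time enters only through `t⁺`, so that everything is frozen in the past, in accordance with the
zero flux in `extendPast`. -/
theorem isPotential_max (c : ℝ) : IsPotential (fun p : ℝ × ℝ => c * max p.1 0)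
    (fun p => c * posTime p) (fun _ => 0) := by
  have hmax : LipschitzWith 1 (fun p : ℝ × ℝ => max p.1 0) := LipschitzWith.prod_fst.max_const 0
  refine ⟨⟨‖c‖₊ * 1, (lipschitzWith_smul c).comp hmax⟩, ?_⟩
  filter_upwards [ae_fst_ne_zero] with p hp
  rcases hp.lt_or_gt with h | h
  · have h1 : (fun p : ℝ × ℝ => c * max p.1 0) =ᶠ[𝓝 p] fun _ => 0 := by
      filter_upwards [(continuous_fst.tendsto p).eventually (gt_mem_nhds h)] with q hq
      rw [max_eq_right hq.le, mul_zero]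
    have h2 : gradForm (c * posTime p) 0 = 0 := ContinuousLinearMap.ext fun v => by
      simp [posTime, h.not_gt]
    rw [h2]
    exact (hasFDerivAt_const (0 : ℝ) p).congr_of_eventuallyEq h1
  · have h1 : (fun p : ℝ × ℝ => c * max p.1 0) =ᶠ[𝓝 p] gradForm c 0 := by
      filter_upwards [(continuous_fst.tendsto p).eventually (lt_mem_nhds h)] with q hq
      rw [max_eq_left hq.le]
      simp
    have h2 : gradForm (c * posTime p) 0 = gradForm c 0 := by simp [posTime, h]
    rw [h2]
    exact (gradForm c 0).hasFDerivAt.congr_of_eventuallyEq h1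

theorem isPotential_snd : IsPotential (fun p : ℝ × ℝ => p.2) (fun _ => 0) (fun _ => 1) := by
  refine ⟨⟨1, LipschitzWith.prod_snd⟩, Eventually.of_forall fun p => ?_⟩
  have : gradForm 0 1 = ContinuousLinearMap.snd ℝ ℝ ℝ := ContinuousLinearMap.ext fun v => by simp
  rw [this]
  exact hasFDerivAt_snd

theorem IsPotential.add {Y Y' α β α' β' : ℝ × ℝ → ℝ} (h : IsPotential Y α β)
    (h' : IsPotential Y' α' β') :
    IsPotential (fun p => Y p + Y' p) (fun p => α p + α' p) (fun p => β p + β' p) := by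
  obtain ⟨L, hL⟩ := h.lipschitz
  obtain ⟨L', hL'⟩ := h'.lipschitz
  refine ⟨⟨L + L', hL.add hL'⟩, ?_⟩
  filter_upwards [h.ae_hasFDerivAt, h'.ae_hasFDerivAt] with p hp hp'
  have : gradForm (α p + α' p) (β p + β' p) = gradForm (α p) (β p) + gradForm (α' p) (β' p) :=
    ContinuousLinearMap.ext fun v => by simp; ring
  rw [this]
  exact hp.fun_add hp'

theorem isPotential_zero : IsPotential (fun _ => 0) (fun _ => 0) (fun _ => 0) := by
  refine ⟨⟨0, LipschitzWith.const 0⟩, Eventually.of_forall fun p => ?_⟩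
  have : gradForm 0 0 = 0 := ContinuousLinearMap.ext fun v => by simp
  rw [this]
  exact hasFDerivAt_const 0 p

theorem IsPotential.sum {ι : Type*} (s : Finset ι) {Y α β : ι → ℝ × ℝ → ℝ}
    (h : ∀ i ∈ s, IsPotential (Y i) (α i) (β i)) :
    IsPotential (fun p => ∑ i ∈ s, Y i p) (fun p => ∑ i ∈ s, α i p) (fun p => ∑ i ∈ s, β i p) := by
  classical
  induction s using Finset.induction_on with
  | empty => simpa using isPotential_zero
  | insert i s hi ih =>
    simp only [Finset.sum_insert hi]
    exact (h i (Finset.mem_insert_self i s)).add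
      (ih fun j hj => h j (Finset.mem_insert_of_mem hj))

theorem IsPotential.const_mul {Y α β : ℝ × ℝ → ℝ} (h : IsPotential Y α β) (c : ℝ) :
    IsPotential (fun p => c * Y p) (fun p => c * α p) (fun p => c * β p) := by
  obtain ⟨L, hL⟩ := h.lipschitz
  refine ⟨⟨‖c‖₊ * L, (lipschitzWith_smul c).comp hL⟩, ?_⟩
  filter_upwards [h.ae_hasFDerivAt] with p hp
  have : gradForm (c * α p) (c * β p) = c • gradForm (α p) (β p) :=
    ContinuousLinearMap.ext fun v => by
      simp only [gradForm_apply, smul_apply, smul_eq_mul]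
      ring
  rw [this]
  exact hp.const_mul c

/-! ### Lagrangian data of the Cauchy problem -/

/-- The data of the Cauchy problem, with Lagrangian speeds `lamT` and the value `c` at `wbar` of
`λᵢ - λ̃ᵢ / N`, which does not depend on `i`. -/
structure IsCauchyData {n : ℕ} (Ω : Set (Fin n → ℝ)) (lam : Fin n → (Fin n → ℝ) → ℝ)
    (N : (Fin n → ℝ) → ℝ) (a b : Fin n → ℝ) (w0 : ℝ → Fin n → ℝ) (wbar lamT : Fin n → ℝ)
    (c : ℝ) : Prop where
  isRichSystem : IsRichSystem Ω lam N
  box_subset : Icc a b ⊆ Ω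
  mem_box : ∀ x, w0 x ∈ Icc a b
  wbar_mem : wbar ∈ Icc a b
  integrable : Integrable (fun x => w0 x - wbar) volume
  speeds : IsLagrangianSpeeds Ω lam N lamT
  lam_wbar : ∀ i, lam i wbar = c + lamT i * (1 / N wbar)

/-- The increment of `1 / N` due to the `j`-th entry of the initial data, in Lagrangian
coordinates. -/
def incr0 {n : ℕ} (N : (Fin n → ℝ) → ℝ) (w0 : ℝ → Fin n → ℝ) (wbar : Fin n → ℝ) (j : Fin n)
    (z : ℝ) : ℝ := invIncr N wbar j (wTilde0 N w0 z j)

/-- The primitive of `incr0`. -/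
def incrInt {n : ℕ} (N : (Fin n → ℝ) → ℝ) (w0 : ℝ → Fin n → ℝ) (wbar : Fin n → ℝ) (j : Fin n)
    (z : ℝ) : ℝ := ∫ y in (0 : ℝ)..z, incr0 N w0 wbar j y

namespace IsCauchyData

variable {n : ℕ} {Ω : Set (Fin n → ℝ)} {lam : Fin n → (Fin n → ℝ) → ℝ} {N : (Fin n → ℝ) → ℝ}
  {a b : Fin n → ℝ} {w0 : ℝ → Fin n → ℝ} {wbar lamT : Fin n → ℝ} {c : ℝ}

theorem exists_bounds (h : IsCauchyData Ω lam N a b w0 wbar lamT c) :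
    ∃ m C : ℝ, 0 < m ∧ 0 < C ∧ ∀ w ∈ Icc a b, m ≤ N w ∧ N w ≤ C := by
  obtain ⟨m, C, hm, h1, h2, -⟩ := h.isRichSystem.exists_bounds_N h.box_subset isCompact_Icc
  exact ⟨m, C, hm, hm.trans_le ((h1 _ h.wbar_mem).trans (h2 _ h.wbar_mem)),
    fun w hw => ⟨h1 w hw, h2 w hw⟩⟩

theorem aemeasurable_w0 (h : IsCauchyData Ω lam N a b w0 wbar lamT c) : AEMeasurable w0 := by
  have := h.integrable.aemeasurable.add_const wbar
  simpa using this

theorem aestronglyMeasurable_N (h : IsCauchyData Ω lam N a b w0 wbar lamT c) :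
    AEStronglyMeasurable (fun x => N (w0 x)) :=
  aestronglyMeasurable_comp_of_continuousOn
    (h.isRichSystem.contDiffOn_N.continuousOn.mono h.box_subset) measurableSet_Icc
    h.aemeasurable_w0 (Eventually.of_forall h.mem_box)

theorem abs_N_le {C : ℝ} (hC : ∀ w ∈ Icc a b, N w ≤ C)
    (h : IsCauchyData Ω lam N a b w0 wbar lamT c) (x : ℝ) : |N (w0 x)| ≤ C := by
  rw [abs_of_pos (h.isRichSystem.N_pos _ (h.box_subset (h.mem_box x)))]
  exact hC _ (h.mem_box x)

/-- Functions of one variable are viewed as functions on the plane that are constant in time, so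
that the inversion lemmas for potentials apply to them. -/
theorem isPotential_Z0 (h : IsCauchyData Ω lam N a b w0 wbar lamT c) :
    IsPotential (fun p => Z0 N w0 p.2) (fun _ => 0) (fun p => N (w0 p.2)) := by
  obtain ⟨m, C, -, -, hC⟩ := h.exists_bounds
  have := isPotential_snd.comp_integral (m := 1) one_pos (fun t x y _ => by simp)
    h.aestronglyMeasurable_N (h.abs_N_le fun w hw => (hC w hw).2)
  simpa [Z0] using this

theorem slope_Z0 {m : ℝ} (hm : ∀ w ∈ Icc a b, m ≤ N w)
    (h : IsCauchyData Ω lam N a b w0 wbar lamT c) :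
    SlopeAtLeast m (fun p => Z0 N w0 p.2) := fun t _ _ hxy =>
  h.isPotential_Z0.slope_of_le (Eventually.of_forall fun p => hm _ (h.mem_box p.2)) t hxy

theorem isPotential_X0 (h : IsCauchyData Ω lam N a b w0 wbar lamT c) :
    IsPotential (fun p => X0 N w0 p.2) (fun _ => 0) (fun p => 1 / N (wTilde0 N w0 p.2)) := by
  obtain ⟨m, C, hm, -, hC⟩ := h.exists_bounds
  have := (h.slope_Z0 fun w hw => (hC w hw).1).isPotential_fibreInv hm h.isPotential_Z0
  simpa [fibreInv, fibreMap, X0, wTilde0] using! this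

theorem X0_Z0 (h : IsCauchyData Ω lam N a b w0 wbar lamT c) (x : ℝ) : X0 N w0 (Z0 N w0 x) = x := by
  obtain ⟨m, C, hm, -, hC⟩ := h.exists_bounds
  exact (h.slope_Z0 fun w hw => (hC w hw).1).fibreInv_apply hm h.isPotential_Z0.continuous 0 x

theorem Z0_X0 (h : IsCauchyData Ω lam N a b w0 wbar lamT c) (z : ℝ) : Z0 N w0 (X0 N w0 z) = z := by
  obtain ⟨m, C, hm, -, hC⟩ := h.exists_bounds
  exact (h.slope_Z0 fun w hw => (hC w hw).1).apply_fibreInv hm h.isPotential_Z0.continuous 0 z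

theorem wTilde0_mem (h : IsCauchyData Ω lam N a b w0 wbar lamT c) (z : ℝ) :
    wTilde0 N w0 z ∈ Icc a b := h.mem_box _

theorem slope_X0 {C : ℝ} (hC : ∀ w ∈ Icc a b, N w ≤ C)
    (h : IsCauchyData Ω lam N a b w0 wbar lamT c) (x y : ℝ) (hxy : x ≤ y) :
    1 / C * (y - x) ≤ X0 N w0 y - X0 N w0 x :=
  h.isPotential_X0.slope_of_le (Eventually.of_forall fun p =>
    one_div_le_one_div_of_le (h.isRichSystem.N_pos _ (h.box_subset (h.wTilde0_mem p.2)))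
      (hC _ (h.wTilde0_mem p.2))) 0 hxy

theorem continuous_X0 (h : IsCauchyData Ω lam N a b w0 wbar lamT c) : Continuous (X0 N w0) :=
  h.isPotential_X0.continuous.comp (Continuous.prodMk_right (0 : ℝ))

theorem aemeasurable_wTilde0 (h : IsCauchyData Ω lam N a b w0 wbar lamT c) :
    AEMeasurable (wTilde0 N w0) := by
  obtain ⟨m, C, -, hC0, hC⟩ := h.exists_bounds
  exact h.aemeasurable_w0.comp_quasiMeasurePreserving
    (quasiMeasurePreserving_of_slope (one_div_pos.2 hC0) h.continuous_X0.measurable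
      (h.slope_X0 fun w hw => (hC w hw).2))

theorem aemeasurable_wTilde0_apply (h : IsCauchyData Ω lam N a b w0 wbar lamT c) (j : Fin n) :
    AEMeasurable (fun z => wTilde0 N w0 z j) :=
  (measurable_pi_apply j).comp_aemeasurable h.aemeasurable_wTilde0

theorem integrable_wTilde0_sub (h : IsCauchyData Ω lam N a b w0 wbar lamT c) (j : Fin n) :
    Integrable (fun z => wTilde0 N w0 z j - wbar j) := by
  obtain ⟨m, C, -, hC0, hC⟩ := h.exists_bounds
  exact integrable_comp_of_slope (one_div_pos.2 hC0) h.continuous_X0.measurable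
    (h.slope_X0 fun w hw => (hC w hw).2) (h.integrable.eval j)

theorem aestronglyMeasurable_incr0 (h : IsCauchyData Ω lam N a b w0 wbar lamT c) (j : Fin n) :
    AEStronglyMeasurable (incr0 N w0 wbar j) := by
  obtain ⟨C, hC0, hC⟩ := h.isRichSystem.exists_lipschitz_invIncr h.box_subset h.wbar_mem
  have hcont : ContinuousOn (invIncr N wbar j) (Icc (a j) (b j)) := by
    have : LipschitzOnWith C.toNNReal (invIncr N wbar j) (Icc (a j) (b j)) := by
      refine LipschitzOnWith.of_dist_le_mul fun x hx y hy => ?_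
      rw [Real.coe_toNNReal _ hC0]
      exact hC j x hx y hy
    exact this.continuousOn
  exact aestronglyMeasurable_comp_of_continuousOn hcont measurableSet_Icc
    (h.aemeasurable_wTilde0_apply j)
    (Eventually.of_forall fun z => apply_mem_Icc (h.wTilde0_mem z) j)

theorem invIncr_wbar (N : (Fin n → ℝ) → ℝ) (wbar : Fin n → ℝ) (j : Fin n) :
    invIncr N wbar j (wbar j) = 0 := by simp [invIncr]

theorem integrable_incr0 (h : IsCauchyData Ω lam N a b w0 wbar lamT c) (j : Fin n) :
    Integrable (incr0 N w0 wbar j) := by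
  obtain ⟨C, hC0, hC⟩ := h.isRichSystem.exists_lipschitz_invIncr h.box_subset h.wbar_mem
  refine ((h.integrable_wTilde0_sub j).norm.const_mul C).mono' (h.aestronglyMeasurable_incr0 j)
    (Eventually.of_forall fun z => ?_)
  have := hC j _ (apply_mem_Icc (h.wTilde0_mem z) j) _ (apply_mem_Icc h.wbar_mem j)
  rwa [invIncr_wbar, sub_zero] at this

theorem exists_abs_incr0_le (h : IsCauchyData Ω lam N a b w0 wbar lamT c) :
    ∃ C, ∀ j z, |incr0 N w0 wbar j z| ≤ C := by
  obtain ⟨C, hC0, hC⟩ := h.isRichSystem.exists_lipschitz_invIncr h.box_subset h.wbar_mem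
  refine ⟨C * ∑ j, |b j - a j|, fun j z => ?_⟩
  have h1 := apply_mem_Icc (h.wTilde0_mem z) j
  have h2 := apply_mem_Icc h.wbar_mem j
  have h3 := hC j _ h1 _ h2
  rw [invIncr_wbar, sub_zero] at h3
  refine h3.trans (mul_le_mul_of_nonneg_left ?_ hC0)
  have h4 : |wTilde0 N w0 z j - wbar j| ≤ |b j - a j| := by
    rw [abs_of_nonneg (sub_nonneg.2 (h1.1.trans h1.2)), abs_le]
    constructor <;> linarith [h1.1, h1.2, h2.1, h2.2]
  exact h4.trans (Finset.single_le_sum (f := fun j => |b j - a j|) (fun i _ => abs_nonneg _)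
    (Finset.mem_univ j))

end IsCauchyData

/-! ### The explicit solution -/

/-- The state at time `t⁺` and Lagrangian coordinate `z`. -/
def lagState {n : ℕ} (N : (Fin n → ℝ) → ℝ) (w0 : ℝ → Fin n → ℝ) (lamT : Fin n → ℝ)
    (p : ℝ × ℝ) : Fin n → ℝ := wTilde N w0 lamT (max p.1 0) p.2

/-- The common value of `λᵢ - λ̃ᵢ / N`. -/
def drift {n : ℕ} (N : (Fin n → ℝ) → ℝ) (wbar lamT : Fin n → ℝ) (c : ℝ) (w : Fin n → ℝ) : ℝ :=
  c - ∑ j, lamT j * invIncr N wbar j (w j)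

/-- The position at time `t⁺` of the particle with Lagrangian coordinate `z`. -/
def position {n : ℕ} (N : (Fin n → ℝ) → ℝ) (w0 : ℝ → Fin n → ℝ) (wbar lamT : Fin n → ℝ) (c : ℝ)
    (p : ℝ × ℝ) : ℝ :=
  1 / N wbar * p.2 + c * max p.1 0 + ∑ j, incrInt N w0 wbar j (p.2 - lamT j * max p.1 0)

/-- The Lagrangian coordinate of the particle at `x` at time `t⁺`. -/
def lagCoord {n : ℕ} (N : (Fin n → ℝ) → ℝ) (w0 : ℝ → Fin n → ℝ) (wbar lamT : Fin n → ℝ) (c : ℝ) :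
    ℝ × ℝ → ℝ := fibreInv (position N w0 wbar lamT c)

/-- The characteristic coordinate of the `i`-th family. -/
def charCoord {n : ℕ} (N : (Fin n → ℝ) → ℝ) (w0 : ℝ → Fin n → ℝ) (wbar lamT : Fin n → ℝ) (c : ℝ)
    (i : Fin n) (p : ℝ × ℝ) : ℝ := lagCoord N w0 wbar lamT c p - lamT i * max p.1 0

/-- The solution of the Cauchy problem. -/
def richSol {n : ℕ} (N : (Fin n → ℝ) → ℝ) (w0 : ℝ → Fin n → ℝ) (wbar lamT : Fin n → ℝ) (c : ℝ)
    (t x : ℝ) : Fin n → ℝ := fun i => wTilde0 N w0 (charCoord N w0 wbar lamT c i (t, x)) i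

namespace IsCauchyData

variable {n : ℕ} {Ω : Set (Fin n → ℝ)} {lam : Fin n → (Fin n → ℝ) → ℝ} {N : (Fin n → ℝ) → ℝ}
  {a b : Fin n → ℝ} {w0 : ℝ → Fin n → ℝ} {wbar lamT : Fin n → ℝ} {c : ℝ}

theorem wTilde_mem (h : IsCauchyData Ω lam N a b w0 wbar lamT c) (t z : ℝ) :
    wTilde N w0 lamT t z ∈ Icc a b :=
  ⟨fun i => (h.wTilde0_mem _).1 i, fun i => (h.wTilde0_mem _).2 i⟩

theorem lagState_mem (h : IsCauchyData Ω lam N a b w0 wbar lamT c) (p : ℝ × ℝ) :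
    lagState N w0 lamT p ∈ Icc a b := h.wTilde_mem _ _

theorem richSol_mem (h : IsCauchyData Ω lam N a b w0 wbar lamT c) (t x : ℝ) :
    richSol N w0 wbar lamT c t x ∈ Icc a b :=
  ⟨fun i => (h.wTilde0_mem _).1 i, fun i => (h.wTilde0_mem _).2 i⟩

/-- In the expansion of `λᵢ` about `w̄` with coefficients `λ̃ᵢ - λ̃ⱼ`, the part carrying `λ̃ᵢ`
recombines with `λᵢ(w̄)` into `c + λ̃ᵢ / N(w)`; what is left is independent of `i`. -/
theorem lam_eq_drift (h : IsCauchyData Ω lam N a b w0 wbar lamT c) {w : Fin n → ℝ}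
    (hw : w ∈ Icc a b) (i : Fin n) : lam i w = drift N wbar lamT c w + lamT i * (1 / N w) := by
  rw [h.isRichSystem.lam_eq h.speeds h.box_subset h.wbar_mem hw i,
    h.isRichSystem.one_div_eq h.speeds h.box_subset h.wbar_mem hw, h.lam_wbar i, drift]
  simp only [sub_mul, Finset.sum_sub_distrib, ← Finset.mul_sum]
  ring

theorem isPotential_char_incrInt (h : IsCauchyData Ω lam N a b w0 wbar lamT c) (j : Fin n) :
    IsPotential (fun p => incrInt N w0 wbar j (p.2 - lamT j * max p.1 0))
      (fun p => -(lamT j * posTime p) * incr0 N w0 wbar j (p.2 - lamT j * max p.1 0))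
      (fun p => incr0 N w0 wbar j (p.2 - lamT j * max p.1 0)) := by
  obtain ⟨C, hC⟩ := h.exists_abs_incr0_le
  have := (isPotential_snd.sub (isPotential_max (lamT j))).comp_integral (m := 1) one_pos
    (fun t x y _ => by simp) (h.aestronglyMeasurable_incr0 j) (hC j)
  simpa [incrInt] using this

/-- Both `1 / N` and `drift` are sums of functions of single components, each transported at its own
constant speed; this is why the field has the closed-form potential `position`. -/
theorem isPotential_position (h : IsCauchyData Ω lam N a b w0 wbar lamT c) :
    IsPotential (position N w0 wbar lamT c)
      (fun p => drift N wbar lamT c (lagState N w0 lamT p) * posTime p)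
      (fun p => 1 / N (lagState N w0 lamT p)) := by
  have h1 := ((isPotential_snd.const_mul (1 / N wbar)).add (isPotential_max c)).add
    (IsPotential.sum Finset.univ fun j _ => h.isPotential_char_incrInt j)
  refine IsPotential.congr_ae (Y := position N w0 wbar lamT c) h1 (Eventually.of_forall fun p => ?_)
    (Eventually.of_forall fun p => ?_)
  · simp only [drift, sub_mul, Finset.sum_mul, mul_zero, zero_add, neg_mul, Finset.sum_neg_distrib,
      ← sub_eq_add_neg]
    congr 1
    refine Finset.sum_congr rfl fun j _ => ?_
    simp only [incr0, lagState, wTilde]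
    ring
  · rw [h.isRichSystem.one_div_eq h.speeds h.box_subset h.wbar_mem (h.lagState_mem p)]
    simp [incr0, lagState, wTilde]

theorem slope_position {C : ℝ} (hC : ∀ w ∈ Icc a b, N w ≤ C)
    (h : IsCauchyData Ω lam N a b w0 wbar lamT c) :
    SlopeAtLeast (1 / C) (position N w0 wbar lamT c) := fun t _ _ hxy =>
  h.isPotential_position.slope_of_le (Eventually.of_forall fun p =>
    one_div_le_one_div_of_le (h.isRichSystem.N_pos _ (h.box_subset (h.lagState_mem p)))
      (hC _ (h.lagState_mem p))) t hxy

theorem position_lagCoord (h : IsCauchyData Ω lam N a b w0 wbar lamT c) (t x : ℝ) :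
    position N w0 wbar lamT c (t, lagCoord N w0 wbar lamT c (t, x)) = x := by
  obtain ⟨m, C, -, hC0, hC⟩ := h.exists_bounds
  exact (h.slope_position fun w hw => (hC w hw).2).apply_fibreInv (one_div_pos.2 hC0)
    h.isPotential_position.continuous t x

theorem lagCoord_position (h : IsCauchyData Ω lam N a b w0 wbar lamT c) (t z : ℝ) :
    lagCoord N w0 wbar lamT c (t, position N w0 wbar lamT c (t, z)) = z := by
  obtain ⟨m, C, -, hC0, hC⟩ := h.exists_bounds
  exact (h.slope_position fun w hw => (hC w hw).2).fibreInv_apply (one_div_pos.2 hC0)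
    h.isPotential_position.continuous t z

theorem position_zero : position N w0 wbar lamT c (0, 0) = 0 := by
  simp [position, incrInt]

/-- In the past the gradient is that of `X⁰`, and both functions vanish at the origin. -/
theorem position_of_nonpos (h : IsCauchyData Ω lam N a b w0 wbar lamT c) {t : ℝ} (ht : t ≤ 0)
    (z : ℝ) : position N w0 wbar lamT c (t, z) = X0 N w0 z := by
  refine h.isPotential_position.eq_of_grad_eq_of_neg h.isPotential_X0 ?_ ?_ ?_ ht z
  · exact Eventually.of_forall fun p hp => by simp [posTime, hp.not_gt]
  · refine Eventually.of_forall fun p hp => ?_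
    have : lagState N w0 lamT p = wTilde0 N w0 p.2 := by
      ext i
      simp [lagState, wTilde, max_eq_right hp.le]
    rw [this]
  · have h0 := h.X0_Z0 0
    rw [show Z0 N w0 0 = 0 by simp [Z0]] at h0
    rw [position_zero]
    exact h0.symm

theorem lagCoord_of_nonpos (h : IsCauchyData Ω lam N a b w0 wbar lamT c) {t : ℝ} (ht : t ≤ 0)
    (x : ℝ) : lagCoord N w0 wbar lamT c (t, x) = Z0 N w0 x := by
  have := h.lagCoord_position t (Z0 N w0 x)
  rwa [h.position_of_nonpos ht, h.X0_Z0] at this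

theorem richSol_of_nonpos (h : IsCauchyData Ω lam N a b w0 wbar lamT c) {t : ℝ} (ht : t ≤ 0)
    (x : ℝ) : richSol N w0 wbar lamT c t x = w0 x := by
  ext i
  simp [richSol, charCoord, h.lagCoord_of_nonpos ht, max_eq_right ht, wTilde0, h.X0_Z0]

theorem isPotential_lagCoord (h : IsCauchyData Ω lam N a b w0 wbar lamT c) :
    IsPotential (lagCoord N w0 wbar lamT c)
      (fun p => -(drift N wbar lamT c (richSol N w0 wbar lamT c p.1 p.2) *
        N (richSol N w0 wbar lamT c p.1 p.2) * posTime p))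
      (fun p => N (richSol N w0 wbar lamT c p.1 p.2)) := by
  obtain ⟨m, C, -, hC0, hC⟩ := h.exists_bounds
  have h1 := (h.slope_position fun w hw => (hC w hw).2).isPotential_fibreInv (one_div_pos.2 hC0)
    h.isPotential_position
  refine h1.congr_ae (Eventually.of_forall fun p => ?_) (Eventually.of_forall fun p => ?_)
  · have h2 : lagState N w0 lamT (fibreMap (fibreInv (position N w0 wbar lamT c)) p) =
      richSol N w0 wbar lamT c p.1 p.2 := rfl
    simp only [h2]
    have h3 : posTime (fibreMap (fibreInv (position N w0 wbar lamT c)) p) = posTime p := rfl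
    rw [h3]
    simp only [one_div, div_inv_eq_mul]
    ring
  · have h2 : lagState N w0 lamT (fibreMap (fibreInv (position N w0 wbar lamT c)) p) =
      richSol N w0 wbar lamT c p.1 p.2 := rfl
    simp only [h2, one_div_one_div]

/-- This is the potential of the first entropy equation: subtracting `λ̃ᵢ t⁺` turns `N` times the
drift into the flux `N λᵢ`. -/
theorem isPotential_charCoord (h : IsCauchyData Ω lam N a b w0 wbar lamT c) (i : Fin n) :
    IsPotential (charCoord N w0 wbar lamT c i)
      (fun p => -(N (richSol N w0 wbar lamT c p.1 p.2) *
        lam i (richSol N w0 wbar lamT c p.1 p.2) * posTime p))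
      (fun p => N (richSol N w0 wbar lamT c p.1 p.2)) := by
  refine (h.isPotential_lagCoord.sub (isPotential_max (lamT i))).congr_ae
    (Eventually.of_forall fun p => ?_) (Eventually.of_forall fun p => by simp)
  have hw := h.richSol_mem p.1 p.2
  have hN := (h.isRichSystem.N_pos _ (h.box_subset hw)).ne'
  rw [h.lam_eq_drift hw i]
  field_simp
  ring

theorem slope_charCoord {m : ℝ} (hm : ∀ w ∈ Icc a b, m ≤ N w)
    (h : IsCauchyData Ω lam N a b w0 wbar lamT c) (i : Fin n) :
    SlopeAtLeast m (charCoord N w0 wbar lamT c i) := fun t _ _ hxy =>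
  (h.isPotential_charCoord i).slope_of_le
    (Eventually.of_forall fun p => hm _ (h.richSol_mem p.1 p.2)) t hxy

theorem aemeasurable_richSol (h : IsCauchyData Ω lam N a b w0 wbar lamT c) :
    AEMeasurable (fun p : ℝ × ℝ => richSol N w0 wbar lamT c p.1 p.2) := by
  obtain ⟨m, C, hm, -, hC⟩ := h.exists_bounds
  refine aemeasurable_pi_lambda _ fun i => ?_
  obtain ⟨L, hL⟩ := (h.isPotential_charCoord i).lipschitz
  have hq := (h.slope_charCoord (fun w hw => (hC w hw).1) i).quasiMeasurePreserving hm hL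
  exact (h.aemeasurable_wTilde0_apply i).comp_quasiMeasurePreserving
    ((Measure.quasiMeasurePreserving_snd (μ := (volume : Measure ℝ))
      (ν := (volume : Measure ℝ))).comp hq)

/-- A potential yields the weak formulation with initial data. -/
theorem _root_.IsPotential.weak_formulation {Y ρ F : ℝ × ℝ → ℝ} {r : ℝ → ℝ}
    (h : IsPotential Y (fun p => -extendPast F 0 p) (extendPast ρ r))
    (hρ : AEStronglyMeasurable (extendPast ρ r)) (hF : AEStronglyMeasurable (extendPast F 0))
    {C : ℝ} (hCρ : ∀ p, |extendPast ρ r p| ≤ C) (hCF : ∀ p, |extendPast F 0 p| ≤ C)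
    {φ : ℝ × ℝ → ℝ} (hφ : ContDiff ℝ ∞ φ) (hc : HasCompactSupport φ) :
    (∫ p, (ρ p * fderiv ℝ φ p (1, 0) + F p * fderiv ℝ φ p (0, 1)) ∂halfPlane) +
      ∫ x, r x * φ (0, x) = 0 := by
  have h1 := locallyIntegrable_of_bounded hρ hCρ
  have h2 := locallyIntegrable_of_bounded hF hCF
  rw [← integral_extendPast h1 h2 hφ hc]
  exact h.isDivFree h1 h2 φ hφ hc

/-- Rotated gradients are divergence-free. The potentials are `charCoord` for the first equation and
a primitive of `w̃⁰ᵢ` composed with it for the second; as the solution equals `w0` for `t ≤ 0`, the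
initial data are included. -/
theorem isEntropySolution_richSol (h : IsCauchyData Ω lam N a b w0 wbar lamT c) :
    IsEntropySolution Ω lam N w0 (richSol N w0 wbar lamT c) := by
  set w := richSol N w0 wbar lamT c with hw
  have hmem : ∀ p : ℝ × ℝ, w p.1 p.2 ∈ Icc a b := fun p => h.richSol_mem p.1 p.2
  have hmeas := h.aemeasurable_richSol
  rw [← hw] at hmeas
  obtain ⟨m, C, hm, hN, hNC, hlC⟩ := h.isRichSystem.exists_bounds_N h.box_subset isCompact_Icc
  have hcN : ContinuousOn N (Icc a b) :=
    h.isRichSystem.contDiffOn_N.continuousOn.mono h.box_subset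
  have hcl : ∀ i, ContinuousOn (lam i) (Icc a b) := fun i =>
    (h.isRichSystem.contDiffOn_lam i).continuousOn.mono h.box_subset
  have hcx : ∀ i : Fin n, ContinuousOn (fun w : Fin n → ℝ => w i) (Icc a b) := fun i =>
    (continuous_apply i).continuousOn
  have hpos : ∀ {f : (Fin n → ℝ) → ℝ}, ContinuousOn f (Icc a b) →
      AEStronglyMeasurable (fun p : ℝ × ℝ => f (w p.1 p.2)) := fun hf =>
    aestronglyMeasurable_comp_of_continuousOn hf measurableSet_Icc hmeas (Eventually.of_forall hmem)
  have hbd : ∀ {f : (Fin n → ℝ) → ℝ}, ContinuousOn f (Icc a b) →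
      ∃ C, 0 ≤ C ∧ ∀ p : ℝ × ℝ, |f (w p.1 p.2)| ≤ C := fun hf => by
    obtain ⟨C, hC⟩ := isCompact_Icc.exists_bound_of_continuousOn hf
    exact ⟨C, (norm_nonneg _).trans (hC _ (hmem 0)), fun p => hC _ (hmem p)⟩
  have hext : ∀ f : (Fin n → ℝ) → ℝ,
      extendPast (fun p => f (w p.1 p.2)) (fun x => f (w0 x)) = fun p => f (w p.1 p.2) := by
    intro f
    ext p
    by_cases hp : 0 < p.1
    · rw [extendPast_of_pos hp]
    · rw [extendPast_of_nonpos (not_lt.1 hp), hw, h.richSol_of_nonpos (not_lt.1 hp)]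
  have hext0 : ∀ f : (Fin n → ℝ) → ℝ,
      extendPast (fun p => f (w p.1 p.2)) 0 = fun p => f (w p.1 p.2) * posTime p := by
    intro f
    ext p
    by_cases hp : 0 < p.1 <;> simp [extendPast, posTime, hp]
  have key : ∀ f g : (Fin n → ℝ) → ℝ, ContinuousOn f (Icc a b) → ContinuousOn g (Icc a b) →
      (∃ Y, IsPotential Y (fun p => -(g (w p.1 p.2) * posTime p)) (fun p => f (w p.1 p.2))) →
      ∀ φ : ℝ × ℝ → ℝ, ContDiff ℝ ∞ φ → HasCompactSupport φ →
      (∫ p, (f (w p.1 p.2) * fderiv ℝ φ p (1, 0) + g (w p.1 p.2) * fderiv ℝ φ p (0, 1))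
        ∂halfPlane) + ∫ x, f (w0 x) * φ (0, x) = 0 := by
    rintro f g hf hg ⟨Y, hY⟩ φ hφ hc
    obtain ⟨C, hC0, hC⟩ := hbd hf
    obtain ⟨D, hD0, hD⟩ := hbd hg
    refine IsPotential.weak_formulation (Y := Y) (ρ := fun p => f (w p.1 p.2))
      (F := fun p => g (w p.1 p.2)) (r := fun x => f (w0 x)) (C := C + D) ?_ ?_ ?_ ?_ ?_ hφ hc
    · rwa [hext, hext0]
    · rw [hext]
      exact hpos hf
    · rw [hext0]
      exact (hpos hg).mul measurable_posTime.aestronglyMeasurable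
    · intro p
      rw [hext]
      exact (hC p).trans (by linarith)
    · intro p
      rw [hext0]
      simp only [abs_mul]
      nlinarith [abs_posTime_le p, hD p, abs_nonneg (g (w p.1 p.2)), abs_nonneg (posTime p)]
  refine ⟨hmeas.aestronglyMeasurable.restrict, ⟨Icc a b, h.box_subset, isCompact_Icc,
    Eventually.of_forall hmem⟩, fun i => ?_, fun i => ?_⟩
  · exact key N (fun w => N w * lam i w) hcN (hcN.mul (hcl i)) ⟨_, h.isPotential_charCoord i⟩
  · refine key (fun w => N w * w i) (fun w => N w * lam i w * w i) (hcN.mul (hcx i))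
      ((hcN.mul (hcl i)).mul (hcx i)) ⟨_, ((h.isPotential_charCoord i).comp_integral hm
        (h.slope_charCoord hN i) (h.aemeasurable_wTilde0_apply i).aestronglyMeasurable
        (C := |a i| + |b i|) fun z => ?_).congr_ae (Eventually.of_forall fun p => ?_)
        (Eventually.of_forall fun p => ?_)⟩
    · have h1 := apply_mem_Icc (h.wTilde0_mem z) i
      rw [abs_le]
      constructor
      · linarith [h1.1, neg_abs_le (a i), abs_nonneg (b i)]
      · linarith [h1.2, le_abs_self (b i), abs_nonneg (a i)]
    · have : wTilde0 N w0 (charCoord N w0 wbar lamT c i p) i = w p.1 p.2 i := rfl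
      simp only [this]
      ring
    · rfl

/-- Each component minus its limit `w̄ᵢ` is an integrable function composed with `charCoord`, which
is Lipschitz in time and expanding in space, so even global `L¹` continuity holds; the components
are summed to bound the sup norm. -/
theorem continuousInL1loc_richSol (h : IsCauchyData Ω lam N a b w0 wbar lamT c) :
    ContinuousInL1loc (richSol N w0 wbar lamT c) := by
  obtain ⟨m, C, hm, -, hC⟩ := h.exists_bounds
  have hs := h.slope_charCoord fun w hw => (hC w hw).1
  have hcont : ∀ i t, Continuous fun x => charCoord N w0 wbar lamT c i (t, x) := fun i t =>
    (h.isPotential_charCoord i).continuous.comp (Continuous.prodMk_right t)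
  have hint : ∀ i t, Integrable fun x => richSol N w0 wbar lamT c t x i - wbar i := fun i t =>
    integrable_comp_of_slope hm (hcont i t).measurable (hs i t) (h.integrable_wTilde0_sub i)
  have hmeas : ∀ t, AEStronglyMeasurable (richSol N w0 wbar lamT c t) := fun t =>
    (aemeasurable_pi_lambda _ fun i => by
      simpa using (hint i t).aemeasurable.add_const (wbar i)).aestronglyMeasurable
  refine ⟨fun t _ => ?_, fun s _ R => ?_⟩
  · refine MemLp.locallyIntegrable (p := ⊤) ?_ le_top
    obtain ⟨B, hB⟩ := (isCompact_Icc (a := a) (b := b)).exists_bound_of_continuousOn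
      (f := fun w : Fin n → ℝ => w) continuousOn_id
    exact memLp_top_of_bound (hmeas t) B (Eventually.of_forall fun x => hB _ (h.richSol_mem t x))
  · have hlim : ∀ i, Tendsto (fun t => eLpNorm (fun x => richSol N w0 wbar lamT c t x i -
        richSol N w0 wbar lamT c s x i) 1 volume) (𝓝[Ici 0] s) (𝓝 0) := by
      intro i
      obtain ⟨L, hL⟩ := (h.isPotential_charCoord i).lipschitz
      have := tendsto_eLpNorm_comp_sub (l := 𝓝[Ici 0] s) (h.integrable_wTilde0_sub i)
        (θ := fun t x => charCoord N w0 wbar lamT c i (t, x))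
        (θ₀ := fun x => charCoord N w0 wbar lamT c i (s, x)) hm
        (fun t => (hcont i t).measurable) (hcont i s).measurable (fun t => hs i t) (hs i s)
        (fun x => ((hL.slice_fst x).continuous.tendsto s).mono_left nhdsWithin_le_nhds)
        (C := L) ?_
      · simpa [richSol] using this
      · have hball : ∀ᶠ t in 𝓝[Ici 0] s, dist t s ≤ 1 :=
          nhdsWithin_le_nhds (Metric.closedBall_mem_nhds s one_pos)
        filter_upwards [hball] with t ht x
        have h1 := (hL.slice_fst x).dist_le_mul t s
        rw [Real.dist_eq] at h1
        exact h1.trans (by nlinarith [L.2])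
    have hsum := tendsto_finsetSum Finset.univ fun i (_ : i ∈ Finset.univ) => hlim i
    rw [Finset.sum_const_zero] at hsum
    refine tendsto_of_tendsto_of_tendsto_of_le_of_le tendsto_const_nhds hsum (fun _ => zero_le)
      fun t => ?_
    have hmi : ∀ i, AEStronglyMeasurable fun x => richSol N w0 wbar lamT c t x i -
        richSol N w0 wbar lamT c s x i := fun i => by
      have := ((hint i t).sub (hint i s)).aestronglyMeasurable
      refine this.congr (Eventually.of_forall fun x => ?_)
      simp
    calc _ ≤ eLpNorm (fun x => richSol N w0 wbar lamT c t x - richSol N w0 wbar lamT c s x) 1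
          volume := eLpNorm_mono_measure _ Measure.restrict_le_self
      _ ≤ _ := by
        simp only [eLpNorm_one_eq_lintegral_enorm]
        rw [← lintegral_finsetSum' _ fun i _ => (hmi i).enorm]
        refine lintegral_mono fun x => ?_
        simp only [← ofReal_norm]
        rw [← ENNReal.ofReal_sum_of_nonneg fun i _ => norm_nonneg _]
        refine ENNReal.ofReal_le_ofReal
          ((pi_norm_le_iff_of_nonneg (Finset.sum_nonneg fun i _ => norm_nonneg _)).2 fun i => ?_)
        exact Finset.single_le_sum (f := fun i => ‖richSol N w0 wbar lamT c t x i -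
          richSol N w0 wbar lamT c s x i‖) (fun i _ => norm_nonneg _) (Finset.mem_univ i)

end IsCauchyData

/-! ### Uniqueness of entropy solutions -/

/-- The weak formulation with initial data yields a potential. -/
theorem exists_isPotential_of_weak_formulation {ρ F : ℝ × ℝ → ℝ} {r : ℝ → ℝ}
    (hρ : AEStronglyMeasurable (extendPast ρ r)) (hF : AEStronglyMeasurable (extendPast F 0))
    {C : ℝ} (hCρ : ∀ᵐ p, |extendPast ρ r p| ≤ C) (hCF : ∀ᵐ p, |extendPast F 0 p| ≤ C)
    (h : ∀ φ : ℝ × ℝ → ℝ, ContDiff ℝ ∞ φ → HasCompactSupport φ →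
      (∫ p, (ρ p * fderiv ℝ φ p (1, 0) + F p * fderiv ℝ φ p (0, 1)) ∂halfPlane) +
        ∫ x, r x * φ (0, x) = 0) :
    ∃ Y, IsPotential Y (fun p => -extendPast F 0 p) (extendPast ρ r) ∧ Y (0, 0) = 0 := by
  refine IsDivFree.exists_isPotential (fun φ hφ hc => ?_) hρ hF hCρ hCF
  have h1 := (memLp_top_of_bound hρ C hCρ).locallyIntegrable le_top
  have h2 := (memLp_top_of_bound hF C hCF).locallyIntegrable le_top
  rw [integral_extendPast h1 h2 hφ hc]
  exact h φ hφ hc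

namespace IsCauchyData

variable {n : ℕ} {Ω : Set (Fin n → ℝ)} {lam : Fin n → (Fin n → ℝ) → ℝ} {N : (Fin n → ℝ) → ℝ}
  {a b : Fin n → ℝ} {w0 : ℝ → Fin n → ℝ} {wbar lamT : Fin n → ℝ} {c : ℝ}

/-- The values of a function for positive times, and the initial data for the other times. -/
def withPast (w0 : ℝ → Fin n → ℝ) (v : ℝ → ℝ → Fin n → ℝ) (p : ℝ × ℝ) : Fin n → ℝ :=
  if 0 < p.1 then v p.1 p.2 else w0 p.2

theorem withPast_of_pos {v : ℝ → ℝ → Fin n → ℝ} {p : ℝ × ℝ} (hp : 0 < p.1) :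
    withPast w0 v p = v p.1 p.2 := if_pos hp

theorem withPast_of_nonpos {v : ℝ → ℝ → Fin n → ℝ} {p : ℝ × ℝ} (hp : p.1 ≤ 0) :
    withPast w0 v p = w0 p.2 := if_neg hp.not_gt

/-- An entropy solution extended by the initial data takes its values in a compact set. -/
theorem exists_compact_withPast (h : IsCauchyData Ω lam N a b w0 wbar lamT c)
    {v : ℝ → ℝ → Fin n → ℝ} (hv : IsEntropySolution Ω lam N w0 v) :
    ∃ K ⊆ Ω, IsCompact K ∧ ∀ᵐ p, withPast w0 v p ∈ K := by
  obtain ⟨K, hK, hKc, hmem⟩ := hv.bounded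
  refine ⟨K ∪ Icc a b, union_subset hK h.box_subset, hKc.union isCompact_Icc, ?_⟩
  filter_upwards [ae_halfPlane_iff.1 hmem] with p hp
  by_cases h0 : 0 < p.1
  · rw [withPast_of_pos h0]
    exact Or.inl (hp h0)
  · rw [withPast_of_nonpos (not_lt.1 h0)]
    exact Or.inr (h.mem_box _)

theorem aemeasurable_withPast (h : IsCauchyData Ω lam N a b w0 wbar lamT c)
    {v : ℝ → ℝ → Fin n → ℝ} (hv : IsEntropySolution Ω lam N w0 v) :
    AEMeasurable (withPast w0 v) := by
  refine aemeasurable_pi_lambda _ fun i => ?_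
  have h1 := aestronglyMeasurable_extendPast (ρ := fun p => v p.1 p.2 i) (r := fun x => w0 x i)
    ((measurable_pi_apply i).comp_aemeasurable
      hv.aestronglyMeasurable.aemeasurable).aestronglyMeasurable
    ((measurable_pi_apply i).comp_aemeasurable h.aemeasurable_w0).aestronglyMeasurable
  refine h1.aemeasurable.congr (Eventually.of_forall fun p => ?_)
  by_cases hp : 0 < p.1 <;> simp [extendPast, withPast, hp]

/-- Potentials of the two entropy equations of the `i`-th family. -/
theorem exists_potentials (h : IsCauchyData Ω lam N a b w0 wbar lamT c)
    {v : ℝ → ℝ → Fin n → ℝ} (hv : IsEntropySolution Ω lam N w0 v) (i : Fin n) :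
    (∃ Y, IsPotential Y (fun p => -(N (withPast w0 v p) * lam i (withPast w0 v p) * posTime p))
      (fun p => N (withPast w0 v p)) ∧ Y (0, 0) = 0) ∧
    ∃ P, IsPotential P
      (fun p => -(N (withPast w0 v p) * lam i (withPast w0 v p) * posTime p) * withPast w0 v p i)
      (fun p => N (withPast w0 v p) * withPast w0 v p i) := by
  obtain ⟨K, hKΩ, hKc, hK⟩ := h.exists_compact_withPast hv
  have hmeas := h.aemeasurable_withPast hv
  have hcN : ContinuousOn N K := h.isRichSystem.contDiffOn_N.continuousOn.mono hKΩ
  have hcl : ContinuousOn (lam i) K := (h.isRichSystem.contDiffOn_lam i).continuousOn.mono hKΩ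
  have hcx : ContinuousOn (fun w : Fin n → ℝ => w i) K := (continuous_apply i).continuousOn
  have key : ∀ f g : (Fin n → ℝ) → ℝ, ContinuousOn f K → ContinuousOn g K →
      (∀ φ : ℝ × ℝ → ℝ, ContDiff ℝ ∞ φ → HasCompactSupport φ →
        (∫ p, (f (v p.1 p.2) * fderiv ℝ φ p (1, 0) + g (v p.1 p.2) * fderiv ℝ φ p (0, 1))
          ∂halfPlane) + ∫ x, f (w0 x) * φ (0, x) = 0) →
      ∃ Y, IsPotential Y (fun p => -(g (withPast w0 v p) * posTime p))
        (fun p => f (withPast w0 v p)) ∧ Y (0, 0) = 0 := by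
    intro f g hf hg hw
    have e1 : extendPast (fun p => f (v p.1 p.2)) (fun x => f (w0 x)) =
        fun p => f (withPast w0 v p) := by
      ext p
      by_cases hp : 0 < p.1 <;> simp [extendPast, withPast, hp]
    have e2 : extendPast (fun p => g (v p.1 p.2)) 0 = fun p => g (withPast w0 v p) * posTime p := by
      ext p
      by_cases hp : 0 < p.1 <;> simp [extendPast, withPast, posTime, hp]
    obtain ⟨C, hC⟩ := hKc.exists_bound_of_continuousOn hf
    obtain ⟨D, hD⟩ := hKc.exists_bound_of_continuousOn hg
    have := exists_isPotential_of_weak_formulation (ρ := fun p => f (v p.1 p.2))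
      (F := fun p => g (v p.1 p.2)) (r := fun x => f (w0 x)) (C := max C D) ?_ ?_ ?_ ?_ hw
    · rwa [e1, e2] at this
    · rw [e1]
      exact aestronglyMeasurable_comp_of_continuousOn hf hKc.measurableSet hmeas hK
    · rw [e2]
      exact (aestronglyMeasurable_comp_of_continuousOn hg hKc.measurableSet hmeas hK).mul
        measurable_posTime.aestronglyMeasurable
    · rw [e1]
      filter_upwards [hK] with p hp using (hC _ hp).trans (le_max_left _ _)
    · rw [e2]
      filter_upwards [hK] with p hp
      have h1 : |g (withPast w0 v p)| ≤ D := hD _ hp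
      rw [abs_mul]
      calc _ ≤ D * 1 := mul_le_mul h1 (abs_posTime_le p) (abs_nonneg _)
            ((abs_nonneg _).trans h1)
        _ ≤ _ := by rw [mul_one]; exact le_max_right _ _
  refine ⟨key N (fun w => N w * lam i w) hcN (hcN.mul hcl) (hv.entropy_N i), ?_⟩
  obtain ⟨P, hP, -⟩ := key (fun w => N w * w i) (fun w => N w * lam i w * w i) (hcN.mul hcx)
    ((hcN.mul hcl).mul hcx) (hv.entropy_Nw i)
  refine ⟨P, hP.congr_ae (Eventually.of_forall fun p => ?_) (Eventually.of_forall fun p => rfl)⟩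
  ring

/-- Entropy solutions are unique. -/
theorem ae_eq_richSol (h : IsCauchyData Ω lam N a b w0 wbar lamT c)
    {v : ℝ → ℝ → Fin n → ℝ} (hv : IsEntropySolution Ω lam N w0 v) :
    ∀ᵐ p ∂halfPlane, v p.1 p.2 = richSol N w0 wbar lamT c p.1 p.2 := by
  rcases isEmpty_or_nonempty (Fin n) with hn | ⟨⟨k⟩⟩
  · exact Eventually.of_forall fun p => Subsingleton.elim _ _
  obtain ⟨K, hKΩ, hKc, hK⟩ := h.exists_compact_withPast hv
  obtain ⟨m, C, hm, hmN, -, -⟩ := h.isRichSystem.exists_bounds_N hKΩ hKc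
  set V := withPast w0 v with hV
  have hmV : ∀ᵐ p, m ≤ N (V p) := by
    filter_upwards [hK] with p hp using hmN _ hp
  have hpot := fun i => (h.exists_potentials hv i).1
  choose Y hY hY0 using hpot
  have hYs : ∀ i, SlopeAtLeast m (Y i) := fun i t _ _ hxy => (hY i).slope_of_le hmV t hxy
  have hYneg : ∀ i, ∀ t ≤ 0, ∀ x, Y i (t, x) = Z0 N w0 x := by
    intro i t ht x
    refine (hY i).eq_of_grad_eq_of_neg h.isPotential_Z0 ?_ ?_ ?_ ht x
    · exact Eventually.of_forall fun p hp => by simp [posTime, hp.not_gt]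
    · exact Eventually.of_forall fun p hp => by rw [withPast_of_nonpos hp.le]
    · rw [hY0]
      simp [Z0]
  -- The gradient of `P` is `Vᵢ` times that of `Yᵢ`, so `Vᵢ` is a function of `Yᵢ`; at negative
  -- times `Yᵢ = Z⁰`, which identifies that function.
  have hchar : ∀ i, ∀ᵐ p, V p i = wTilde0 N w0 (Y i p) i := by
    intro i
    obtain ⟨P, hP⟩ := (h.exists_potentials hv i).2
    refine ae_eq_comp_of_isPotential (hYs i) hm (hY i) hP (q := fun y => wTilde0 N w0 y i)
      (Eventually.of_forall fun p hp => ?_)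
    have := hYneg i p.1 hp.le p.2
    simp only [Prod.mk.eta] at this
    rw [this, withPast_of_nonpos hp.le, wTilde0, h.X0_Z0]
  set Z : ℝ × ℝ → ℝ := fun p => Y k p + lamT k * max p.1 0 with hZdef
  have hZ : IsPotential Z
      (fun p => -(N (V p) * lam k (V p) * posTime p) + lamT k * posTime p)
      (fun p => N (V p)) :=
    ((hY k).add (isPotential_max (lamT k))).congr_ae (Eventually.of_forall fun p => rfl)
      (Eventually.of_forall fun p => by simp [hV])
  -- All families share one Lagrangian coordinate, because `N (λᵢ - λₖ)` is the constant `λ̃ᵢ - λ̃ₖ`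
  -- and potentials vanishing at the origin are determined by their gradients.
  have hYZ : ∀ i p, Y i p = Z p - lamT i * max p.1 0 := by
    intro i
    have h1 : IsPotential (fun p => Z p - lamT i * max p.1 0)
        (fun p => -(N (V p) * lam i (V p) * posTime p)) (fun p => N (V p)) := by
      refine (hZ.sub (isPotential_max (lamT i))).congr_ae ?_
        (Eventually.of_forall fun p => by simp)
      filter_upwards [hK] with p hp
      have h2 := h.isRichSystem.sub_speed h.speeds (hKΩ hp) i k
      have h3 := h.isRichSystem.N_pos _ (hKΩ hp)
      have h4 : N (V p) * (lam i (V p) - lam k (V p)) = lamT i - lamT k := by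
        rw [h2]
        field_simp
      linear_combination posTime p * h4
    exact congrFun ((hY i).eq_of_grad_eq h1 (by simp [hY0, hZdef]))
  have hZs : SlopeAtLeast m Z := fun t _ _ hxy => hZ.slope_of_le hmV t hxy
  have hVZ : ∀ᵐ p, V p = lagState N w0 lamT (fibreMap Z p) := by
    filter_upwards [ae_all_iff.2 hchar] with p hp
    ext i
    rw [hp i, hYZ i]
    rfl
  obtain ⟨L, hL⟩ := hZ.lipschitz
  have hVX : ∀ᵐ q, V (fibreMap (fibreInv Z) q) = lagState N w0 lamT q := by
    filter_upwards [(hZs.quasiMeasurePreserving_inv hm hL).ae hVZ] with q hq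
    rw [hq, hZs.fibreMap_fibreMap_inv hm hL.continuous]
  -- In Lagrangian coordinates the state is known, so the gradient of the inverse of `Z` no longer
  -- depends on the solution and agrees with that of `position`.
  have hX : IsPotential (fibreInv Z)
      (fun p => drift N wbar lamT c (lagState N w0 lamT p) * posTime p)
      (fun p => 1 / N (lagState N w0 lamT p)) := by
    refine (hZs.isPotential_fibreInv hm hZ).congr_ae ?_ ?_
    · filter_upwards [hVX] with q hq
      have h1 : posTime (fibreMap (fibreInv Z) q) = posTime q := rfl
      have h2 := h.lagState_mem q
      have h3 := (h.isRichSystem.N_pos _ (h.box_subset h2)).ne'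
      rw [hq, h1, h.lam_eq_drift h2 k]
      field_simp
      ring
    · filter_upwards [hVX] with q hq
      rw [hq]
  have hX0 : fibreInv Z (0, 0) = 0 := by
    have h1 := hZs.fibreInv_apply hm hL.continuous 0 0
    have h2 : Z (0, 0) = 0 := by simp [hZdef, hY0]
    rwa [h2] at h1
  have hXeq : fibreInv Z = position N w0 wbar lamT c :=
    hX.eq_of_grad_eq h.isPotential_position (by rw [hX0, position_zero])
  have hZeq : ∀ t x, Z (t, x) = lagCoord N w0 wbar lamT c (t, x) := by
    intro t x
    have h1 := hZs.fibreInv_apply hm hL.continuous t x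
    rw [hXeq] at h1
    have h2 := h.lagCoord_position t (Z (t, x))
    rw [h1] at h2
    exact h2.symm
  rw [ae_halfPlane_iff]
  filter_upwards [hVZ] with p hp hp0
  rw [hV, withPast_of_pos hp0] at hp
  rw [hp]
  have : fibreMap Z p = fibreMap (lagCoord N w0 wbar lamT c) (p.1, p.2) := by
    simp only [fibreMap, Prod.mk.eta]
    rw [← hZeq p.1 p.2]
  rw [this]
  rfl

end IsCauchyData

/-! ### Asymptotic positions -/

theorem Fin.sum_eq_sum_Iio_add_sum_Ioi {n : ℕ} (f : Fin n → ℝ) (i : Fin n) :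
    ∑ j, f j = (∑ j ∈ Finset.Iio i, f j) + f i + ∑ j ∈ Finset.Ioi i, f j := by
  have h1 : (Finset.univ : Finset (Fin n)) = Finset.Iic i ∪ Finset.Ioi i := by
    ext j
    simp [le_or_gt]
  have h2 : Disjoint (Finset.Iic i) (Finset.Ioi i) :=
    Finset.disjoint_left.2 fun j hj hj' => by
      simp only [Finset.mem_Iic, Finset.mem_Ioi] at hj hj'
      exact absurd hj hj'.not_ge
  have h3 : Finset.Iic i = insert i (Finset.Iio i) := by
    ext j
    simp [le_iff_eq_or_lt]
  rw [h1, Finset.sum_union h2, h3, Finset.sum_insert (by simp)]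
  ring

/-- The limit of `incrInt` at `+∞`. -/
def incrTop {n : ℕ} (N : (Fin n → ℝ) → ℝ) (w0 : ℝ → Fin n → ℝ) (wbar : Fin n → ℝ)
    (j : Fin n) : ℝ := ∫ y in Ioi (0 : ℝ), incr0 N w0 wbar j y

/-- The limit of `incrInt` at `-∞`. -/
def incrBot {n : ℕ} (N : (Fin n → ℝ) → ℝ) (w0 : ℝ → Fin n → ℝ) (wbar : Fin n → ℝ)
    (j : Fin n) : ℝ := -∫ y in Iic (0 : ℝ), incr0 N w0 wbar j y

/-- The asymptotic position, relative to the velocity `λᵢ (wbar)`, of the `i`-th characteristic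
that starts at the Lagrangian coordinate `y`. -/
def asymPosition {n : ℕ} (N : (Fin n → ℝ) → ℝ) (w0 : ℝ → Fin n → ℝ) (wbar : Fin n → ℝ)
    (i : Fin n) (y : ℝ) : ℝ :=
  1 / N wbar * y + incrInt N w0 wbar i y + ((∑ j ∈ Finset.Iio i, incrTop N w0 wbar j) +
    ∑ j ∈ Finset.Ioi i, incrBot N w0 wbar j)

namespace IsCauchyData

variable {n : ℕ} {Ω : Set (Fin n → ℝ)} {lam : Fin n → (Fin n → ℝ) → ℝ} {N : (Fin n → ℝ) → ℝ}
  {a b : Fin n → ℝ} {w0 : ℝ → Fin n → ℝ} {wbar lamT : Fin n → ℝ} {c : ℝ}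

theorem tendsto_incrInt_atTop (h : IsCauchyData Ω lam N a b w0 wbar lamT c) (j : Fin n) :
    Tendsto (incrInt N w0 wbar j) atTop (𝓝 (incrTop N w0 wbar j)) :=
  intervalIntegral_tendsto_integral_Ioi 0 (h.integrable_incr0 j).integrableOn tendsto_id

theorem tendsto_incrInt_atBot (h : IsCauchyData Ω lam N a b w0 wbar lamT c) (j : Fin n) :
    Tendsto (incrInt N w0 wbar j) atBot (𝓝 (incrBot N w0 wbar j)) := by
  have := (intervalIntegral_tendsto_integral_Iic 0 (h.integrable_incr0 j).integrableOn
    (tendsto_id (x := atBot))).neg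
  refine this.congr fun z => ?_
  rw [incrInt, intervalIntegral.integral_symm z 0]
  simp

theorem integral_Ioi_incr0 (h : IsCauchyData Ω lam N a b w0 wbar lamT c) (j : Fin n) (y : ℝ) :
    ∫ ξ in Ioi y, incr0 N w0 wbar j ξ = incrTop N w0 wbar j - incrInt N w0 wbar j y := by
  have := intervalIntegral.integral_interval_add_Ioi (a := 0) (b := y)
    (h.integrable_incr0 j).integrableOn (h.integrable_incr0 j).integrableOn
  rw [incrTop, incrInt]
  linarith

theorem integral_Iic_incr0 (h : IsCauchyData Ω lam N a b w0 wbar lamT c) (j : Fin n) (y : ℝ) :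
    ∫ ξ in Iic y, incr0 N w0 wbar j ξ = incrInt N w0 wbar j y - incrBot N w0 wbar j := by
  have := intervalIntegral.integral_Iic_sub_Iic (a := 0) (b := y)
    (h.integrable_incr0 j).integrableOn (h.integrable_incr0 j).integrableOn
  rw [incrBot, incrInt]
  linarith

theorem integral_incr0 (h : IsCauchyData Ω lam N a b w0 wbar lamT c) (j : Fin n) :
    ∫ ξ, incr0 N w0 wbar j ξ = incrTop N w0 wbar j - incrBot N w0 wbar j := by
  have := intervalIntegral.integral_Iic_add_Ioi (b := 0)
    (h.integrable_incr0 j).integrableOn (h.integrable_incr0 j).integrableOn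
  rw [incrBot, incrTop]
  linarith

theorem abs_incrInt_le (h : IsCauchyData Ω lam N a b w0 wbar lamT c) (j : Fin n) (z : ℝ) :
    |incrInt N w0 wbar j z| ≤ ∫ ξ, |incr0 N w0 wbar j ξ| := by
  have h1 := intervalIntegral.norm_integral_le_integral_norm_uIoc (f := incr0 N w0 wbar j)
    (μ := volume) (a := 0) (b := z)
  exact h1.trans (setIntegral_le_integral (h.integrable_incr0 j).norm
    (Eventually.of_forall fun ξ => norm_nonneg _))

theorem lam_update_sub_eq_incr0 (h : IsCauchyData Ω lam N a b w0 wbar lamT c) (i j : Fin n)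
    (ξ : ℝ) : lam i (Function.update wbar j (wTilde0 N w0 ξ j)) - lam i wbar =
      (lamT i - lamT j) * incr0 N w0 wbar j ξ :=
  h.isRichSystem.lam_update_sub h.speeds h.box_subset h.wbar_mem i j
    (apply_mem_Icc (h.wTilde0_mem ξ) j)

theorem one_div_sub_eq_sum (h : IsCauchyData Ω lam N a b w0 wbar lamT c) (ξ : ℝ) :
    1 / N (wTilde0 N w0 ξ) - 1 / N wbar = ∑ j, incr0 N w0 wbar j ξ := by
  rw [h.isRichSystem.one_div_eq h.speeds h.box_subset h.wbar_mem (h.wTilde0_mem ξ)]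
  simp [incr0]

/-- This is the explicit formula for `position` at time `0`, where it coincides with `X⁰`. -/
theorem X0_eq (h : IsCauchyData Ω lam N a b w0 wbar lamT c) (y : ℝ) :
    X0 N w0 y = 1 / N wbar * y + ∑ j, incrInt N w0 wbar j y := by
  rw [← h.position_of_nonpos le_rfl]
  simp [position]

theorem strictMono_speeds (h : IsCauchyData Ω lam N a b w0 wbar lamT c) : StrictMono lamT :=
  h.isRichSystem.speed_strictMono h.speeds (h.box_subset h.wbar_mem)

/-- The integral of `incr0` along a line that is not characteristic. -/
theorem mul_integral_incr0_comp (h : IsCauchyData Ω lam N a b w0 wbar lamT c) (j : Fin n)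
    (y : ℝ) {s : ℝ} (hs : s ≠ 0) :
    Integrable (fun τ => incr0 N w0 wbar j (y + s * τ)) ∧
    s * ∫ τ in Ioi (0 : ℝ), incr0 N w0 wbar j (y + s * τ) =
      (if 0 < s then incrTop N w0 wbar j else incrBot N w0 wbar j) - incrInt N w0 wbar j y := by
  have hi : Integrable (fun τ => incr0 N w0 wbar j (y + s * τ)) :=
    ((h.integrable_incr0 j).comp_add_left y).comp_mul_left' hs
  refine ⟨hi, ?_⟩
  have h1 := (intervalIntegral_tendsto_integral_Ioi 0 hi.integrableOn
    (tendsto_id (x := atTop))).const_mul s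
  have h2 : ∀ T : ℝ, s * ∫ τ in (0 : ℝ)..T, incr0 N w0 wbar j (y + s * τ) =
      incrInt N w0 wbar j (y + s * T) - incrInt N w0 wbar j y := by
    intro T
    rw [intervalIntegral.integral_comp_add_mul _ hs, smul_eq_mul, mul_inv_cancel_left₀ hs, mul_zero,
      add_zero, incrInt, incrInt, intervalIntegral.integral_interval_sub_left]
    · exact (h.integrable_incr0 j).intervalIntegrable
    · exact (h.integrable_incr0 j).intervalIntegrable
  simp only [id, h2] at h1
  refine tendsto_nhds_unique h1 (Tendsto.sub_const ?_ _)
  rcases hs.lt_or_gt with hneg | hpos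
  · rw [if_neg hneg.not_gt]
    exact (h.tendsto_incrInt_atBot j).comp
      (tendsto_atBot_add_const_left _ _ (tendsto_id.const_mul_atTop_of_neg hneg))
  · rw [if_pos hpos]
    exact (h.tendsto_incrInt_atTop j).comp
      (tendsto_atTop_add_const_left _ _ (tendsto_id.const_mul_atTop hpos))

/-- The function `ψᵢ` gives the asymptotic positions. -/
theorem psi_X0 (h : IsCauchyData Ω lam N a b w0 wbar lamT c) {i k : Fin n}
    (hk : lamT i ≠ 0 → k ≠ i) (y : ℝ) :
    psi lam N w0 wbar lamT i k (X0 N w0 y) = asymPosition N w0 wbar i y := by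
  have hmono := h.strictMono_speeds
  have hsum1 : ∀ s : Set ℝ, ∫ ξ in s, (1 / N (wTilde0 N w0 ξ) - 1 / N wbar) =
      ∑ j, ∫ ξ in s, incr0 N w0 wbar j ξ := fun s => by
    simp only [h.one_div_sub_eq_sum]
    exact integral_finsetSum _ fun j _ => (h.integrable_incr0 j).integrableOn
  rw [psi, psi1, psi2, h.Z0_X0, asymPosition, h.X0_eq]
  simp only [h.lam_update_sub_eq_incr0, integral_const_mul, hsum1, h.integral_incr0,
    h.integral_Ioi_incr0, h.integral_Iic_incr0, Finset.sum_sub_distrib]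
  -- The target minus `X⁰ (y)` is the sum over `j < i` of `incrTop - incrInt` and over `j > i` of
  -- `incrBot - incrInt`, with no `i`-th term. For `λ̃ᵢ > 0`, `ψᵢ₂` supplies `incrTop - incrInt` for
  -- every `j`; in `ψᵢ₁` the sum exchanges `incrTop` for `incrBot` when `j > i`, and the term with
  -- `k` cancels `j = i`. The case `λ̃ᵢ < 0` is the mirror image.
  rcases lt_trichotomy (lamT i) 0 with hi | hi | hi
  · have hki : lamT i - lamT k ≠ 0 :=
      sub_ne_zero.2 fun he => hk hi.ne (hmono.injective he).symm
    have h1 : ∑ j ∈ Finset.Iio i, 1 / (lamT i - lamT j) * ((lamT i - lamT j) *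
        (incrTop N w0 wbar j - incrBot N w0 wbar j)) =
        ∑ j ∈ Finset.Iio i, (incrTop N w0 wbar j - incrBot N w0 wbar j) := by
      refine Finset.sum_congr rfl fun j hj => ?_
      have : lamT i - lamT j ≠ 0 := sub_ne_zero.2 (hmono (Finset.mem_Iio.1 hj)).ne'
      field_simp
    have h2 : ∀ r, 1 / (lamT i - lamT k) * -((lamT k - lamT i) * r) = r := fun r => by
      field_simp
      ring
    simp only [if_neg hi.not_gt, if_neg hi.ne, h1, h2, Finset.sum_sub_distrib]
    rw [Fin.sum_eq_sum_Iio_add_sum_Ioi (fun j => incrBot N w0 wbar j) i]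
    ring
  -- When `λ̃ᵢ = 0` the characteristic is the vertical line `z = y`. The `j`-th component sweeps the
  -- half-line to the right of `y` if `λ̃ⱼ < 0`, that is `j < i`, and the one to the left if `j >
  -- i`.
  · have h1 : ∀ τ, lam i (wTilde N w0 lamT τ y) - lam i wbar =
        ∑ j, (lamT i - lamT j) * incr0 N w0 wbar j (y + -lamT j * τ) := fun τ => by
      rw [h.isRichSystem.lam_eq h.speeds h.box_subset h.wbar_mem (h.wTilde_mem τ y) i]
      simp [incr0, wTilde, sub_eq_add_neg]
    have h2 : ∀ j, IntegrableOn (fun τ => (lamT i - lamT j) * incr0 N w0 wbar j (y + -lamT j * τ))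
        (Ioi 0) ∧ ∫ τ in Ioi (0 : ℝ), (lamT i - lamT j) * incr0 N w0 wbar j (y + -lamT j * τ) =
          if j = i then 0 else (if j < i then incrTop N w0 wbar j else incrBot N w0 wbar j) -
            incrInt N w0 wbar j y := by
      intro j
      by_cases hj : j = i
      · simp [hj]
      · have hne : -lamT j ≠ 0 := by
          rw [neg_ne_zero, ← hi]
          exact fun he => hj (hmono.injective he)
        obtain ⟨h3, h4⟩ := h.mul_integral_incr0_comp j y hne
        refine ⟨(h3.const_mul _).integrableOn, ?_⟩
        rw [integral_const_mul, hi, zero_sub, h4, if_neg hj]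
        have : 0 < -lamT j ↔ j < i := by
          rw [neg_pos, ← hi]
          exact hmono.lt_iff_lt
        simp only [this]
    simp only [hi, lt_irrefl, if_false, if_true]
    rw [hi] at h1 h2
    simp only [h1]
    rw [integral_finsetSum _ fun j _ => (h2 j).1]
    simp only [(h2 _).2]
    rw [Fin.sum_eq_sum_Iio_add_sum_Ioi (fun j => incrInt N w0 wbar j y) i,
      Fin.sum_eq_sum_Iio_add_sum_Ioi _ i]
    have h5 : ∑ j ∈ Finset.Iio i, (if j = i then (0 : ℝ) else
        (if j < i then incrTop N w0 wbar j else incrBot N w0 wbar j) - incrInt N w0 wbar j y) =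
        ∑ j ∈ Finset.Iio i, (incrTop N w0 wbar j - incrInt N w0 wbar j y) := by
      refine Finset.sum_congr rfl fun j hj => ?_
      have hj := Finset.mem_Iio.1 hj
      rw [if_neg hj.ne, if_pos hj]
    have h6 : ∑ j ∈ Finset.Ioi i, (if j = i then (0 : ℝ) else
        (if j < i then incrTop N w0 wbar j else incrBot N w0 wbar j) - incrInt N w0 wbar j y) =
        ∑ j ∈ Finset.Ioi i, (incrBot N w0 wbar j - incrInt N w0 wbar j y) := by
      refine Finset.sum_congr rfl fun j hj => ?_
      have hj := Finset.mem_Ioi.1 hj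
      rw [if_neg hj.ne', if_neg hj.not_gt]
    rw [h5, h6, if_pos rfl]
    simp only [Finset.sum_sub_distrib]
    ring
  · have hki : lamT i - lamT k ≠ 0 :=
      sub_ne_zero.2 fun he => hk hi.ne' (hmono.injective he).symm
    have h1 : ∑ j ∈ Finset.Ioi i, 1 / (lamT j - lamT i) * ((lamT i - lamT j) *
        (incrTop N w0 wbar j - incrBot N w0 wbar j)) =
        ∑ j ∈ Finset.Ioi i, (incrBot N w0 wbar j - incrTop N w0 wbar j) := by
      refine Finset.sum_congr rfl fun j hj => ?_
      have : lamT j - lamT i ≠ 0 := sub_ne_zero.2 (hmono (Finset.mem_Ioi.1 hj)).ne'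
      field_simp
      ring
    have h2 : ∀ r, 1 / (lamT i - lamT k) * ((lamT k - lamT i) * r) = -r := fun r => by
      field_simp
      ring
    simp only [if_pos hi, h1, h2, Finset.sum_sub_distrib]
    rw [Fin.sum_eq_sum_Iio_add_sum_Ioi (fun j => incrTop N w0 wbar j) i]
    ring

/-- Asymptotically the `i`-th wave has separated from the others, so the density it sees is `N` at
`w̄` with only the `i`-th entry replaced. Such states lie in the box, which bounds the slope of
`asymPosition` and of its inverse from below. -/
theorem isPotential_asymPosition (h : IsCauchyData Ω lam N a b w0 wbar lamT c) (i : Fin n) :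
    IsPotential (fun p => asymPosition N w0 wbar i p.2) (fun _ => 0)
      (fun p => 1 / N (Function.update wbar i (wTilde0 N w0 p.2 i))) := by
  obtain ⟨C, hC⟩ := h.exists_abs_incr0_le
  have h1 := isPotential_snd.comp_integral (m := 1) one_pos (fun t x y _ => by simp)
    (h.aestronglyMeasurable_incr0 i) (hC i)
  have h2 := ((isPotential_snd.const_mul (1 / N wbar)).add h1).sub_const
    (-((∑ j ∈ Finset.Iio i, incrTop N w0 wbar j) + ∑ j ∈ Finset.Ioi i, incrBot N w0 wbar j))
  have h3 := h2.congr_ae (α' := fun _ => 0)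
    (β' := fun p => 1 / N (Function.update wbar i (wTilde0 N w0 p.2 i)))
    (Eventually.of_forall fun p => by simp)
    (Eventually.of_forall fun p => by simp [incr0, invIncr])
  simpa only [sub_neg_eq_add] using! h3

theorem slope_asymPosition {C : ℝ} (hC : ∀ w ∈ Icc a b, N w ≤ C)
    (h : IsCauchyData Ω lam N a b w0 wbar lamT c) (i : Fin n) :
    SlopeAtLeast (1 / C) (fun p => asymPosition N w0 wbar i p.2) := fun t _ _ hxy =>
  (h.isPotential_asymPosition i).slope_of_le (Eventually.of_forall fun p => by
    have hmem := update_mem_Icc h.wbar_mem (apply_mem_Icc (h.wTilde0_mem p.2) i)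
    exact one_div_le_one_div_of_le (h.isRichSystem.N_pos _ (h.box_subset hmem)) (hC _ hmem)) t hxy

/-- The inverse of `asymPosition`. -/
def asymCoord (N : (Fin n → ℝ) → ℝ) (w0 : ℝ → Fin n → ℝ) (wbar : Fin n → ℝ)
    (i : Fin n) : ℝ → ℝ := Function.invFun (asymPosition N w0 wbar i)

theorem isPotential_asymCoord (h : IsCauchyData Ω lam N a b w0 wbar lamT c) (i : Fin n) :
    IsPotential (fun p => asymCoord N w0 wbar i p.2) (fun _ => 0)
      (fun p => N (Function.update wbar i (wTilde0 N w0 (asymCoord N w0 wbar i p.2) i))) := by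
  obtain ⟨m, C, -, hC0, hC⟩ := h.exists_bounds
  have := (h.slope_asymPosition (fun w hw => (hC w hw).2) i).isPotential_fibreInv
    (one_div_pos.2 hC0) (h.isPotential_asymPosition i)
  simpa [fibreInv, fibreMap, asymCoord] using! this

theorem asymPosition_asymCoord (h : IsCauchyData Ω lam N a b w0 wbar lamT c) (i : Fin n) (x : ℝ) :
    asymPosition N w0 wbar i (asymCoord N w0 wbar i x) = x := by
  obtain ⟨m, C, -, hC0, hC⟩ := h.exists_bounds
  exact (h.slope_asymPosition (fun w hw => (hC w hw).2) i).apply_fibreInv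
    (one_div_pos.2 hC0) (h.isPotential_asymPosition i).continuous 0 x

theorem asymCoord_asymPosition (h : IsCauchyData Ω lam N a b w0 wbar lamT c) (i : Fin n) (y : ℝ) :
    asymCoord N w0 wbar i (asymPosition N w0 wbar i y) = y := by
  obtain ⟨m, C, -, hC0, hC⟩ := h.exists_bounds
  exact (h.slope_asymPosition (fun w hw => (hC w hw).2) i).fibreInv_apply
    (one_div_pos.2 hC0) (h.isPotential_asymPosition i).continuous 0 y

theorem slope_asymCoord {m : ℝ} (hm : ∀ w ∈ Icc a b, m ≤ N w)
    (h : IsCauchyData Ω lam N a b w0 wbar lamT c) (i : Fin n) (x y : ℝ) (hxy : x ≤ y) :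
    m * (y - x) ≤ asymCoord N w0 wbar i y - asymCoord N w0 wbar i x :=
  (h.isPotential_asymCoord i).slope_of_le (Eventually.of_forall fun _ =>
    hm _ (update_mem_Icc h.wbar_mem (apply_mem_Icc (h.wTilde0_mem _) i))) 0 hxy

/-- Invert `ψᵢ ∘ X⁰ = asymPosition`; consequently `w⁰ᵢ ∘ ψᵢ⁻¹` is `w̃⁰ᵢ` composed with `asymCoord`.
-/
theorem invFun_psi (h : IsCauchyData Ω lam N a b w0 wbar lamT c) {i k : Fin n}
    (hk : lamT i ≠ 0 → k ≠ i) (x : ℝ) :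
    Function.invFun (psi lam N w0 wbar lamT i k) x = X0 N w0 (asymCoord N w0 wbar i x) := by
  have hinj : Function.Injective (psi lam N w0 wbar lamT i k) := by
    intro x y hxy
    rw [← h.X0_Z0 x, ← h.X0_Z0 y, h.psi_X0 hk, h.psi_X0 hk] at hxy
    have := congrArg (asymCoord N w0 wbar i) hxy
    rw [h.asymCoord_asymPosition, h.asymCoord_asymPosition] at this
    rw [← h.X0_Z0 x, ← h.X0_Z0 y, this]
  have : psi lam N w0 wbar lamT i k (X0 N w0 (asymCoord N w0 wbar i x)) = x := by
    rw [h.psi_X0 hk, h.asymPosition_asymCoord]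
  conv_lhs => rw [← this]
  exact Function.leftInverse_invFun hinj _

/-- Positions along the `i`-th characteristics, relative to the velocity `λᵢ (wbar)`, converge to
the asymptotic positions within bounded distance. -/
theorem position_sub_asymPosition (h : IsCauchyData Ω lam N a b w0 wbar lamT c) (i : Fin n) :
    (∃ B, ∀ t, 0 ≤ t → ∀ y, |position N w0 wbar lamT c (t, y + lamT i * t) - lam i wbar * t -
      asymPosition N w0 wbar i y| ≤ B) ∧
    ∀ y, Tendsto (fun t => position N w0 wbar lamT c (t, y + lamT i * t) - lam i wbar * t -
      asymPosition N w0 wbar i y) atTop (𝓝 0) := by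
  have hmono := h.strictMono_speeds
  -- The linear terms cancel because `λᵢ(w̄) = c + λ̃ᵢ / N(w̄)`, and the `i`-th primitives cancel
  -- because their argument stays at `y`.
  have key : ∀ t, 0 ≤ t → ∀ y, position N w0 wbar lamT c (t, y + lamT i * t) - lam i wbar * t -
      asymPosition N w0 wbar i y =
      (∑ j ∈ Finset.Iio i,
        (incrInt N w0 wbar j (y + (lamT i - lamT j) * t) - incrTop N w0 wbar j)) +
      ∑ j ∈ Finset.Ioi i,
        (incrInt N w0 wbar j (y + (lamT i - lamT j) * t) - incrBot N w0 wbar j) := by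
    intro t ht y
    have e : ∀ j, y + lamT i * t - lamT j * t = y + (lamT i - lamT j) * t := fun j => by ring
    simp only [position, asymPosition, max_eq_left ht, e]
    rw [Fin.sum_eq_sum_Iio_add_sum_Ioi _ i, h.lam_wbar i, Finset.sum_sub_distrib,
      Finset.sum_sub_distrib, sub_self, zero_mul, add_zero]
    ring
  have htop : ∀ j ∈ Finset.Iio i, ∀ y, Tendsto (fun t =>
      incrInt N w0 wbar j (y + (lamT i - lamT j) * t) - incrTop N w0 wbar j) atTop (𝓝 0) := by
    intro j hj y
    have hpos : 0 < lamT i - lamT j := sub_pos.2 (hmono (Finset.mem_Iio.1 hj))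
    have := ((h.tendsto_incrInt_atTop j).comp (tendsto_atTop_add_const_left _ y
      (tendsto_id.const_mul_atTop hpos))).sub_const (incrTop N w0 wbar j)
    simpa using! this
  have hbot : ∀ j ∈ Finset.Ioi i, ∀ y, Tendsto (fun t =>
      incrInt N w0 wbar j (y + (lamT i - lamT j) * t) - incrBot N w0 wbar j) atTop (𝓝 0) := by
    intro j hj y
    have hneg : lamT i - lamT j < 0 := sub_neg.2 (hmono (Finset.mem_Ioi.1 hj))
    have := ((h.tendsto_incrInt_atBot j).comp (tendsto_atBot_add_const_left _ y
      (tendsto_id.const_mul_atTop_of_neg hneg))).sub_const (incrBot N w0 wbar j)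
    simpa using! this
  constructor
  · have hT : ∀ j, |incrTop N w0 wbar j| ≤ ∫ ξ, |incr0 N w0 wbar j ξ| := fun j =>
      le_of_tendsto (h.tendsto_incrInt_atTop j).abs (Eventually.of_forall (h.abs_incrInt_le j))
    have hB : ∀ j, |incrBot N w0 wbar j| ≤ ∫ ξ, |incr0 N w0 wbar j ξ| := fun j =>
      le_of_tendsto (h.tendsto_incrInt_atBot j).abs (Eventually.of_forall (h.abs_incrInt_le j))
    refine ⟨(∑ j ∈ Finset.Iio i, 2 * ∫ ξ, |incr0 N w0 wbar j ξ|) +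
      ∑ j ∈ Finset.Ioi i, 2 * ∫ ξ, |incr0 N w0 wbar j ξ|, fun t ht y => ?_⟩
    rw [key t ht y]
    refine (abs_add_le _ _).trans (add_le_add ?_ ?_)
    · refine (Finset.abs_sum_le_sum_abs _ _).trans (Finset.sum_le_sum fun j _ => ?_)
      refine (abs_sub _ _).trans ?_
      linarith [hT j, h.abs_incrInt_le j (y + (lamT i - lamT j) * t)]
    · refine (Finset.abs_sum_le_sum_abs _ _).trans (Finset.sum_le_sum fun j _ => ?_)
      refine (abs_sub _ _).trans ?_
      linarith [hB j, h.abs_incrInt_le j (y + (lamT i - lamT j) * t)]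
  · intro y
    have := (tendsto_finsetSum _ fun j hj => htop j hj y).add
      (tendsto_finsetSum _ fun j hj => hbot j hj y)
    simp only [Finset.sum_const_zero, add_zero] at this
    refine this.congr' ?_
    filter_upwards [eventually_ge_atTop 0] with t ht
    rw [key t ht y]

/-- Convergence to a superposition of travelling waves. -/
theorem tendsto_eLpNorm_sub_travellingWave (h : IsCauchyData Ω lam N a b w0 wbar lamT c)
    {i k : Fin n} (hk : lamT i ≠ 0 → k ≠ i) :
    Tendsto (fun t : ℝ => eLpNorm (fun x => richSol N w0 wbar lamT c t x i -
      w0 (Function.invFun (psi lam N w0 wbar lamT i k) (x - lam i wbar * t)) i) 1 volume)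
      atTop (𝓝 0) := by
  obtain ⟨m, C, hm, -, hC⟩ := h.exists_bounds
  have hmN : ∀ w ∈ Icc a b, m ≤ N w := fun w hw => (hC w hw).1
  obtain ⟨L, hL⟩ := (h.isPotential_charCoord i).lipschitz
  obtain ⟨⟨B, hB⟩, hlim⟩ := h.position_sub_asymPosition i
  -- The characteristic coordinate in the frame moving with velocity `λᵢ(w̄)`; its limit is
  -- `asymCoord`.
  set θ : ℝ → ℝ → ℝ := fun t x => charCoord N w0 wbar lamT c i (t, x + lam i wbar * t) with hθ
  have hθs : ∀ t x y, x ≤ y → m * (y - x) ≤ θ t y - θ t x := fun t x y hxy => by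
    have := h.slope_charCoord hmN i t (x + lam i wbar * t) (y + lam i wbar * t) (by linarith)
    simpa using this
  have hθm : ∀ t, Measurable (θ t) := fun t =>
    ((hL.slice_snd t).continuous.comp (continuous_id.add continuous_const)).measurable
  have hAs := h.slope_asymCoord hmN i
  have hAm : Measurable (asymCoord N w0 wbar i) :=
    ((h.isPotential_asymCoord i).continuous.comp (Continuous.prodMk_right (0 : ℝ))).measurable
  -- At the actual position of the characteristic starting at `y = asymCoord x` the coordinate is
  -- exactly `y`, so the Lipschitz bound of `charCoord` turns convergence of positions into
  -- convergence of coordinates.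
  have hdist : ∀ t, 0 ≤ t → ∀ x, |θ t x - asymCoord N w0 wbar i x| ≤
      L * |position N w0 wbar lamT c (t, asymCoord N w0 wbar i x + lamT i * t) -
        lam i wbar * t - asymPosition N w0 wbar i (asymCoord N w0 wbar i x)| := by
    intro t ht x
    set y := asymCoord N w0 wbar i x with hy
    have h1 : charCoord N w0 wbar lamT c i
        (t, position N w0 wbar lamT c (t, y + lamT i * t)) = y := by
      rw [charCoord, h.lagCoord_position, max_eq_left ht]
      ring
    have h2 := (hL.slice_snd t).dist_le_mul (x + lam i wbar * t)
      (position N w0 wbar lamT c (t, y + lamT i * t))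
    rw [h1, Real.dist_eq, Real.dist_eq] at h2
    rw [hy, h.asymPosition_asymCoord, ← hy]
    have e : |position N w0 wbar lamT c (t, y + lamT i * t) - lam i wbar * t - x| =
        |x + lam i wbar * t - position N w0 wbar lamT c (t, y + lamT i * t)| := by
      rw [← abs_neg]
      congr 1
      ring
    rw [e]
    exact h2
  have hmain := tendsto_eLpNorm_comp_sub (l := atTop) (h.integrable_wTilde0_sub i) (θ := θ)
    (θ₀ := asymCoord N w0 wbar i) hm hθm hAm hθs hAs (fun x => ?_) (C := L * B) ?_
  · refine hmain.congr fun t => ?_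
    have hmeas : AEStronglyMeasurable (fun x => (wTilde0 N w0 (θ t x) i - wbar i) -
        (wTilde0 N w0 (asymCoord N w0 wbar i x) i - wbar i)) :=
      ((integrable_comp_of_slope hm (hθm t) (hθs t) (h.integrable_wTilde0_sub i)).sub
        (integrable_comp_of_slope hm hAm hAs (h.integrable_wTilde0_sub i))).aestronglyMeasurable
    -- Translation invariance of the `L¹` norm returns from the moving frame to the fixed one.
    rw [← eLpNorm_comp_measurePreserving hmeas
      (measurePreserving_sub_right volume (lam i wbar * t))]
    congr 1
    ext x
    simp [hθ, richSol, h.invFun_psi hk, wTilde0]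
  · have h1 := ((hlim (asymCoord N w0 wbar i x)).abs).const_mul (L : ℝ)
    rw [abs_zero, mul_zero] at h1
    rw [tendsto_iff_dist_tendsto_zero]
    refine squeeze_zero' (Eventually.of_forall fun _ => dist_nonneg) ?_ h1
    filter_upwards [eventually_ge_atTop 0] with t ht
    exact hdist t ht x
  · filter_upwards [eventually_ge_atTop 0] with t ht x
    exact (hdist t ht x).trans (mul_le_mul_of_nonneg_left (hB t ht _) L.2)

/-- The solution does not depend on the choice of the Lagrangian speeds. -/
theorem richSol_eq_richSol (h : IsCauchyData Ω lam N a b w0 wbar lamT c) {lamT' : Fin n → ℝ}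
    {c' : ℝ} (h' : IsCauchyData Ω lam N a b w0 wbar lamT' c') :
    richSol N w0 wbar lamT c = richSol N w0 wbar lamT' c' := by
  rcases isEmpty_or_nonempty (Fin n) with hn | ⟨⟨k⟩⟩
  · funext t x
    exact Subsingleton.elim _ _
  set d := lamT' k - lamT k with hd
  have hN := h.isRichSystem.N_pos _ (h.box_subset h.wbar_mem)
  -- A common shift `d` of the speeds moves the Lagrangian coordinate by `d t⁺`, with `c`
  -- compensating, and therefore leaves every `charCoord` unchanged.
  have hshift : ∀ j, lamT' j = lamT j + d := by
    intro j
    have h1 := h.isRichSystem.sub_speed h.speeds (h.box_subset h.wbar_mem) j k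
    have h2 := h.isRichSystem.sub_speed h'.speeds (h.box_subset h.wbar_mem) j k
    have h3 : lamT j - lamT k = lamT' j - lamT' k :=
      mul_right_cancel₀ (one_div_pos.2 hN).ne' (h1.symm.trans h2)
    linarith
  have hc : c' = c - d * (1 / N wbar) := by
    have h1 := h.lam_wbar k
    have h2 := h'.lam_wbar k
    rw [hshift k] at h2
    linarith
  have hpos : ∀ t z, position N w0 wbar lamT' c' (t, z + d * max t 0) =
      position N w0 wbar lamT c (t, z) := by
    intro t z
    simp only [position, hc, hshift]
    congr 1
    · ring
    · refine Finset.sum_congr rfl fun j _ => ?_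
      congr 1
      ring
  have hlag : ∀ t x, lagCoord N w0 wbar lamT' c' (t, x) =
      lagCoord N w0 wbar lamT c (t, x) + d * max t 0 := by
    intro t x
    have h1 := hpos t (lagCoord N w0 wbar lamT c (t, x))
    rw [h.position_lagCoord] at h1
    rw [← h1, h'.lagCoord_position, h1]
  funext t x i
  have e : lagCoord N w0 wbar lamT c (t, x) - lamT i * max t 0 =
      lagCoord N w0 wbar lamT c (t, x) + d * max t 0 - (lamT i + d) * max t 0 := by
    ring
  simp only [richSol, charCoord, hlag, hshift, e]

end IsCauchyData

end

theorem theorem3p1 {n : ℕ} (Ω : Set (Fin n → ℝ)) (lam : Fin n → (Fin n → ℝ) → ℝ)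
    (N : (Fin n → ℝ) → ℝ) (hsys : IsRichSystem Ω lam N)
    (a b : Fin n → ℝ) (hab : Set.Icc a b ⊆ Ω)
    (w0 : ℝ → Fin n → ℝ) (hw0 : ∀ x, w0 x ∈ Set.Icc a b)
    (wbar : Fin n → ℝ) (hL1 : Integrable (fun x => w0 x - wbar) volume)
    (htop : Tendsto w0 atTop (𝓝 wbar)) (hbot : Tendsto w0 atBot (𝓝 wbar)) :
    (∃ lamT : Fin n → ℝ, IsLagrangianSpeeds Ω lam N lamT) ∧
    ∃ w : ℝ → ℝ → Fin n → ℝ,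
      IsEntropySolution Ω lam N w0 w ∧ ContinuousInL1loc w ∧
      (∀ v : ℝ → ℝ → Fin n → ℝ, IsEntropySolution Ω lam N w0 v →
        ∀ᵐ p ∂halfPlane, v p.1 p.2 = w p.1 p.2) ∧
      ∀ lamT : Fin n → ℝ, IsLagrangianSpeeds Ω lam N lamT →
        ∀ i k : Fin n, (lamT i ≠ 0 → k ≠ i) →
          (∃ L, LipschitzWith L (psi lam N w0 wbar lamT i k)) →
          ∀ C₀ : ℝ, 0 < C₀ →
          (∀ᵐ x : ℝ, C₀ ≤ deriv (psi lam N w0 wbar lamT i k) x) →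
          Tendsto
            (fun t : ℝ => eLpNorm
              (fun x : ℝ => w t x i -
                w0 (Function.invFun (psi lam N w0 wbar lamT i k) (x - lam i wbar * t)) i)
              1 volume)
            atTop (𝓝 0) := by
  have hwbar : wbar ∈ Icc a b := isClosed_Icc.mem_of_tendsto htop (Eventually.of_forall hw0)
  have hdata : ∀ lamT : Fin n → ℝ, IsLagrangianSpeeds Ω lam N lamT →
      ∃ c, IsCauchyData Ω lam N a b w0 wbar lamT c := by
    intro lamT hT
    obtain ⟨M, hM⟩ := id hT
    -- Dividing `N λᵢ - λ̃ᵢ = M` by `N` at `w̄` gives the common value of `λᵢ - λ̃ᵢ / N`.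
    refine ⟨M wbar / N wbar, hsys, hab, hw0, hwbar, hL1, hT, fun i => ?_⟩
    have h1 := hM wbar (hab hwbar) i
    have h2 := (hsys.N_pos _ (hab hwbar)).ne'
    field_simp
    linarith
  obtain ⟨lamT, hT⟩ := hsys.exists_lagrangianSpeeds (hab hwbar)
  obtain ⟨c, h⟩ := hdata lamT hT
  refine ⟨⟨lamT, hT⟩, richSol N w0 wbar lamT c, h.isEntropySolution_richSol,
    h.continuousInL1loc_richSol, fun v hv => h.ae_eq_richSol hv, ?_⟩
  intro lamT' hT' i k hk _ _ _ _
  obtain ⟨c', h'⟩ := hdata lamT' hT'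
  -- The solution was built from one choice of speeds; the asymptotic statement for arbitrary speeds
  -- is obtained by rebuilding the same function from those.
  rw [h.richSol_eq_richSol h']
  exact h'.tendsto_eLpNorm_sub_travellingWave hk
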